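/- **Theorem (flatness at non-generic points).** Let $n\ge 2$, let $X\subset\mathbb R^n$ be open (a local chart of the state manifold) and consider the control affine system $$\dot x=g(x,u)=f_0(x)+\sum_{i=1}^{n-1}u_if_i(x),$$ with $f_0,\dots,f_{n-1}$ of class $C^\infty$ on $X$ and $f_1,\dots,f_{n-1}$ linearly independent on a dense open subset of $X$. Let $x_0\in X$ and $1<p\le n$ be such that $\operatorname{Span}\{f_1(x_0),\dots,f_{n-1}(x_0)\}$ has dimension $n-p$ and, after renumbering, is spanned by $f_1(x_0),\dots,f_{n-p}(x_0)$. Put $u_a=(u_1,\dots,u_{n-p})$, $u_b=(u_{n-p+1},\dots,u_{n-1})$, $\overline u=(u,\dot u,\ddot u,\dots)$, $\overline u_b=(u_b,\dot u_b,\ddot u_b,\dots)\in\mathbb R^{p-1}_\infty=(\mathbb R^{p-1})^{\mathbb N}$ with the product topology, and $\overline u_b^{(s)}=(u_b,\dots,u_b^{(s)})$, which is void if $s<0$. A function of $(x,\overline u)$ or $(x,\overline u_b)$ is called smooth on an open set if it depends there on finitely many coordinates only and is $C^\infty$ in them. Let $$F_0^b=f_0(x)+\sum_{i=n-p+1}^{n-1}u_if_i(x)+\sum_{k\ge0}u_b^{(k+1)}\frac{\partial}{\partial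 u_b^{(k)}},$$ let $\Gamma_0^a$ be the span of $f_1,\dots,f_{n-p}$ over the smooth functions of $(x,\overline u_b)$, and let $\Gamma^a_{k+1}=\Gamma^a_k+\mathrm{ad}_{F_0^b}\Gamma^a_k$ for $k\ge0$. Assume that there are an open neighborhood $V\subset X$ of $x_0$ and an open dense set $O\subset\mathbb R^{p-1}_\infty$ such that on $V\times O$: (i) for every $k\ge0$, $\Gamma^a_k$ has constant dimension $\rho_k$ and is involutive; (ii) $\Gamma^a_p=\mathrm T\mathbb R^n$. Let $r_0=\rho_0$, $r_j=\rho_j-\rho_{j-1}$ for $j\ge1$, and let $k_i=\#\{j\ge0: r_j\ge i\}$, $i=1,\dots,n-p$, be the Brunovský controllability indices. Then $p+1\ge k_1\ge\dots\ge k_{n-p}\ge 0$, $\sum_i k_i=n$, and the following hold. 1. Every point of $V\times O$ (a dense open subset of $V\times\mathbb R^{p-1}_\infty$) has an open neighborhood $W\subset V\times O$ on which there are smooth functions $\varphi_{i,0}(x,\overline u_b^{(k_i-3)})$, $i=1,\dots,n-p$, which, with $\varphi_{i,j}=L^j_{F_0^b}\varphi_{i,0}$, satisfy at every point of $W$: $L_\gamma\varphi_{i,j}=0$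 for all $\gamma\in\Gamma^a_l$ and all $j,l\ge0$ with $l\le k_i-j-2$; the $n$ functions $\varphi_{i,j}$, $0\le j\le k_i-1$, have linearly independent differentials with respect to $x$; the matrix with entries $L_{\mathrm{ad}^{k_j-1}_{F_0^b}f_i}\varphi_{j,0}$, $1\le i,j\le n-p$, is invertible. 2. For all functions $\varphi_{i,0}$ as in 1 on an open set $W\subset V\times O$, with $z_i=\varphi_{i,0}(x,\overline u_b^{(k_i-3)})$, the system is flat with flat output $(z_1,\dots,z_{n-p},u_{n-p+1},\dots,u_{n-1})$ at every point $(x,\overline u)$ with $(x,\overline u_b)\in W$. That is, near $(x,\overline u)$ this output is the zeroth order part of a Lie–Bäcklund chart. 3. $x_0$ is an apparent singularity: for every $\overline u$ with $\overline u_b\in O$, the point $(x_0,\overline u)$ belongs to some Lie–Bäcklund chart of the system and is left out by another one. Here a Lie–Bäcklund chart is a map $\psi$, smooth in every component, from a non-empty open set of $X\times\mathbb R^{n-1}_\infty$ onto an open set of $\mathbb R^{n-1}_\infty$ (coordinates $y,\dot y,\ddot y,\dots$), with an inverse that is smooth in every component, such that $\psi$ and its inverse exchange the Cartan field $g\,\partial_x+\sum_{k\ge0}u^{(k+1)}\partial_{u^{(k)}}$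 of the system and the trivial Cartan field $\sum_{k\ge0}y^{(k+1)}\partial_{y^{(k)}}$. -/

import Mathlib

open scoped ContDiff

namespace AffineFlat

/-- Infinite order jets `(x, u, u', u'', ...)`: the state `x ∈ ℝⁿ` and the sequence of all
derivatives `P.2 k = u^(k)` of the input, with the product topology. -/
abbrev Jet (n : ℕ) (ι : Type) : Type := (Fin n → ℝ) × (ℕ → ι → ℝ)

/-- The first coordinates `(x, u^(0), ..., u^(N-1))` of a jet. -/
def jetTrunc {n : ℕ} {ι : Type} (N : ℕ) (P : Jet n ι) : (Fin n → ℝ) × (Fin N → ι → ℝ) :=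
  (P.1, fun k => P.2 k)

/-- A real function on a set of jets is smooth when it depends on finitely many coordinates only
and is `C^∞` with respect to them. -/
def JetSmoothOn {n : ℕ} {ι : Type} [Fintype ι] (h : Jet n ι → ℝ) (U : Set (Jet n ι)) : Prop :=
  ∃ (N : ℕ) (H : (Fin n → ℝ) × (Fin N → ι → ℝ) → ℝ),
    ContDiffOn ℝ ∞ H (jetTrunc N '' U) ∧ ∀ P ∈ U, h P = H (jetTrunc N P)

/-- Vector fields on the space of jets. -/
abbrev JetField (n : ℕ) (ι : Type) : Type := Jet n ι → Jet n ι

/-- Lie derivative `L_C h` of a function along a vector field: the derivative at `P` in the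
direction `C P`. For a smooth `h` this is
`∑ C_{x_i} ∂h/∂x_i + ∑ C_{u_i^(k)} ∂h/∂u_i^(k)`, a finite sum. -/
noncomputable def lieDerivative {n : ℕ} {ι : Type} (C : JetField n ι) (h : Jet n ι → ℝ) :
    Jet n ι → ℝ :=
  fun P => lineDeriv ℝ h P (C P)

/-- Lie bracket `[η, γ] = (∂γ) η - (∂η) γ`, coordinate by coordinate. -/
noncomputable def jetBracket {n : ℕ} {ι : Type} (η γ : JetField n ι) : JetField n ι :=
  fun P =>
    (fun i => lieDerivative η (fun Q => (γ Q).1 i) P - lieDerivative γ (fun Q => (η Q).1 i) P,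
     fun k j =>
       lieDerivative η (fun Q => (γ Q).2 k j) P - lieDerivative γ (fun Q => (η Q).2 k j) P)

/-- The Cartan field `g ∂/∂x + ∑ u^(k+1) ∂/∂u^(k)` of the system `x' = g(x, u)`. -/
def cartanField {n : ℕ} {ι : Type} (g : (Fin n → ℝ) → (ι → ℝ) → Fin n → ℝ) : JetField n ι :=
  fun P => (g P.1 (P.2 0), fun k => P.2 (k + 1))

/-! ### Lie-Bäcklund isomorphisms, flatness, apparent singularities -/

/-- `Ψ : U → U'` is a Lie-Bäcklund isomorphism with inverse `Φ` between the system `x' = g(x, u)`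
on `X` and the system `y' = γ(y, v)` on `Y`: both maps are smooth, and they exchange the Cartan
fields. -/
structure IsLieBacklundIso {n m : ℕ} {ι κ : Type} [Fintype ι] [Fintype κ]
    (X : Set (Fin n → ℝ)) (g : (Fin n → ℝ) → (ι → ℝ) → Fin n → ℝ)
    (Y : Set (Fin m → ℝ)) (γ : (Fin m → ℝ) → (κ → ℝ) → Fin m → ℝ)
    (U : Set (Jet n ι)) (U' : Set (Jet m κ))
    (Ψ : Jet n ι → Jet m κ) (Φ : Jet m κ → Jet n ι) : Prop where
  isOpen_source : IsOpen U
  isOpen_target : IsOpen U'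
  source_subset : U ⊆ X ×ˢ Set.univ
  target_subset : U' ⊆ Y ×ˢ Set.univ
  mapsTo : Set.MapsTo Ψ U U'
  mapsTo_inv : Set.MapsTo Φ U' U
  leftInv : ∀ P ∈ U, Φ (Ψ P) = P
  rightInv : ∀ Q ∈ U', Ψ (Φ Q) = Q
  smooth_state : ∀ i, JetSmoothOn (fun P => (Ψ P).1 i) U
  smooth_input : ∀ k j, JetSmoothOn (fun P => (Ψ P).2 k j) U
  smooth_inv_state : ∀ i, JetSmoothOn (fun Q => (Φ Q).1 i) U'
  smooth_inv_input : ∀ k j, JetSmoothOn (fun Q => (Φ Q).2 k j) U'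
  related_state : ∀ P ∈ U, ∀ i,
    lieDerivative (cartanField g) (fun R => (Ψ R).1 i) P = (cartanField γ (Ψ P)).1 i
  related_input : ∀ P ∈ U, ∀ k j,
    lieDerivative (cartanField g) (fun R => (Ψ R).2 k j) P = (cartanField γ (Ψ P)).2 k j
  related_inv_state : ∀ Q ∈ U', ∀ i,
    lieDerivative (cartanField γ) (fun R => (Φ R).1 i) Q = (cartanField g (Φ Q)).1 i
  related_inv_input : ∀ Q ∈ U', ∀ k j,
    lieDerivative (cartanField γ) (fun R => (Φ R).2 k j) Q = (cartanField g (Φ Q)).2 k j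

/-- The trivial system: no state, so that its jets are the sequences `(y, y', y'', ...)` and its
Cartan field is `∑ y^(k+1) ∂/∂y^(k)`. -/
def trivialSystem (ι : Type) : (Fin 0 → ℝ) → (ι → ℝ) → Fin 0 → ℝ := fun _ _ => 0

/-- `ψ` is a Lie-Bäcklund isomorphism of the non-empty open set `U` onto an open set of jets of
the trivial system with the same number of inputs. -/
def IsLieBacklundChart {n : ℕ} {ι : Type} [Fintype ι] (X : Set (Fin n → ℝ))
    (g : (Fin n → ℝ) → (ι → ℝ) → Fin n → ℝ) (U : Set (Jet n ι)) (ψ : Jet n ι → Jet 0 ι) : Prop :=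
  U.Nonempty ∧ ∃ (U' : Set (Jet 0 ι)) (φ : Jet 0 ι → Jet n ι),
    IsLieBacklundIso X g Set.univ (trivialSystem ι) U U' ψ φ

/-- The system `x' = g(x, u)` on `X` is flat at the jet `P` with flat output `y`: near `P`, `y` is
the zeroth order part of a Lie-Bäcklund isomorphism onto the trivial system. -/
def IsFlatOutputAt {n : ℕ} {ι : Type} [Fintype ι] (X : Set (Fin n → ℝ))
    (g : (Fin n → ℝ) → (ι → ℝ) → Fin n → ℝ) (y : Jet n ι → ι → ℝ) (P : Jet n ι) : Prop :=
  ∃ (U : Set (Jet n ι)) (ψ : Jet n ι → Jet 0 ι),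
    IsLieBacklundChart X g U ψ ∧ P ∈ U ∧ ∀ Q ∈ U, (ψ Q).2 0 = y Q

/-- `P` is left out by some Lie-Bäcklund chart, but belongs to another one. -/
def IsApparentSingularity {n : ℕ} {ι : Type} [Fintype ι] (X : Set (Fin n → ℝ))
    (g : (Fin n → ℝ) → (ι → ℝ) → Fin n → ℝ) (P : Jet n ι) : Prop :=
  (∃ (U : Set (Jet n ι)) (ψ : Jet n ι → Jet 0 ι), IsLieBacklundChart X g U ψ ∧ P ∉ U) ∧
  (∃ (U : Set (Jet n ι)) (ψ : Jet n ι → Jet 0 ι), IsLieBacklundChart X g U ψ ∧ P ∈ U)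

/-! ### Control affine systems with inputs split into `u = (u_a, u_b)` -/

/-- Right-hand side `f₀(x) + ∑ uᵢ fᵢ(x)` of a control affine system. -/
def affineSystem {n : ℕ} {ι : Type} [Fintype ι] (f₀ : (Fin n → ℝ) → Fin n → ℝ)
    (f : ι → (Fin n → ℝ) → Fin n → ℝ) : (Fin n → ℝ) → (ι → ℝ) → Fin n → ℝ :=
  fun x u => f₀ x + ∑ i, u i • f i x

/-- The part `(x, u_b, u_b', ...)` of the jet `(x, u, u', ...)`. -/
def projB {n r q : ℕ} (P : Jet n (Fin r ⊕ Fin q)) : Jet n (Fin q) :=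
  (P.1, fun k j => P.2 k (Sum.inr j))

/-- The extended drift `F₀ᵇ = f₀ + u_b f_b + τ_b`, with `τ_b = ∑ u_b^(k+1) ∂/∂u_b^(k)`. -/
def extendedDrift {n r q : ℕ} (f₀ : (Fin n → ℝ) → Fin n → ℝ)
    (f : Fin r ⊕ Fin q → (Fin n → ℝ) → Fin n → ℝ) : JetField n (Fin q) :=
  cartanField (affineSystem f₀ fun j => f (Sum.inr j))

/-- A vector field of `X` seen as a vector field on jets. -/
def liftField {n : ℕ} {ι : Type} (v : (Fin n → ℝ) → Fin n → ℝ) : JetField n ι :=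
  fun P => (v P.1, 0)

/-- The vector fields of the distribution `Γᵃ_k`: `Γᵃ_0` is the span of the fields `f_a` over the
smooth functions of `(x, u_b, u_b', ...)`, and `Γᵃ_{k+1} = Γᵃ_k + ad_{F₀ᵇ} Γᵃ_k`.
Only the values of the fields over `X` matter. -/
def Gamma {n r q : ℕ} (X : Set (Fin n → ℝ)) (f₀ : (Fin n → ℝ) → Fin n → ℝ)
    (f : Fin r ⊕ Fin q → (Fin n → ℝ) → Fin n → ℝ) : ℕ → Set (JetField n (Fin q))
  | 0 => {γ | ∃ c : Fin r → Jet n (Fin q) → ℝ, (∀ i, JetSmoothOn (c i) (X ×ˢ Set.univ)) ∧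
      ∀ P, P.1 ∈ X → γ P = ∑ i, c i P • liftField (f (Sum.inl i)) P}
  | k + 1 => {γ | ∃ δ ∈ Gamma X f₀ f k, ∃ ε ∈ Gamma X f₀ f k,
      ∀ P, P.1 ∈ X → γ P = δ P + jetBracket (extendedDrift f₀ f) ε P}

/-- The values `Γ(P)` at the point `P` of a set `Γ` of vector fields. -/
def valuesAt {n : ℕ} {ι : Type} (Γ : Set (JetField n ι)) (P : Jet n ι) : Set (Jet n ι) :=
  {v | ∃ γ ∈ Γ, γ P = v}

/-- The dimension of the vector space `Γ(P)`. -/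
noncomputable def dimAt {n : ℕ} {ι : Type} (Γ : Set (JetField n ι)) (P : Jet n ι) : ℕ :=
  Module.finrank ℝ (Submodule.span ℝ (valuesAt Γ P))

/-- `Γ` is involutive on `S`: brackets of fields of `Γ` have their values in `Γ`. -/
def IsInvolutiveOn {n : ℕ} {ι : Type} (Γ : Set (JetField n ι)) (S : Set (Jet n ι)) : Prop :=
  ∀ γ ∈ Γ, ∀ δ ∈ Γ, ∀ P ∈ S, jetBracket γ δ P ∈ valuesAt Γ P

/-- The dimension jumps `r₀ = ρ₀`, `r_{j+1} = ρ_{j+1} - ρ_j` of a sequence of dimensions. -/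
def dimJump (ρ : ℕ → ℕ) : ℕ → ℕ
  | 0 => ρ 0
  | j + 1 => ρ (j + 1) - ρ j

/-- The Brunovský controllability index `#{j | r_j ≥ i}`, where `i` is counted from 1; the
argument `i` of the function is counted from 0. -/
noncomputable def brunovskyIndex (ρ : ℕ → ℕ) (i : ℕ) : ℕ :=
  Set.ncard {j | i + 1 ≤ dimJump ρ j}

/-- The function `(x, u_b, u_b', ...) ↦ φ (x, u_b, ..., u_b^(N-1))`. -/
def pullTrunc {n : ℕ} {ι : Type} {N : ℕ} (φ : (Fin n → ℝ) × (Fin N → ι → ℝ) → ℝ) : Jet n ι → ℝ :=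
  fun P => φ (jetTrunc N P)

/-- The functions `φᵢ(x, u_b, ..., u_b^(kᵢ-3))` (functions of `x` alone if `kᵢ ≤ 2`), `i < r`,
form a Brunovský family of first integrals on `W`: they are smooth; with
`φ_{i,j} = L_{F₀ᵇ}^j φᵢ`, the function `φ_{i,j}` is a first integral of `Γᵃ_l` for all
`l ≤ kᵢ - j - 2`; the `φ_{i,j}`, `j < kᵢ`, are independent functions of `x`; and the matrix with
entries `L_{ad^{kⱼ-1} fᵢ} φⱼ` is invertible. -/
structure IsBrunovskyFamily {n r q : ℕ} (X : Set (Fin n → ℝ)) (f₀ : (Fin n → ℝ) → Fin n → ℝ)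
    (f : Fin r ⊕ Fin q → (Fin n → ℝ) → Fin n → ℝ) (k : Fin r → ℕ) (W : Set (Jet n (Fin q)))
    (φ : ∀ i : Fin r, (Fin n → ℝ) × (Fin (k i - 2) → Fin q → ℝ) → ℝ) : Prop where
  smooth : ∀ i, ContDiffOn ℝ ∞ (φ i) (jetTrunc (k i - 2) '' W)
  firstIntegral : ∀ (i : Fin r) (j l : ℕ), j + l + 2 ≤ k i → ∀ γ ∈ Gamma X f₀ f l, ∀ P ∈ W,
    lieDerivative γ ((lieDerivative (extendedDrift f₀ f))^[j] (pullTrunc (φ i))) P = 0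
  independent : ∀ P ∈ W, LinearIndependent ℝ
    (fun (s : Σ i : Fin r, Fin (k i)) (l : Fin n) =>
      lineDeriv ℝ ((lieDerivative (extendedDrift f₀ f))^[(s.2 : ℕ)] (pullTrunc (φ s.1))) P
        (Pi.single l 1, 0))
  invertible : ∀ P ∈ W, (Matrix.of fun i j : Fin r =>
    lieDerivative ((jetBracket (extendedDrift f₀ f))^[k j - 1] (liftField (f (Sum.inl i))))
      (pullTrunc (φ j)) P).det ≠ 0

/-- The output `(z, u_b)` with `zᵢ = φᵢ(x, u_b, ..., u_b^(kᵢ-3))`. -/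
def brunovskyOutput {n r q : ℕ} {k : Fin r → ℕ}
    (φ : ∀ i : Fin r, (Fin n → ℝ) × (Fin (k i - 2) → Fin q → ℝ) → ℝ) :
    Jet n (Fin r ⊕ Fin q) → Fin r ⊕ Fin q → ℝ :=
  fun P => Sum.elim (fun i => pullTrunc (φ i) (projB P)) (fun j => P.2 0 (Sum.inr j))

end AffineFlat

/-!
The derivatives of `u_b` are parameters for the distributions `Γᵃ_k`: the fields of `Γᵃ_k` are
combinations of the brackets `ad^m f_i`, `m ≤ k`, of the extended drift with the fields of `u_a`
(`exists_eq_sum_of_mem_Gamma`), these brackets have components along the states only, and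
`ad^m f_i` depends on `x, u_b, ..., u_b^(m-1)` only (`factorsOn_iteratedBracket`). By the Leibniz
rule, dimensions, involutivity and first integrals can thus all be read on the iterated brackets,
in finite dimensional spaces of truncated jets.

*First integrals.* Let `Γᵃ_k` be involutive of constant dimension. Every covector of the state space
that annihilates `Γᵃ_k` at a jet is the differential there of a local first integral, which depends
on `x, u_b, ..., u_b^(k-1)` (`exists_firstIntegral_iteratedBracket`). This is Frobenius' theorem
(`exists_firstIntegral`). Its proof normalises a basis of the distribution so that the fields
commute, and sends a point to the point of its leaf on a transversal. Smooth dependence of this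
point is obtained from the implicit function theorem in a space of continuous paths
(`exists_smooth_paths`), and constancy along the leaves from a linear differential inequality
(`exists_firstIntegral_of_commute`).

*Brunovský indices.* If `h` is a first integral of `Γᵃ_l`, then its derivative along the drift is a
first integral of `Γᵃ_{l-1}`, and `L_{ad^l f_i} (L h) = -L_{ad^{l+1} f_i} h`. Hence the dual of
`Γᵃ_{l+1} / Γᵃ_l`, seen in `ℝ^r` through the values on the brackets of order `l + 1`, is contained
in the dual of `Γᵃ_l / Γᵃ_{l-1}` (`IsRegularOn.levelDual_succ_le`). The dimension jumps therefore
decrease, and the indices `kᵢ` are their conjugate sequence: this gives their monotonicity, the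
bound `p + 1` and the sum `n`. It also allows to choose independent vectors of `ℝ^r`, the `i`-th
one in the dual of level `kᵢ - 1`; first integrals `φᵢ` of the brackets of order less than `kᵢ - 1`
that realise these vectors have an invertible matrix `L_{ad^{kⱼ-1} fᵢ} φⱼ`. The differentials of
the `φ_{i,j}` paired with the brackets form a block triangular array with columns of that matrix,
up to signs, in the diagonal blocks, whence their independence (`linearIndependent_of_triangular`,
`isBrunovskyFamily_of_det_ne_zero`).

*Flatness.* Along the system, the derivatives of `zᵢ = φᵢ` of orders `j < kᵢ` are the `φ_{i,j}`, and
the derivative of order `kᵢ` is affine in `u_a` with an invertible linear part, the decoupling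
matrix. The local inverse of `(x, u_b, ...) ↦ (φ_{i,j}, u_b, ...)` recovers the state from the
derivatives of the output, Cramer's rule recovers `u_a`, and differentiation recovers its
derivatives. That both maps exchange the Cartan fields reduces to the uniqueness of a vector with
given values on the independent covectors `dφ_{i,j}` (`IsBrunovskyFamily.isFlatOutputAt`).

*Apparent singularity.* A chart around a jet over `x₀` can be restricted to the jets over the open
dense set where all control fields are independent, to which `x₀` does not belong.
-/

universe u

namespace AffineFlat

/-! ### Smooth local inverses -/

/-- The inverse function theorem with an inverse of class `C^∞` on a whole open set (being `C^∞`
at a point only gives, for every finite order, a neighbourhood depending on that order). -/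
theorem exists_smooth_local_inverse {E F : Type*} [NormedAddCommGroup E] [NormedSpace ℝ E]
    [CompleteSpace E] [NormedAddCommGroup F] [NormedSpace ℝ F]
    {f : E → F} {s : Set E} (hs : IsOpen s) (hf : ContDiffOn ℝ ∞ f s) {a : E} (ha : a ∈ s)
    (f' : E ≃L[ℝ] F) (hf' : HasFDerivAt f (f' : E →L[ℝ] F) a) :
    ∃ e : OpenPartialHomeomorph E F, a ∈ e.source ∧ e.source ⊆ s ∧ (∀ x, e x = f x) ∧
      ContDiffOn ℝ ∞ e.symm e.target := by
  have hfa : ContDiffAt ℝ ∞ f a := hf.contDiffAt (hs.mem_nhds ha)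
  have hcont : ContinuousOn (fderiv ℝ f) s := hf.continuousOn_fderiv_of_isOpen hs (by simp)
  have hinv : IsOpen (Set.range ((↑) : (E ≃L[ℝ] F) → E →L[ℝ] F)) := ContinuousLinearEquiv.isOpen
  have hs' : IsOpen (s ∩ fderiv ℝ f ⁻¹' Set.range ((↑) : (E ≃L[ℝ] F) → E →L[ℝ] F)) :=
    hcont.isOpen_inter_preimage hs hinv
  let e := (hfa.toOpenPartialHomeomorph f hf' (by simp)).restrOpen _ hs'
  refine ⟨e, ⟨hfa.mem_toOpenPartialHomeomorph_source hf' (by simp), ha, f', hf'.fderiv.symm⟩,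
    fun x hx => hx.2.1, fun x => rfl, ?_⟩
  intro y hy
  have hx : e.symm y ∈ e.source := e.map_target hy
  obtain ⟨g', hg'⟩ := hx.2.2
  have hfx : ContDiffAt ℝ ∞ f (e.symm y) := hf.contDiffAt (hs.mem_nhds hx.2.1)
  have hd : HasFDerivAt f (g' : E →L[ℝ] F) (e.symm y) := by
    rw [hg']; exact (hfx.differentiableAt (by simp)).hasFDerivAt
  exact (e.contDiffAt_symm hy hd hfx).contDiffWithinAt

/-! ### Superposition operators on spaces of continuous functions -/

section Superposition

variable {K : Type*} [TopologicalSpace K] [CompactSpace K]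

/-- Pointwise application `(A, h) ↦ (k ↦ A(k) h(k))`, as a continuous bilinear map. -/
noncomputable def pointwiseApply (K : Type*) [TopologicalSpace K] [CompactSpace K]
    (E F : Type*) [NormedAddCommGroup E] [NormedSpace ℝ E]
    [NormedAddCommGroup F] [NormedSpace ℝ F] :
    C(K, E →L[ℝ] F) →L[ℝ] C(K, E) →L[ℝ] C(K, F) :=
  LinearMap.mkContinuous₂ (LinearMap.mk₂ ℝ
    (fun (A : C(K, E →L[ℝ] F)) (h : C(K, E)) => (⟨fun k => A k (h k), by fun_prop⟩ : C(K, F)))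
    (fun _ _ _ => by ext; simp) (fun _ _ _ => by ext; simp) (fun _ _ _ => by ext; simp)
    (fun _ _ _ => by ext; simp)) 1 (fun A h => by
      rw [one_mul]
      refine (ContinuousMap.norm_le _ (by positivity)).2 fun k => ?_
      exact ((A k).le_opNorm _).trans (mul_le_mul (A.norm_coe_le_norm k) (h.norm_coe_le_norm k)
        (norm_nonneg _) (norm_nonneg A)))

@[simp] theorem pointwiseApply_apply {E F : Type*} [NormedAddCommGroup E] [NormedSpace ℝ E]
    [NormedAddCommGroup F] [NormedSpace ℝ F] (A : C(K, E →L[ℝ] F)) (h : C(K, E)) (k : K) :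
    pointwiseApply K E F A h k = A k (h k) := rfl

/-- The superposition operator `z ↦ f ∘ z` has the derivative `h ↦ (Df ∘ z) h`. -/
theorem hasFDerivAt_superposition {E F : Type*} [NormedAddCommGroup E] [NormedSpace ℝ E]
    [NormedAddCommGroup F] [NormedSpace ℝ F] (f : C(E, F)) (f' : C(E, E →L[ℝ] F))
    (hf : ∀ x, HasFDerivAt f (f' x) x) (z : C(K, E)) :
    HasFDerivAt (fun w : C(K, E) => f.comp w) (pointwiseApply K E F (f'.comp z)) z := by
  rw [hasFDerivAt_iff_isLittleO_nhds_zero, Asymptotics.isLittleO_iff]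
  intro c hc
  have hcont : Continuous (fun w : C(K, E) => f'.comp w) := f'.continuous_postcomp
  have hev : ∀ᶠ w in nhds z, dist (f'.comp w) (f'.comp z) < c :=
    hcont.continuousAt.eventually (Metric.ball_mem_nhds (f'.comp z) hc)
  obtain ⟨δ, hδ, hball⟩ := Metric.eventually_nhds_iff.1 hev
  filter_upwards [Metric.ball_mem_nhds (0 : C(K, E)) hδ] with h hh
  refine (ContinuousMap.norm_le _ (by positivity)).2 fun k => ?_
  have hh' : ‖h‖ < δ := by simpa using hh
  have key : ∀ y ∈ segment ℝ (z k) (z k + h k), ‖f' y - f' (z k)‖ ≤ c := by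
    intro y hy
    rw [segment_eq_image'] at hy
    obtain ⟨s, hs, rfl⟩ := hy
    have h1 : dist (z + s • h) z < δ := by
      rw [dist_eq_norm, add_sub_cancel_left, norm_smul, Real.norm_of_nonneg hs.1]
      exact (mul_le_of_le_one_left (norm_nonneg _) hs.2).trans_lt hh'
    have h2 := (ContinuousMap.dist_apply_le_dist k).trans (hball h1).le
    rw [dist_eq_norm] at h2
    simpa using h2
  have := (convex_segment (𝕜 := ℝ) (z k) (z k + h k)).norm_image_sub_le_of_norm_hasFDerivWithin_le'
    (f := f) (f' := f') (φ := f' (z k)) (fun y _ => (hf y).hasFDerivWithinAt) key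
    (left_mem_segment ℝ _ _) (right_mem_segment ℝ _ _)
  simp only [add_sub_cancel_left] at this
  refine le_trans ?_ (this.trans (mul_le_mul_of_nonneg_left (h.norm_coe_le_norm k) hc.le))
  simp

/-- The superposition operator of a smooth map is smooth. -/
theorem contDiff_superposition {E F : Type u} [NormedAddCommGroup E] [NormedSpace ℝ E]
    [NormedAddCommGroup F] [NormedSpace ℝ F] (f : C(E, F)) (hf : ContDiff ℝ ∞ f) :
    ContDiff ℝ ∞ (fun w : C(K, E) => f.comp w) := by
  rw [contDiff_infty]
  intro n
  induction n generalizing F with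
  | zero => exact contDiff_zero.2 f.continuous_postcomp
  | succ n ih =>
    have hf' : ContDiff ℝ ∞ (fderiv ℝ f) := hf.fderiv_right (by simp)
    let f' : C(E, E →L[ℝ] F) := ⟨fderiv ℝ f, hf'.continuous⟩
    have hd : ∀ z : C(K, E), HasFDerivAt (fun w : C(K, E) => f.comp w)
        (pointwiseApply K E F (f'.comp z)) z :=
      hasFDerivAt_superposition f f' fun x => (hf.differentiable (by simp) x).hasFDerivAt
    rw [Nat.cast_succ, contDiff_succ_iff_hasFDerivAt]
    have hL : ContDiff ℝ n (fun A : C(K, E →L[ℝ] F) => pointwiseApply K E F A) := by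
      apply ContinuousLinearMap.contDiff
    exact ⟨fun z => pointwiseApply K E F (f'.comp z), hL.comp (ih f' hf'), hd⟩

end Superposition

/-! ### Integration over the unit interval -/

/-- The primitive `t ↦ ∫₀ᵗ g` of a continuous function on the unit interval. -/
noncomputable def primitiveL (E : Type*) [NormedAddCommGroup E] [NormedSpace ℝ E] :
    C(unitInterval, E) →L[ℝ] C(unitInterval, E) :=
  LinearMap.mkContinuous
    { toFun := fun g => ⟨fun t => ∫ s in (0 : ℝ)..t, g (Set.projIcc 0 1 zero_le_one s), by
        have hg : Continuous fun s : ℝ => g (Set.projIcc 0 1 zero_le_one s) :=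
          g.continuous.comp continuous_projIcc
        exact (intervalIntegral.continuous_primitive
          (fun a b => hg.intervalIntegrable a b) 0).comp continuous_subtype_val⟩
      map_add' := fun g h => by
        ext t
        exact intervalIntegral.integral_add
          ((g.continuous.comp continuous_projIcc).intervalIntegrable _ _)
          ((h.continuous.comp continuous_projIcc).intervalIntegrable _ _)
      map_smul' := fun c g => by
        ext t
        exact intervalIntegral.integral_smul _ _ } 1 (fun g => by
    rw [one_mul]
    refine (ContinuousMap.norm_le _ (norm_nonneg _)).2 fun t => ?_
    have := intervalIntegral.norm_integral_le_of_norm_le_const (a := 0) (b := (t : ℝ))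
      (f := fun s => g (Set.projIcc 0 1 zero_le_one s)) (C := ‖g‖)
      fun s _ => g.norm_coe_le_norm _
    refine this.trans ?_
    rw [sub_zero, abs_of_nonneg t.2.1]
    exact mul_le_of_le_one_right (norm_nonneg _) t.2.2)

theorem primitiveL_apply {E : Type*} [NormedAddCommGroup E] [NormedSpace ℝ E]
    (g : C(unitInterval, E)) (t : unitInterval) :
    primitiveL E g t = ∫ s in (0 : ℝ)..t, g (Set.projIcc 0 1 zero_le_one s) := rfl

theorem primitiveL_const {E : Type*} [NormedAddCommGroup E] [NormedSpace ℝ E] [CompleteSpace E]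
    (v : E) : primitiveL E (ContinuousMap.const _ v) 1 = v := by
  simp [primitiveL_apply]

/-- The integrand is extended by constants outside the unit interval, which makes its primitive
differentiable at the endpoints, from both sides. -/
theorem hasDerivAt_primitive {E : Type*} [NormedAddCommGroup E] [NormedSpace ℝ E]
    [CompleteSpace E] (g : C(unitInterval, E)) (t : ℝ) :
    HasDerivAt (fun t : ℝ => ∫ s in (0 : ℝ)..t, g (Set.projIcc 0 1 zero_le_one s))
      (g (Set.projIcc 0 1 zero_le_one t)) t := by
  have hg : Continuous fun s : ℝ => g (Set.projIcc 0 1 zero_le_one s) :=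
    g.continuous.comp continuous_projIcc
  exact intervalIntegral.integral_hasDerivAt_right (hg.intervalIntegrable _ _)
    (hg.stronglyMeasurableAtFilter _ _) hg.continuousAt

/-! ### First integrals of involutive distributions -/

section Frobenius

variable {E A : Type u} [NormedAddCommGroup E] [NormedSpace ℝ E] [NormedAddCommGroup A]
  [NormedSpace ℝ A]

/-- The constant functions on the unit interval, as a continuous linear map. -/
noncomputable def constL (E : Type*) [NormedAddCommGroup E] [NormedSpace ℝ E] :
    E →L[ℝ] C(unitInterval, E) :=
  LinearMap.mkContinuous
    { toFun := fun v => ContinuousMap.const _ v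
      map_add' := fun _ _ => rfl
      map_smul' := fun _ _ => rfl } 1 (fun v => by
    rw [one_mul]
    exact (ContinuousMap.norm_le _ (norm_nonneg _)).2 fun _ => le_rfl)

@[simp] theorem constL_apply {E : Type*} [NormedAddCommGroup E] [NormedSpace ℝ E] (v : E)
    (k : unitInterval) : constL E v k = v := rfl

/-- Smooth dependence of the solution of `y' = -e(y) π(Q - P₀)`, `y(0) = Q`, on the point `Q`
near `P₀`. It follows from the implicit function theorem in the space of continuous paths: at
`Q = P₀` the solution is constant and the derivative of the integral equation with respect to the
path is the identity. -/
theorem exists_smooth_paths [CompleteSpace E] (e : C(E, A →L[ℝ] E)) (he : ContDiff ℝ ∞ e)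
    (π : E →L[ℝ] A) (P₀ : E) :
    ∃ t : Set E, IsOpen t ∧ P₀ ∈ t ∧ ∃ Y : E → C(unitInterval, E), ContDiffOn ℝ ∞ Y t ∧
      Y P₀ = constL E P₀ ∧
      ∀ Q ∈ t, Y Q = constL E Q - primitiveL E
        (pointwiseApply _ A E (e.comp (Y Q)) (constL A (π (Q - P₀)))) := by
  let c : E × C(unitInterval, E) → (C(unitInterval, A) →L[ℝ] C(unitInterval, E)) :=
    fun x => pointwiseApply _ A E (e.comp x.2)
  have hL : ContDiff ℝ ∞ (fun B : C(unitInterval, A →L[ℝ] E) => pointwiseApply _ A E B) := by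
    apply ContinuousLinearMap.contDiff
  have hc : ContDiff ℝ ∞ c := hL.comp ((contDiff_superposition e he).comp contDiff_snd)
  let w : E × C(unitInterval, E) → C(unitInterval, A) := fun x => constL A (π (x.1 - P₀))
  have hw : ContDiff ℝ ∞ w :=
    (constL A).contDiff.comp (π.contDiff.comp (contDiff_fst.sub contDiff_const))
  let G : E × C(unitInterval, E) → E × C(unitInterval, E) :=
    fun x => (x.1, x.2 - constL E x.1 + primitiveL E (c x (w x)))
  have hG : ContDiff ℝ ∞ G :=
    contDiff_fst.prodMk ((contDiff_snd.sub ((constL E).contDiff.comp contDiff_fst)).add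
      ((primitiveL E).contDiff.comp (hc.clm_apply hw)))
  let x₀ : E × C(unitInterval, E) := (P₀, constL E P₀)
  have hw0 : w x₀ = 0 := by simp [w, x₀]
  have hGx : G x₀ = (P₀, 0) := by
    have : G x₀ = (P₀, constL E P₀ - constL E P₀ + primitiveL E (c x₀ (w x₀))) := rfl
    rw [this, hw0]; simp
  let M : E →L[ℝ] C(unitInterval, E) :=
    -constL E + (primitiveL E).comp ((c x₀).comp ((constL A).comp π))
  let G' := (ContinuousLinearEquiv.refl ℝ E).skewProd
    (ContinuousLinearEquiv.refl ℝ C(unitInterval, E)) M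
  have hwd : HasFDerivAt w ((constL A).comp (π.comp (ContinuousLinearMap.fst ℝ E _))) x₀ := by
    have h1 : HasFDerivAt (fun x : E × C(unitInterval, E) => x.1 - P₀)
        (ContinuousLinearMap.fst ℝ E _) x₀ := hasFDerivAt_fst.sub_const P₀
    exact (constL A).hasFDerivAt.comp x₀ (π.hasFDerivAt.comp x₀ h1)
  have hcd : HasFDerivAt c (fderiv ℝ c x₀) x₀ := (hc.differentiable (by simp) x₀).hasFDerivAt
  have hGd : HasFDerivAt G (G' : _ →L[ℝ] _) x₀ := by
    have h2 := (primitiveL E).hasFDerivAt.comp x₀ (hcd.clm_apply hwd)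
    have h3 := hasFDerivAt_fst.prodMk ((hasFDerivAt_snd.sub
      ((constL E).hasFDerivAt.comp x₀ (hasFDerivAt_fst (𝕜 := ℝ)))).add h2)
    refine h3.congr_fderiv ?_
    refine ContinuousLinearMap.ext fun v => ?_
    rw [hw0]
    refine Prod.ext (by simp [G']) ?_
    simp [G', M]
    abel
  obtain ⟨ε, hε0, -, hεG, hεs⟩ := exists_smooth_local_inverse isOpen_univ hG.contDiffOn
    (Set.mem_univ x₀) G' hGd
  let j : E → E × C(unitInterval, E) := fun Q => (Q, 0)
  have hj : ContDiff ℝ ∞ j := contDiff_id.prodMk contDiff_const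
  have hP₀ : j P₀ ∈ ε.target := by
    have := ε.map_source hε0
    rwa [hεG, hGx] at this
  refine ⟨j ⁻¹' ε.target, ε.open_target.preimage hj.continuous, hP₀,
    fun Q => (ε.symm (j Q)).2, ?_, ?_, ?_⟩
  · exact contDiff_snd.comp_contDiffOn (hεs.comp hj.contDiffOn fun Q hQ => hQ)
  · have h4 : ε.symm (j P₀) = x₀ := by
      have := ε.left_inv hε0
      rwa [hεG, hGx] at this
    change (ε.symm (j P₀)).2 = _
    rw [h4]
  · intro Q hQ
    have h5 : G (ε.symm (j Q)) = j Q := by rw [← hεG]; exact ε.right_inv hQ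
    have h6 : (ε.symm (j Q)).1 = Q := congrArg Prod.fst h5
    have h7 : (ε.symm (j Q)).2 - constL E (ε.symm (j Q)).1 +
      primitiveL E (c (ε.symm (j Q)) (w (ε.symm (j Q)))) = 0 := congrArg Prod.snd h5
    simp only [w, h6, c] at h7
    have h8 := eq_neg_of_add_eq_zero_left h7
    rw [sub_eq_iff_eq_add] at h8
    exact h8.trans (by abel)

/-- First integrals of a distribution spanned by commuting fields `Q ↦ e(Q) a` normalised by
`π e(Q) = id`: a point `Q` is sent to the point of its leaf on the transversal `π = π(P₀)`. -/
theorem exists_firstIntegral_of_commute [CompleteSpace E] (e : C(E, A →L[ℝ] E))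
    (he : ContDiff ℝ ∞ e) (π : E →L[ℝ] A) {P₀ : E} {U : Set E} (hU : IsOpen U) (hP₀ : P₀ ∈ U)
    (hπ : ∀ Q ∈ U, ∀ a, π (e Q a) = a)
    (hcomm : ∀ Q ∈ U, ∀ a a', fderiv ℝ e Q (e Q a) a' = fderiv ℝ e Q (e Q a') a) :
    ∃ t, IsOpen t ∧ P₀ ∈ t ∧ t ⊆ U ∧ ∃ Φ : E → E, ContDiffOn ℝ ∞ Φ t ∧
      (∀ Q ∈ t, ∀ a, fderiv ℝ Φ Q (e Q a) = 0) ∧ ∀ v, fderiv ℝ Φ P₀ v = v - e P₀ (π v) := by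
  obtain ⟨t, ht, hP₀t, Y, hY, hY₀, hYeq⟩ := exists_smooth_paths e he π P₀
  have hed : ∀ Q, HasFDerivAt e (fderiv ℝ e Q) Q :=
    fun Q => (he.differentiable (by simp) Q).hasFDerivAt
  let e' : C(E, E →L[ℝ] A →L[ℝ] E) := ⟨fderiv ℝ e, he.continuous_fderiv (by simp)⟩
  -- the linearised integral equation
  have hvar : ∀ Q ∈ t, ∀ v, fderiv ℝ Y Q v = constL E v - primitiveL E
      (pointwiseApply _ A E (e.comp (Y Q)) (constL A (π v)) +
        pointwiseApply _ A E (pointwiseApply _ E (A →L[ℝ] E) (e'.comp (Y Q)) (fderiv ℝ Y Q v))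
          (constL A (π (Q - P₀)))) := by
    intro Q hQ v
    have hYd : HasFDerivAt Y (fderiv ℝ Y Q) Q :=
      ((hY.contDiffAt (ht.mem_nhds hQ)).differentiableAt (by simp)).hasFDerivAt
    have h1 : HasFDerivAt (fun R => e.comp (Y R)) _ Q :=
      (hasFDerivAt_superposition e e' hed (Y Q)).comp Q hYd
    have hLd : HasFDerivAt (fun B : C(unitInterval, A →L[ℝ] E) => pointwiseApply _ A E B)
        (pointwiseApply unitInterval A E) (e.comp (Y Q)) := by
      apply ContinuousLinearMap.hasFDerivAt
    have h2 : HasFDerivAt (fun R => pointwiseApply unitInterval A E (e.comp (Y R)))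
        ((pointwiseApply unitInterval A E).comp
          ((pointwiseApply unitInterval E (A →L[ℝ] E) (e'.comp (Y Q))).comp (fderiv ℝ Y Q))) Q := by
      exact HasFDerivAt.comp (F := C(unitInterval, A →L[ℝ] E))
        (G := C(unitInterval, A) →L[ℝ] C(unitInterval, E)) Q hLd h1
    have h3 : HasFDerivAt (fun R : E => constL A (π (R - P₀))) ((constL A).comp π) Q := by
      have h0 : HasFDerivAt (fun R : E => R - P₀) (ContinuousLinearMap.id ℝ E) Q :=
        (hasFDerivAt_id Q).sub_const P₀
      exact (constL A).hasFDerivAt.comp Q (π.hasFDerivAt.comp Q h0)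
    have h4 := (constL E).hasFDerivAt.sub ((primitiveL E).hasFDerivAt.comp Q (h2.clm_apply h3))
    have h5 : Y =ᶠ[nhds Q] fun R => constL E R - primitiveL E
        (pointwiseApply _ A E (e.comp (Y R)) (constL A (π (R - P₀)))) :=
      Filter.eventually_of_mem (ht.mem_nhds hQ) hYeq
    have h6 := (hYd.congr_of_eventuallyEq h5.symm).unique h4
    exact congrArg (fun L => L v) h6
  have hYU : IsOpen {z : C(unitInterval, E) | Set.MapsTo z Set.univ U} :=
    ContinuousMap.isOpen_setOfPred_mapsTo isCompact_univ hU
  have hΦd : ∀ Q ∈ t, ∀ v, fderiv ℝ (fun R => Y R 1) Q v = fderiv ℝ Y Q v 1 := by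
    intro Q hQ v
    have hYd : HasFDerivAt Y (fderiv ℝ Y Q) Q :=
      ((hY.contDiffAt (ht.mem_nhds hQ)).differentiableAt (by simp)).hasFDerivAt
    have := ((ContinuousMap.evalCLM ℝ (1 : unitInterval)).hasFDerivAt.comp Q hYd).fderiv
    exact congrArg (fun L => L v) this
  refine ⟨t ∩ Y ⁻¹' {z | Set.MapsTo z Set.univ U},
    hY.continuousOn.isOpen_inter_preimage ht hYU, ⟨hP₀t, ?_⟩, ?_, fun Q => Y Q 1, ?_, ?_, ?_⟩
  · intro s _
    rw [hY₀]; exact hP₀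
  · rintro Q ⟨hQt, hQU⟩
    have h0 : Y Q 0 = Q := by
      rw [hYeq Q hQt]
      simp [primitiveL_apply]
    rw [← h0]
    exact hQU (Set.mem_univ 0)
  · exact ((ContinuousMap.evalCLM ℝ (1 : unitInterval)).contDiff.comp_contDiffOn hY).mono
      Set.inter_subset_left
  · rintro Q ⟨hQt, hQU⟩ α
    rw [hΦd Q hQt]
    set y := Y Q with hy
    set a : A := π (Q - P₀) with ha
    set h := fderiv ℝ Y Q (e Q α) with hh
    have hQU' : Q ∈ U := by
      have h0 : Y Q 0 = Q := by
        rw [hYeq Q hQt]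
        simp [primitiveL_apply]
      rw [← h0]
      exact hQU (Set.mem_univ 0)
    -- the paths `y` and `h`, extended to the real line
    let y₁ : ℝ → E := fun s => Q - ∫ τ in (0 : ℝ)..s,
      pointwiseApply _ A E (e.comp y) (constL A a) (Set.projIcc 0 1 zero_le_one τ)
    let g : C(unitInterval, E) := pointwiseApply _ A E (e.comp y) (constL A α) +
        pointwiseApply _ A E (pointwiseApply _ E (A →L[ℝ] E) (e'.comp y) h) (constL A a)
    let h₁ : ℝ → E := fun s => e Q α - ∫ τ in (0 : ℝ)..s, g (Set.projIcc 0 1 zero_le_one τ)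
    have hyy : ∀ s : unitInterval, y₁ s = y s := by
      intro s
      conv_rhs => rw [hy, hYeq Q hQt]
      rfl
    have hhh : ∀ s : unitInterval, h₁ s = h s := by
      intro s
      conv_rhs => rw [hh, hvar Q hQt, hπ Q hQU']
      rfl
    -- the deviation of `h` from the field, which solves a linear equation
    let W : ℝ → E := fun s => h₁ s - (1 - s) • e (y₁ s) α
    let W' : ℝ → E := fun s => -fderiv ℝ e (y₁ s) (W s) a
    have hWd : ∀ s ∈ Set.Ico (0 : ℝ) 1, HasDerivAt W (W' s) s := by
      intro s hs
      have hs' : s ∈ Set.Icc (0 : ℝ) 1 := ⟨hs.1, hs.2.le⟩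
      have hp : Set.projIcc (0 : ℝ) 1 zero_le_one s = ⟨s, hs'⟩ := Set.projIcc_of_mem _ hs'
      have d1 : HasDerivAt y₁ (-(e (y ⟨s, hs'⟩) a)) s := by
        have := (hasDerivAt_primitive
          (pointwiseApply _ A E (e.comp y) (constL A a)) s).const_sub Q
        rwa [hp] at this
      have d2 : HasDerivAt h₁ (-g ⟨s, hs'⟩) s := by
        have := (hasDerivAt_primitive g s).const_sub (e Q α)
        rwa [hp] at this
      have d3 : HasDerivAt (fun s => e (y₁ s) α)
          (fderiv ℝ e (y₁ s) (-(e (y ⟨s, hs'⟩) a)) α) s := by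
        have := ((hed (y₁ s)).comp_hasDerivAt s d1).clm_apply (hasDerivAt_const s α)
        simpa using this
      have d4 : HasDerivAt (fun s : ℝ => 1 - s) (-1) s := by
        simpa using (hasDerivAt_id s).const_sub 1
      have d5 := d2.sub (d4.smul d3)
      refine d5.congr_deriv ?_
      have e1 : y₁ s = y ⟨s, hs'⟩ := hyy ⟨s, hs'⟩
      have e2 : h₁ s = h ⟨s, hs'⟩ := hhh ⟨s, hs'⟩
      have hyU : y ⟨s, hs'⟩ ∈ U := hQU (Set.mem_univ _)
      have hcm := hcomm _ hyU a α
      have hg : g ⟨s, hs'⟩ = e (y ⟨s, hs'⟩) α + fderiv ℝ e (y ⟨s, hs'⟩) (h ⟨s, hs'⟩) a := rfl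
      simp only [W', W, e1, e2, hg, map_neg, map_sub, map_smul, neg_smul, one_smul,
        _root_.neg_apply, _root_.sub_apply, _root_.smul_apply, smul_neg, hcm]
      abel
    have hW0 : W 0 = 0 := by
      simp [W, h₁, y₁]
    obtain ⟨C, hC⟩ := isCompact_univ.exists_bound_of_continuousOn
      ((he.continuous_fderiv (by simp)).comp y.continuous).continuousOn
    have hWb : ∀ s ∈ Set.Ico (0 : ℝ) 1, ‖W' s‖ ≤ C * ‖a‖ * ‖W s‖ := by
      intro s hs
      have hs' : s ∈ Set.Icc (0 : ℝ) 1 := ⟨hs.1, hs.2.le⟩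
      have e1 : y₁ s = y ⟨s, hs'⟩ := hyy ⟨s, hs'⟩
      have b1 : ‖fderiv ℝ e (y₁ s)‖ ≤ C := by
        rw [e1]; exact hC ⟨s, hs'⟩ (Set.mem_univ _)
      calc ‖W' s‖ = ‖fderiv ℝ e (y₁ s) (W s) a‖ := norm_neg _
        _ ≤ ‖fderiv ℝ e (y₁ s)‖ * ‖W s‖ * ‖a‖ := ContinuousLinearMap.le_opNorm₂ _ _ _
        _ ≤ C * ‖W s‖ * ‖a‖ := by gcongr
        _ = _ := by ring
    have hWc : Continuous W := by
      have c1 : Continuous y₁ := continuous_iff_continuousAt.2 fun s =>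
        ((hasDerivAt_primitive _ s).const_sub Q).continuousAt
      have c2 : Continuous h₁ := continuous_iff_continuousAt.2 fun s =>
        ((hasDerivAt_primitive g s).const_sub (e Q α)).continuousAt
      exact c2.sub ((continuous_const.sub continuous_id).smul
        ((e.continuous.comp c1).clm_apply continuous_const))
    have := eq_zero_of_abs_deriv_le_mul_abs_self_of_eq_zero_right hWc.continuousOn
      (fun s hs => (hWd s hs).hasDerivWithinAt) hW0 hWb 1 (by simp)
    have h1 : h₁ 1 = h 1 := hhh 1
    simpa [W, h1] using this
  · intro v
    rw [hΦd P₀ hP₀t, hvar P₀ hP₀t, hY₀]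
    have h1 : e.comp (constL E P₀) = constL (A →L[ℝ] E) (e P₀) := rfl
    have h2 : pointwiseApply unitInterval A E (constL (A →L[ℝ] E) (e P₀)) (constL A (π v)) =
      constL E (e P₀ (π v)) := rfl
    have h3 : primitiveL E (constL E (e P₀ (π v))) 1 = e P₀ (π v) := primitiveL_const _
    rw [h1, h2, sub_self, map_zero, map_zero, map_zero, add_zero, ContinuousMap.sub_apply, h3,
      constL_apply]

end Frobenius

/-- **Frobenius' theorem**, first integrals: a covector that annihilates an involutive distribution
at `P₀` is the differential at `P₀` of a local first integral. The distribution is the range of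
`e(Q)`, and `De(e a) a' - De(e a') a` is the bracket of the fields `e a` and `e a'`. Multiplying
`e` on the right by the inverse of `π e`, with `π` a left inverse of `e(P₀)`, makes these fields
commute: their brackets are in the distribution, on which `π` is injective, and are killed by
`π`. -/
theorem exists_firstIntegral {E A : Type u} [NormedAddCommGroup E] [NormedSpace ℝ E]
    [NormedAddCommGroup A] [NormedSpace ℝ A] [FiniteDimensional ℝ E] [FiniteDimensional ℝ A]
    {s : Set E} (hs : IsOpen s) {P₀ : E} (hP₀ : P₀ ∈ s) {e : E → A →L[ℝ] E}
    (he : ContDiffOn ℝ ∞ e s) (hinj : Function.Injective (e P₀))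
    (hinv : ∀ Q ∈ s, ∀ a a', ∃ b, fderiv ℝ e Q (e Q a) a' - fderiv ℝ e Q (e Q a') a = e Q b)
    (θ : E →L[ℝ] ℝ) (hθ : ∀ a, θ (e P₀ a) = 0) :
    ∃ t, IsOpen t ∧ P₀ ∈ t ∧ t ⊆ s ∧ ∃ φ : E → ℝ, ContDiffOn ℝ ∞ φ t ∧
      (∀ Q ∈ t, ∀ a, fderiv ℝ φ Q (e Q a) = 0) ∧ fderiv ℝ φ P₀ = θ := by
  have : CompleteSpace E := FiniteDimensional.complete ℝ E
  have : CompleteSpace A := FiniteDimensional.complete ℝ A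
  obtain ⟨π', hπ'⟩ := LinearMap.exists_leftInverse_of_injective (e P₀ : A →ₗ[ℝ] E)
    (LinearMap.ker_eq_bot.2 hinj)
  let π : E →L[ℝ] A := LinearMap.toContinuousLinearMap π'
  have hπ : ∀ a, π (e P₀ a) = a := fun a => congrArg (fun L => L a) hπ'
  let q : E → A →L[ℝ] A := fun Q => π.comp (e Q)
  have hq : ContDiffOn ℝ ∞ q s := contDiffOn_const.clm_comp he
  have hq₀ : q P₀ = 1 := ContinuousLinearMap.ext hπ
  let U₁ : Set E := s ∩ q ⁻¹' {x | IsUnit x}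
  have hU₁ : IsOpen U₁ := hq.continuousOn.isOpen_inter_preimage hs Units.isOpen
  have hP₀U₁ : P₀ ∈ U₁ := ⟨hP₀, by simp [hq₀]⟩
  let m : E → A →L[ℝ] A := fun Q => Ring.inverse (q Q)
  have hm : ContDiffOn ℝ ∞ m U₁ := by
    rintro Q ⟨hQ, u, hu⟩
    have h1 : ContDiffAt ℝ ∞ Ring.inverse (q Q) := hu ▸ contDiffAt_ringInverse ℝ u
    exact (h1.comp Q (hq.contDiffAt (hs.mem_nhds hQ))).contDiffWithinAt
  have hqm : ∀ Q ∈ U₁, ∀ a, q Q (m Q a) = a := fun Q hQ a =>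
    congrArg (fun L : A →L[ℝ] A => L a) (Ring.mul_inverse_cancel _ hQ.2)
  have hmq : ∀ Q ∈ U₁, ∀ a, m Q (q Q a) = a := fun Q hQ a =>
    congrArg (fun L : A →L[ℝ] A => L a) (Ring.inverse_mul_cancel _ hQ.2)
  let e₁ : E → A →L[ℝ] E := fun Q => (e Q).comp (m Q)
  have he₁ : ContDiffOn ℝ ∞ e₁ U₁ := (he.mono Set.inter_subset_left).clm_comp hm
  -- brackets of the normalised fields vanish
  have hcomm₁ : ∀ Q ∈ U₁, ∀ a a', fderiv ℝ e₁ Q (e₁ Q a) a' = fderiv ℝ e₁ Q (e₁ Q a') a := by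
    intro Q hQ a a'
    have d0 : HasFDerivAt e (fderiv ℝ e Q) Q :=
      ((he.contDiffAt (hs.mem_nhds hQ.1)).differentiableAt (by simp)).hasFDerivAt
    have d1 : HasFDerivAt m (fderiv ℝ m Q) Q :=
      ((hm.contDiffAt (hU₁.mem_nhds hQ)).differentiableAt (by simp)).hasFDerivAt
    have d2 : HasFDerivAt e₁ (fderiv ℝ e₁ Q) Q :=
      ((he₁.contDiffAt (hU₁.mem_nhds hQ)).differentiableAt (by simp)).hasFDerivAt
    have h1 : ∀ v a, fderiv ℝ e₁ Q v a = fderiv ℝ e Q v (m Q a) + e Q (fderiv ℝ m Q v a) := by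
      intro v a
      rw [(d0.clm_comp d1).fderiv]
      simp [add_comm]
    have h2 : ∀ v a, π (fderiv ℝ e₁ Q v a) = 0 := by
      intro v a
      have h3 : HasFDerivAt (fun R => π (e₁ R a)) _ Q :=
        π.hasFDerivAt.comp Q (d2.clm_apply (hasFDerivAt_const a Q))
      have h4 : (fun R => π (e₁ R a)) =ᶠ[nhds Q] fun _ => a :=
        Filter.eventually_of_mem (hU₁.mem_nhds hQ) fun R hR => hqm R hR a
      have h5 := (h3.congr_of_eventuallyEq h4.symm).unique (hasFDerivAt_const a Q)
      simpa using congrArg (fun L => L v) h5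
    obtain ⟨b, hb⟩ := hinv Q hQ.1 (m Q a) (m Q a')
    have h6 : fderiv ℝ e₁ Q (e₁ Q a) a' - fderiv ℝ e₁ Q (e₁ Q a') a =
        e Q (b + fderiv ℝ m Q (e₁ Q a) a' - fderiv ℝ m Q (e₁ Q a') a) := by
      rw [h1, h1, map_sub, map_add, ← hb]
      simp only [e₁, ContinuousLinearMap.comp_apply]
      abel
    set b' := b + fderiv ℝ m Q (e₁ Q a) a' - fderiv ℝ m Q (e₁ Q a') a
    have h7 : q Q b' = 0 := by
      have := congrArg π h6
      rw [map_sub, h2, h2, sub_zero] at this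
      exact this.symm
    have h8 : b' = 0 := by rw [← hmq Q hQ b', h7, map_zero]
    rw [h8, map_zero, sub_eq_zero] at h6
    exact h6
  -- a cut-off makes the normalised fields globally smooth
  obtain ⟨r, hr, hrU⟩ := Metric.isOpen_iff.1 hU₁ P₀ hP₀U₁
  let χ : ContDiffBump P₀ := ⟨r / 4, r / 2, by positivity, by linarith⟩
  have hχ : ContDiff ℝ ∞ (fun Q => (χ Q : ℝ) • e₁ Q) := by
    rw [contDiff_iff_contDiffAt]
    intro Q
    by_cases hQ : Q ∈ U₁
    · exact χ.contDiff.contDiffAt.smul (he₁.contDiffAt (hU₁.mem_nhds hQ))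
    · have hQ' : Q ∉ tsupport χ := by
        rw [χ.tsupport_eq]
        intro h
        refine hQ (hrU ?_)
        rw [Metric.mem_closedBall] at h
        have h' : dist Q P₀ ≤ r / 2 := h
        rw [Metric.mem_ball]
        linarith
      have h0 : (fun Q => (χ Q : ℝ) • e₁ Q) =ᶠ[nhds Q] fun _ => 0 := by
        filter_upwards [notMem_tsupport_iff_eventuallyEq.1 hQ'] with R hR
        rw [hR]; simp
      exact contDiffAt_const.congr_of_eventuallyEq h0
  have hχU : ∀ Q ∈ Metric.ball P₀ (r / 4), (χ Q : ℝ) • e₁ Q = e₁ Q := by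
    intro Q hQ
    rw [χ.one_of_mem_closedBall (Metric.ball_subset_closedBall hQ), one_smul]
  have hsub : Metric.ball P₀ (r / 4) ⊆ U₁ :=
    (Metric.ball_subset_ball (by linarith)).trans hrU
  have hchi : ∀ Q ∈ Metric.ball P₀ (r / 4), fderiv ℝ (fun Q => (χ Q : ℝ) • e₁ Q) Q =
      fderiv ℝ e₁ Q := fun Q hQ => Filter.EventuallyEq.fderiv_eq
    (Filter.eventually_of_mem (Metric.isOpen_ball.mem_nhds hQ) hχU)
  obtain ⟨t, ht, hP₀t, htU, Φ, hΦ, hΦe, hΦ₀⟩ := exists_firstIntegral_of_commute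
    ⟨fun Q => (χ Q : ℝ) • e₁ Q, hχ.continuous⟩ hχ π Metric.isOpen_ball
    (Metric.mem_ball_self (by positivity : 0 < r / 4))
    (fun Q hQ a => by
      rw [ContinuousMap.coe_mk, hχU Q hQ]
      exact hqm Q (hsub hQ) a)
    (fun Q hQ a a' => by
      simp only [ContinuousMap.coe_mk, hχU Q hQ, hchi Q hQ]
      exact hcomm₁ Q (hsub hQ) a a')
  have hΦd : ∀ Q ∈ t, HasFDerivAt Φ (fderiv ℝ Φ Q) Q := fun Q hQ =>
    ((hΦ.contDiffAt (ht.mem_nhds hQ)).differentiableAt (by simp)).hasFDerivAt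
  refine ⟨t, ht, hP₀t, fun Q hQ => (hsub (htU hQ)).1, fun Q => θ (Φ Q),
    θ.contDiff.comp_contDiffOn hΦ, ?_, ?_⟩
  · intro Q hQ a
    have h1 : fderiv ℝ (fun Q => θ (Φ Q)) Q = θ.comp (fderiv ℝ Φ Q) :=
      (θ.hasFDerivAt.comp Q (hΦd Q hQ)).fderiv
    have h2 := hΦe Q hQ (q Q a)
    rw [ContinuousMap.coe_mk, hχU Q (htU hQ)] at h2
    have h3 : e₁ Q (q Q a) = e Q a := congrArg (e Q) (hmq Q (hsub (htU hQ)) a)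
    rw [h1, ContinuousLinearMap.comp_apply, ← h3, h2, map_zero]
  · have h1 : fderiv ℝ (fun Q => θ (Φ Q)) P₀ = θ.comp (fderiv ℝ Φ P₀) :=
      (θ.hasFDerivAt.comp P₀ (hΦd P₀ hP₀t)).fderiv
    rw [h1]
    refine ContinuousLinearMap.ext fun v => ?_
    rw [ContinuousLinearMap.comp_apply, hΦ₀, map_sub, ContinuousMap.coe_mk, hχU P₀ (htU hP₀t)]
    have : θ (e₁ P₀ (π v)) = 0 := hθ _
    rw [this, sub_zero]

/-! ### Calculus of smooth functions of jets -/

section JetCalculus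

variable {n m N M : ℕ} {ι κ : Type} [Fintype ι] [Fintype κ]
  {F F' : Type*} [NormedAddCommGroup F] [NormedSpace ℝ F] [NormedAddCommGroup F'] [NormedSpace ℝ F']

/-- The finite dimensional space of truncated jets. -/
abbrev TruncJet (n : ℕ) (ι : Type) (N : ℕ) : Type := (Fin n → ℝ) × (Fin N → ι → ℝ)

/-- On `U`, the map `g` is a `C^∞` function of the truncated jet `(x, u^(0), ..., u^(N-1))`. -/
def FactorsOn (N : ℕ) (g : Jet n ι → F) (U : Set (Jet n ι)) : Prop :=
  ∃ H : TruncJet n ι N → F, ContDiffOn ℝ ∞ H (jetTrunc N '' U) ∧ ∀ P ∈ U, g P = H (jetTrunc N P)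

/-- Smooth maps from jets to a normed space; for real functions this is `JetSmoothOn`. -/
def JetSmoothMapOn (g : Jet n ι → F) (U : Set (Jet n ι)) : Prop := ∃ N, FactorsOn N g U

/-- Maps between jet spaces (in particular vector fields) all of whose coordinates are smooth; the
number of variables may depend on the coordinate. -/
structure IsSmoothField (C : Jet n ι → Jet m κ) (U : Set (Jet n ι)) : Prop where
  state : ∀ i, JetSmoothOn (fun P => (C P).1 i) U
  input : ∀ k j, JetSmoothOn (fun P => (C P).2 k j) U

omit [Fintype ι] in
theorem continuous_jetTrunc : Continuous (jetTrunc N : Jet n ι → TruncJet n ι N) := by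
  unfold jetTrunc; fun_prop

/-- The jet with a given truncation and vanishing derivatives of higher order. -/
def jetExtend (p : TruncJet n ι N) : Jet n ι :=
  (p.1, fun k => if h : k < N then p.2 ⟨k, h⟩ else 0)

omit [Fintype ι] in
theorem jetTrunc_jetExtend (p : TruncJet n ι N) : jetTrunc N (jetExtend p) = p := by
  simp [jetTrunc, jetExtend]

omit [Fintype ι] in
theorem continuous_jetExtend : Continuous (jetExtend : TruncJet n ι N → Jet n ι) := by
  refine continuous_fst.prodMk (continuous_pi fun k => ?_)
  by_cases h : k < N
  · simp only [h, dite_true]; fun_prop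
  · simp only [h, dite_false]; fun_prop

omit [Fintype ι] in
theorem isOpen_image_jetTrunc {U : Set (Jet n ι)} (hU : IsOpen U) :
    IsOpen (jetTrunc N '' U) := by
  rw [isOpen_iff_mem_nhds]
  rintro _ ⟨P, hP, rfl⟩
  have hc : Continuous fun p : TruncJet n ι N => P + jetExtend (p - jetTrunc N P) :=
    continuous_const.add (continuous_jetExtend.comp (continuous_id.sub continuous_const))
  have h0 : P + jetExtend (jetTrunc N P - jetTrunc N P) = P := by
    rw [sub_self]
    refine Prod.ext (by simp [jetExtend]) ?_
    funext k
    simp [jetExtend]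
  have h1 := hc.continuousAt (x := jetTrunc N P) |>.preimage_mem_nhds
    (hU.mem_nhds (h0.symm ▸ hP))
  filter_upwards [h1] with p hp
  refine ⟨_, hp, ?_⟩
  have : jetTrunc N (P + jetExtend (p - jetTrunc N P)) =
    jetTrunc N P + jetTrunc N (jetExtend (p - jetTrunc N P)) := rfl
  rw [this, jetTrunc_jetExtend, add_sub_cancel]

theorem FactorsOn.mono {g : Jet n ι → F} {U V : Set (Jet n ι)} (h : FactorsOn N g U)
    (hVU : V ⊆ U) : FactorsOn N g V :=
  let ⟨H, h1, h2⟩ := h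
  ⟨H, h1.mono (Set.image_mono hVU), fun P hP => h2 P (hVU hP)⟩

theorem FactorsOn.congr {g g' : Jet n ι → F} {U : Set (Jet n ι)} (h : FactorsOn N g U)
    (hg : ∀ P ∈ U, g' P = g P) : FactorsOn N g' U :=
  let ⟨H, h1, h2⟩ := h
  ⟨H, h1, fun P hP => (hg P hP).trans (h2 P hP)⟩

theorem FactorsOn.of_le {g : Jet n ι → F} {U : Set (Jet n ι)} (h : FactorsOn N g U)
    (hNM : N ≤ M) : FactorsOn M g U := by
  obtain ⟨H, h1, h2⟩ := h
  let r : TruncJet n ι M → TruncJet n ι N := fun p => (p.1, fun k => p.2 (Fin.castLE hNM k))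
  have hr : ContDiff ℝ ∞ r := by fun_prop
  refine ⟨H ∘ r, h1.comp hr.contDiffOn ?_, h2⟩
  rintro _ ⟨P, hP, rfl⟩
  exact ⟨P, hP, rfl⟩

theorem FactorsOn.comp {g : Jet n ι → F} {U : Set (Jet n ι)} (h : FactorsOn N g U) {K : F → F'}
    {s : Set F} (hK : ContDiffOn ℝ ∞ K s) (hgs : ∀ P ∈ U, g P ∈ s) :
    FactorsOn N (fun P => K (g P)) U := by
  obtain ⟨H, h1, h2⟩ := h
  refine ⟨K ∘ H, hK.comp h1 ?_, fun P hP => congrArg K (h2 P hP)⟩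
  rintro _ ⟨P, hP, rfl⟩
  rw [← h2 P hP]
  exact hgs P hP

theorem FactorsOn.prodMk {g : Jet n ι → F} {g' : Jet n ι → F'} {U : Set (Jet n ι)}
    (h : FactorsOn N g U) (h' : FactorsOn N g' U) : FactorsOn N (fun P => (g P, g' P)) U := by
  obtain ⟨H, h1, h2⟩ := h
  obtain ⟨H', h1', h2'⟩ := h'
  exact ⟨fun p => (H p, H' p), h1.prodMk h1', fun P hP => Prod.ext (h2 P hP) (h2' P hP)⟩

theorem FactorsOn.pi {α : Type*} [Fintype α] {g : Jet n ι → α → F} {U : Set (Jet n ι)}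
    (h : ∀ a, FactorsOn N (fun P => g P a) U) : FactorsOn N g U := by
  choose H h1 h2 using h
  exact ⟨fun p a => H a p, contDiffOn_pi.2 h1, fun P hP => funext fun a => h2 a P hP⟩

theorem factorsOn_jetTrunc (U : Set (Jet n ι)) : FactorsOn N (jetTrunc N) U :=
  ⟨id, contDiffOn_id, fun _ _ => rfl⟩

theorem JetSmoothMapOn.mono {g : Jet n ι → F} {U V : Set (Jet n ι)} (h : JetSmoothMapOn g U)
    (hVU : V ⊆ U) : JetSmoothMapOn g V :=
  let ⟨N, h⟩ := h
  ⟨N, h.mono hVU⟩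

theorem JetSmoothMapOn.continuousOn {g : Jet n ι → F} {U : Set (Jet n ι)}
    (h : JetSmoothMapOn g U) : ContinuousOn g U := by
  obtain ⟨N, H, h1, h2⟩ := h
  exact (h1.continuousOn.comp continuous_jetTrunc.continuousOn
    fun P hP => ⟨P, hP, rfl⟩).congr h2

theorem JetSmoothMapOn.congr {g g' : Jet n ι → F} {U : Set (Jet n ι)} (h : JetSmoothMapOn g U)
    (hg : ∀ P ∈ U, g' P = g P) : JetSmoothMapOn g' U :=
  let ⟨N, h⟩ := h
  ⟨N, h.congr hg⟩

theorem JetSmoothMapOn.comp {g : Jet n ι → F} {U : Set (Jet n ι)} (h : JetSmoothMapOn g U)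
    {K : F → F'} {s : Set F} (hK : ContDiffOn ℝ ∞ K s) (hgs : ∀ P ∈ U, g P ∈ s) :
    JetSmoothMapOn (fun P => K (g P)) U :=
  let ⟨N, h⟩ := h
  ⟨N, h.comp hK hgs⟩

theorem JetSmoothMapOn.comp_contDiff {g : Jet n ι → F} {U : Set (Jet n ι)}
    (h : JetSmoothMapOn g U) {K : F → F'} (hK : ContDiff ℝ ∞ K) :
    JetSmoothMapOn (fun P => K (g P)) U :=
  h.comp hK.contDiffOn fun _ _ => Set.mem_univ _

theorem JetSmoothMapOn.prodMk {g : Jet n ι → F} {g' : Jet n ι → F'} {U : Set (Jet n ι)}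
    (h : JetSmoothMapOn g U) (h' : JetSmoothMapOn g' U) :
    JetSmoothMapOn (fun P => (g P, g' P)) U :=
  let ⟨N, h⟩ := h
  let ⟨N', h'⟩ := h'
  ⟨max N N', (h.of_le (le_max_left _ _)).prodMk (h'.of_le (le_max_right _ _))⟩

theorem JetSmoothMapOn.pi {α : Type*} [Fintype α] {g : Jet n ι → α → F} {U : Set (Jet n ι)}
    (h : ∀ a, JetSmoothMapOn (fun P => g P a) U) : JetSmoothMapOn g U := by
  choose N h using h
  exact ⟨Finset.univ.sup N, FactorsOn.pi fun a => (h a).of_le (Finset.le_sup (Finset.mem_univ a))⟩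

theorem jetSmoothMapOn_const (c : F) (U : Set (Jet n ι)) : JetSmoothMapOn (fun _ => c) U :=
  ⟨0, fun _ => c, contDiffOn_const, fun _ _ => rfl⟩

theorem JetSmoothMapOn.sub {g g' : Jet n ι → F} {U : Set (Jet n ι)} (h : JetSmoothMapOn g U)
    (h' : JetSmoothMapOn g' U) : JetSmoothMapOn (fun P => g P - g' P) U :=
  (h.prodMk h').comp_contDiff (K := fun p : F × F => p.1 - p.2) (contDiff_fst.sub contDiff_snd)

theorem factorsOn_state {f : (Fin n → ℝ) → F} {X : Set (Fin n → ℝ)} (hf : ContDiffOn ℝ ∞ f X) :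
    FactorsOn 0 (fun P : Jet n ι => f P.1) (X ×ˢ Set.univ) := by
  refine ⟨fun p => f p.1, hf.comp contDiff_fst.contDiffOn ?_, fun _ _ => rfl⟩
  rintro _ ⟨P, hP, rfl⟩
  exact hP.1

theorem factorsOn_input (k : ℕ) (j : ι) (U : Set (Jet n ι)) :
    FactorsOn (k + 1) (fun P => P.2 k j) U :=
  ⟨fun p => p.2 (Fin.last k) j, by fun_prop, fun _ _ => rfl⟩

theorem jetSmoothMapOn_state (i : Fin n) (U : Set (Jet n ι)) :
    JetSmoothMapOn (fun P => P.1 i) U :=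
  ⟨0, fun p => p.1 i, by fun_prop, fun _ _ => rfl⟩

omit [Fintype κ] in
theorem IsSmoothField.mono {C : Jet n ι → Jet m κ} {U V : Set (Jet n ι)} (h : IsSmoothField C U)
    (hVU : V ⊆ U) : IsSmoothField C V :=
  ⟨fun i => JetSmoothMapOn.mono (h.state i) hVU, fun k j => JetSmoothMapOn.mono (h.input k j) hVU⟩

theorem IsSmoothField.jetTrunc {C : Jet n ι → Jet m κ} {U : Set (Jet n ι)}
    (h : IsSmoothField C U) (N : ℕ) : JetSmoothMapOn (fun P => jetTrunc N (C P)) U :=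
  (JetSmoothMapOn.pi h.state).prodMk (JetSmoothMapOn.pi fun k => JetSmoothMapOn.pi (h.input k))

/-- Smooth functions of jets are pulled back to smooth functions by smooth maps. -/
theorem JetSmoothMapOn.comp_field {g : Jet m κ → F} {U' : Set (Jet m κ)}
    (hg : JetSmoothMapOn g U') {C : Jet n ι → Jet m κ} {U : Set (Jet n ι)}
    (hC : IsSmoothField C U) (hCU : ∀ P ∈ U, C P ∈ U') : JetSmoothMapOn (fun P => g (C P)) U := by
  obtain ⟨N, H, h1, h2⟩ := hg
  exact ((hC.jetTrunc N).comp h1 fun P hP => ⟨_, hCU P hP, rfl⟩).congr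
    fun P hP => h2 _ (hCU P hP)

omit [Fintype ι] in
theorem eventually_line_mem {U : Set (Jet n ι)} (hU : IsOpen U) {P : Jet n ι} (hP : P ∈ U)
    (v : Jet n ι) : ∀ᶠ t : ℝ in nhds 0, P + t • v ∈ U := by
  have hc : Continuous fun t : ℝ => P + t • v := by fun_prop
  exact hc.continuousAt.preimage_mem_nhds (hU.mem_nhds (by simpa using hP))

/-- A smooth function has a differential, which depends on finitely many coordinates and computes
its derivative along all curves. -/
theorem FactorsOn.exists_differential {g : Jet n ι → F} {U : Set (Jet n ι)} (hU : IsOpen U)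
    (h : FactorsOn N g U) {P : Jet n ι} (hP : P ∈ U) :
    ∃ L : TruncJet n ι N →L[ℝ] F, (∀ v, lineDeriv ℝ g P v = L (AffineFlat.jetTrunc N v)) ∧
      ∀ (c : ℝ → Jet n ι) (t₀ : ℝ) (v : TruncJet n ι N), c t₀ = P → (∀ᶠ t in nhds t₀, c t ∈ U) →
        HasDerivAt (fun t => AffineFlat.jetTrunc N (c t)) v t₀ →
        HasDerivAt (fun t => g (c t)) (L v) t₀ := by
  obtain ⟨H, h1, h2⟩ := h
  have hd : HasFDerivAt H (fderiv ℝ H (AffineFlat.jetTrunc N P)) (AffineFlat.jetTrunc N P) :=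
    ((h1.contDiffAt ((isOpen_image_jetTrunc hU).mem_nhds ⟨P, hP, rfl⟩)).differentiableAt
      (by simp)).hasFDerivAt
  have hcurve : ∀ (c : ℝ → Jet n ι) (t₀ : ℝ) (v : TruncJet n ι N), c t₀ = P →
      (∀ᶠ t in nhds t₀, c t ∈ U) → HasDerivAt (fun t => AffineFlat.jetTrunc N (c t)) v t₀ →
      HasDerivAt (fun t => g (c t)) (fderiv ℝ H (AffineFlat.jetTrunc N P) v) t₀ := by
    rintro c t₀ v rfl hcU hc
    refine (hd.comp_hasDerivAt t₀ hc).congr_of_eventuallyEq ?_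
    filter_upwards [hcU] with t ht using h2 _ ht
  refine ⟨_, fun v => ?_, hcurve⟩
  have hline : HasDerivAt (fun t : ℝ => AffineFlat.jetTrunc N (P + t • v))
      (AffineFlat.jetTrunc N v) 0 := by
    have h3 := ((hasDerivAt_id (0 : ℝ)).smul_const (AffineFlat.jetTrunc N v)).const_add
      (AffineFlat.jetTrunc N P)
    rw [one_smul] at h3
    exact h3
  exact (hcurve (fun t => P + t • v) 0 _ (by simp) (eventually_line_mem hU hP v) hline).deriv

omit [Fintype ι] in
/-- The derivative of a curve of jets may be computed coordinate by coordinate. -/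
theorem hasDerivAt_jetTrunc {c : ℝ → Jet n ι} {t₀ : ℝ} {v : Jet n ι} (N : ℕ) [Finite ι]
    (h1 : ∀ i, HasDerivAt (fun t => (c t).1 i) (v.1 i) t₀)
    (h2 : ∀ k j, HasDerivAt (fun t => (c t).2 k j) (v.2 k j) t₀) :
    HasDerivAt (fun t => jetTrunc N (c t)) (jetTrunc N v) t₀ := by
  have := Fintype.ofFinite ι
  exact (hasDerivAt_pi.2 h1).prodMk (hasDerivAt_pi.2 fun k => hasDerivAt_pi.2 (h2 k))

theorem JetSmoothMapOn.hasDerivAt_curve {g : Jet n ι → F} {U : Set (Jet n ι)} (hU : IsOpen U)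
    (h : JetSmoothMapOn g U) {c : ℝ → Jet n ι} {t₀ : ℝ} {v : Jet n ι}
    (hcU : ∀ᶠ t in nhds t₀, c t ∈ U) (h1 : ∀ i, HasDerivAt (fun t => (c t).1 i) (v.1 i) t₀)
    (h2 : ∀ k j, HasDerivAt (fun t => (c t).2 k j) (v.2 k j) t₀) :
    HasDerivAt (fun t => g (c t)) (lineDeriv ℝ g (c t₀) v) t₀ := by
  obtain ⟨N, h⟩ := h
  obtain ⟨L, h3, h4⟩ := h.exists_differential hU hcU.self_of_nhds
  rw [h3]
  exact h4 c t₀ _ rfl hcU (hasDerivAt_jetTrunc N h1 h2)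

theorem JetSmoothMapOn.hasDerivAt_line {g : Jet n ι → F} {U : Set (Jet n ι)} (hU : IsOpen U)
    (h : JetSmoothMapOn g U) {P : Jet n ι} (hP : P ∈ U) (v : Jet n ι) :
    HasDerivAt (fun t : ℝ => g (P + t • v)) (lineDeriv ℝ g P v) 0 := by
  obtain ⟨N, h⟩ := h
  obtain ⟨L, h3, h4⟩ := h.exists_differential hU hP
  have hline : HasDerivAt (fun t : ℝ => AffineFlat.jetTrunc N (P + t • v))
      (AffineFlat.jetTrunc N v) 0 := by
    have h3 := ((hasDerivAt_id (0 : ℝ)).smul_const (AffineFlat.jetTrunc N v)).const_add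
      (AffineFlat.jetTrunc N P)
    rw [one_smul] at h3
    exact h3
  rw [h3]
  exact h4 _ _ _ (by simp) (eventually_line_mem hU hP v) hline

/-- The derivative of a smooth function is linear in the direction. -/
theorem JetSmoothMapOn.exists_linearMap {g : Jet n ι → F} {U : Set (Jet n ι)} (hU : IsOpen U)
    (h : JetSmoothMapOn g U) {P : Jet n ι} (hP : P ∈ U) :
    ∃ L : Jet n ι →ₗ[ℝ] F, ∀ v, lineDeriv ℝ g P v = L v := by
  obtain ⟨N, h⟩ := h
  obtain ⟨L, h3, -⟩ := h.exists_differential hU hP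
  exact ⟨⟨⟨fun v => L (AffineFlat.jetTrunc N v), fun v w =>
    L.map_add (AffineFlat.jetTrunc N v) (AffineFlat.jetTrunc N w)⟩,
    fun a v => L.map_smul a (AffineFlat.jetTrunc N v)⟩, h3⟩

omit [Fintype ι] in
theorem lineDeriv_congr_of_isOpen {g g' : Jet n ι → F} {U : Set (Jet n ι)} (hU : IsOpen U)
    (hg : ∀ P ∈ U, g P = g' P) {P : Jet n ι} (hP : P ∈ U) (v : Jet n ι) :
    lineDeriv ℝ g P v = lineDeriv ℝ g' P v := by
  refine Filter.EventuallyEq.deriv_eq ?_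
  filter_upwards [eventually_line_mem hU hP v] with t ht using hg _ ht

omit [Fintype ι] in
theorem lieDerivative_congr {C C' : JetField n ι} {g g' : Jet n ι → ℝ} {U : Set (Jet n ι)}
    (hU : IsOpen U) (hg : ∀ P ∈ U, g P = g' P) {P : Jet n ι} (hP : P ∈ U) (hC : C P = C' P) :
    lieDerivative C g P = lieDerivative C' g' P := by
  unfold lieDerivative
  rw [lineDeriv_congr_of_isOpen hU hg hP, hC]

/-- If `g` is represented by `H`, its derivative is represented by the derivative of `H`. -/
theorem lineDeriv_eq_fderiv {g : Jet n ι → F} {H : TruncJet n ι N → F} {U : Set (Jet n ι)}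
    (hU : IsOpen U) (h1 : ContDiffOn ℝ ∞ H (AffineFlat.jetTrunc N '' U))
    (h2 : ∀ P ∈ U, g P = H (AffineFlat.jetTrunc N P)) {P : Jet n ι} (hP : P ∈ U) (v : Jet n ι) :
    lineDeriv ℝ g P v = fderiv ℝ H (AffineFlat.jetTrunc N P) (AffineFlat.jetTrunc N v) := by
  have ho : IsOpen (AffineFlat.jetTrunc N '' U) := isOpen_image_jetTrunc hU
  have hd : HasFDerivAt H (fderiv ℝ H (AffineFlat.jetTrunc N P)) (AffineFlat.jetTrunc N P) :=
    ((h1.contDiffAt (ho.mem_nhds ⟨P, hP, rfl⟩)).differentiableAt (by simp)).hasFDerivAt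
  have hline : HasDerivAt (fun t : ℝ => AffineFlat.jetTrunc N P +
      t • AffineFlat.jetTrunc N v) (AffineFlat.jetTrunc N v) 0 := by
    simpa using ((hasDerivAt_id (0 : ℝ)).smul_const (AffineFlat.jetTrunc N v)).const_add
      (AffineFlat.jetTrunc N P)
  rw [lineDeriv_congr_of_isOpen (g' := fun Q => H (AffineFlat.jetTrunc N Q)) hU h2 hP]
  exact (hd.comp_hasDerivAt_of_eq (0 : ℝ) hline (by simp)).deriv

theorem FactorsOn.lineDeriv {g : Jet n ι → F} {C : JetField n ι} {U : Set (Jet n ι)}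
    (hU : IsOpen U) (h : FactorsOn N g U) (hNM : N ≤ M)
    (hC : FactorsOn M (fun P => AffineFlat.jetTrunc N (C P)) U) :
    FactorsOn M (fun P => lineDeriv ℝ g P (C P)) U := by
  obtain ⟨H, h1, h2⟩ := h
  have ho : IsOpen (AffineFlat.jetTrunc N '' U) := isOpen_image_jetTrunc hU
  have h3 : FactorsOn N (fun P => fderiv ℝ H (AffineFlat.jetTrunc N P)) U :=
    (factorsOn_jetTrunc U).comp (h1.fderiv_of_isOpen ho (by simp)) fun P hP => ⟨P, hP, rfl⟩
  have h4 := ((h3.of_le hNM).prodMk hC).comp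
    (K := fun p : (TruncJet n ι N →L[ℝ] F) × TruncJet n ι N => p.1 p.2)
    (contDiff_fst.clm_apply contDiff_snd).contDiffOn fun _ _ => Set.mem_univ _
  exact h4.congr fun P hP => lineDeriv_eq_fderiv hU h1 h2 hP _

/-- The derivative of a smooth function along a smooth field of directions is smooth. -/
theorem JetSmoothMapOn.lineDeriv {g : Jet n ι → F} {C : JetField n ι} {U : Set (Jet n ι)}
    (hU : IsOpen U) (h : JetSmoothMapOn g U) (hC : IsSmoothField C U) :
    JetSmoothMapOn (fun P => lineDeriv ℝ g P (C P)) U := by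
  obtain ⟨N, h⟩ := h
  obtain ⟨M, hM⟩ := hC.jetTrunc N
  exact ⟨max N M, h.lineDeriv hU (le_max_left _ _) (hM.of_le (le_max_right _ _))⟩

theorem JetSmoothMapOn.lieDerivative {g : Jet n ι → ℝ} {C : JetField n ι} {U : Set (Jet n ι)}
    (hU : IsOpen U) (h : JetSmoothMapOn g U) (hC : IsSmoothField C U) :
    JetSmoothMapOn (lieDerivative C g) U := h.lineDeriv hU hC

theorem JetSmoothMapOn.iterate_lieDerivative {g : Jet n ι → ℝ} {C : JetField n ι}
    {U : Set (Jet n ι)} (hU : IsOpen U) (h : JetSmoothMapOn g U) (hC : IsSmoothField C U) (k : ℕ) :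
    JetSmoothMapOn ((AffineFlat.lieDerivative C)^[k] g) U := by
  induction k with
  | zero => exact h
  | succ k ih =>
    rw [Function.iterate_succ_apply']
    exact ih.lieDerivative hU hC

theorem IsSmoothField.jetBracket {η γ : JetField n ι} {U : Set (Jet n ι)} (hU : IsOpen U)
    (hη : IsSmoothField η U) (hγ : IsSmoothField γ U) : IsSmoothField (jetBracket η γ) U :=
  ⟨fun i => (JetSmoothMapOn.lieDerivative hU (hγ.state i) hη).sub
      (JetSmoothMapOn.lieDerivative hU (hη.state i) hγ),
    fun k j => (JetSmoothMapOn.lieDerivative hU (hγ.input k j) hη).sub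
      (JetSmoothMapOn.lieDerivative hU (hη.input k j) hγ)⟩

/-- The Lie derivative along a bracket is the commutator of the Lie derivatives. -/
theorem lieDerivative_jetBracket {η γ : JetField n ι} {h : Jet n ι → ℝ} {U : Set (Jet n ι)}
    (hU : IsOpen U) (hη : IsSmoothField η U) (hγ : IsSmoothField γ U) (hh : JetSmoothMapOn h U)
    {P : Jet n ι} (hP : P ∈ U) :
    lieDerivative (jetBracket η γ) h P =
      lieDerivative η (lieDerivative γ h) P - lieDerivative γ (lieDerivative η h) P := by
  obtain ⟨N, H, h1, h2⟩ := hh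
  have ho : IsOpen (jetTrunc N '' U) := isOpen_image_jetTrunc hU
  have hH : ∀ Q ∈ U, ∀ v, lineDeriv ℝ h Q v = fderiv ℝ H (jetTrunc N Q) (jetTrunc N v) :=
    fun Q hQ v => lineDeriv_eq_fderiv hU h1 h2 hQ v
  have hHP : ContDiffAt ℝ ∞ H (jetTrunc N P) := h1.contDiffAt (ho.mem_nhds ⟨P, hP, rfl⟩)
  -- the derivative of `L_δ h` along `ε`, in terms of the second derivative of `H`
  have key : ∀ ε δ : JetField n ι, IsSmoothField δ U →
      lieDerivative ε (lieDerivative δ h) P =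
        fderiv ℝ (fderiv ℝ H) (jetTrunc N P) (jetTrunc N (ε P)) (jetTrunc N (δ P)) +
        fderiv ℝ H (jetTrunc N P) (fun i => lieDerivative ε (fun Q => (δ Q).1 i) P,
          fun k j => lieDerivative ε (fun Q => (δ Q).2 k j) P) := by
    intro ε δ hδ
    have hline : HasDerivAt (fun t : ℝ => jetTrunc N P + t • jetTrunc N (ε P))
        (jetTrunc N (ε P)) 0 := by
      simpa using ((hasDerivAt_id (0 : ℝ)).smul_const (jetTrunc N (ε P))).const_add (jetTrunc N P)
    have hd2 : HasFDerivAt (fderiv ℝ H) (fderiv ℝ (fderiv ℝ H) (jetTrunc N P)) (jetTrunc N P) :=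
      ((hHP.fderiv_right (m := ∞) (by simp)).differentiableAt (by simp)).hasFDerivAt
    have d1 := hd2.comp_hasDerivAt_of_eq (0 : ℝ) hline (by simp)
    have d2 : HasDerivAt (fun t : ℝ => jetTrunc N (δ (P + t • ε P)))
        ((fun i => lieDerivative ε (fun Q => (δ Q).1 i) P,
          fun k j => lieDerivative ε (fun Q => (δ Q).2 k j) P) : TruncJet n ι N) 0 :=
      (hasDerivAt_pi.2 fun i => JetSmoothMapOn.hasDerivAt_line hU (hδ.state i) hP _).prodMk
        (hasDerivAt_pi.2 fun k => hasDerivAt_pi.2 fun j =>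
          JetSmoothMapOn.hasDerivAt_line hU (hδ.input k j) hP _)
    have d3 := d1.clm_apply d2
    have d4 : HasDerivAt (fun t : ℝ => lieDerivative δ h (P + t • ε P)) _ 0 :=
      d3.congr_of_eventuallyEq (by
        filter_upwards [eventually_line_mem hU hP (ε P)] with t ht
        exact hH _ ht _)
    have d5 := d4.deriv
    simp only [Function.comp_apply, zero_smul, add_zero] at d5
    exact d5
  rw [key η γ hγ, key γ η hη, (hHP.isSymmSndFDerivAt (by
    rw [minSmoothness_of_isRCLikeNormedField]
    exact WithTop.coe_le_coe.2 (le_top : (2 : ℕ∞) ≤ ⊤))).eq (jetTrunc N (η P))]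
  rw [add_sub_add_left_eq_sub, ← map_sub]
  exact hH P hP _

/-- Chain rule for the derivative of a function composed with a map between jet spaces. -/
theorem lineDeriv_comp_field {g : Jet m κ → F} {U' : Set (Jet m κ)} (hU' : IsOpen U')
    (hg : JetSmoothMapOn g U') {C : Jet n ι → Jet m κ} {U : Set (Jet n ι)} (hU : IsOpen U)
    (hC : IsSmoothField C U) (hCU : ∀ P ∈ U, C P ∈ U') {P : Jet n ι} (hP : P ∈ U) {v : Jet n ι}
    {w : Jet m κ} (h1 : ∀ i, lineDeriv ℝ (fun Q => (C Q).1 i) P v = w.1 i)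
    (h2 : ∀ k j, lineDeriv ℝ (fun Q => (C Q).2 k j) P v = w.2 k j) :
    lineDeriv ℝ (fun Q => g (C Q)) P v = lineDeriv ℝ g (C P) w := by
  have := hg.hasDerivAt_curve hU' (c := fun t : ℝ => C (P + t • v)) (t₀ := 0) (v := w)
    ((eventually_line_mem hU hP v).mono fun t ht => hCU _ ht)
    (fun i => h1 i ▸ JetSmoothMapOn.hasDerivAt_line hU (hC.state i) hP v)
    (fun k j => h2 k j ▸ JetSmoothMapOn.hasDerivAt_line hU (hC.input k j) hP v)
  rw [zero_smul, add_zero] at this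
  exact this.deriv

end JetCalculus

/-! ### The distributions `Γᵃ_k` -/

section GammaStructure

variable {n r q : ℕ} {ι : Type} [Fintype ι]

/-- The Leibniz rule for the bracket with a combination of fields. -/
theorem jetBracket_sum_smul {α : Type*} [Fintype α] {η : JetField n ι} {γ : α → JetField n ι}
    {c : α → Jet n ι → ℝ} {U : Set (Jet n ι)} (hU : IsOpen U) (hη : IsSmoothField η U)
    (hγ : ∀ a, IsSmoothField (γ a) U) (hc : ∀ a, JetSmoothMapOn (c a) U) {P : Jet n ι}
    (hP : P ∈ U) :
    jetBracket η (fun Q => ∑ a, c a Q • γ a Q) P =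
      ∑ a, (lieDerivative η (c a) P • γ a P + c a P • jetBracket η (γ a) P) := by
  have key : ∀ (g : α → Jet n ι → ℝ) (h : Jet n ι → ℝ), (∀ a, JetSmoothMapOn (g a) U) →
      JetSmoothMapOn h U →
      lineDeriv ℝ (fun Q => ∑ a, c a Q * g a Q) P (η P) - lineDeriv ℝ h P (∑ a, c a P • γ a P) =
      ∑ a, (lieDerivative η (c a) P * g a P +
        c a P * (lineDeriv ℝ (g a) P (η P) - lineDeriv ℝ h P (γ a P))) := by
    intro g h hg hh
    have h1 : HasDerivAt (fun t : ℝ => ∑ a, c a (P + t • η P) * g a (P + t • η P))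
        (∑ a, (lineDeriv ℝ (c a) P (η P) * g a (P + (0 : ℝ) • η P) +
          c a (P + (0 : ℝ) • η P) * lineDeriv ℝ (g a) P (η P))) 0 :=
      HasDerivAt.fun_sum fun a _ => ((hc a).hasDerivAt_line hU hP _).mul
        ((hg a).hasDerivAt_line hU hP _)
    obtain ⟨L, hL⟩ := hh.exists_linearMap hU hP
    have h2 : lineDeriv ℝ (fun Q => ∑ a, c a Q * g a Q) P (η P) = _ := h1.deriv
    rw [h2, hL, map_sum, ← Finset.sum_sub_distrib]
    refine Finset.sum_congr rfl fun a _ => ?_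
    rw [map_smul, hL, zero_smul, add_zero, smul_eq_mul]
    unfold lieDerivative
    ring
  refine Prod.ext (funext fun i => ?_) (funext fun k => funext fun j => ?_)
  · have := key (fun a Q => (γ a Q).1 i) (fun Q => (η Q).1 i) (fun a => (hγ a).state i)
      (hη.state i)
    simpa [jetBracket, lieDerivative, Prod.fst_sum] using this
  · have := key (fun a Q => (γ a Q).2 k j) (fun Q => (η Q).2 k j) (fun a => (hγ a).input k j)
      (hη.input k j)
    simpa [jetBracket, lieDerivative, Prod.snd_sum] using this

omit [Fintype ι] in
theorem jetBracket_congr {η γ γ' : JetField n ι} {U : Set (Jet n ι)} (hU : IsOpen U)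
    (hγ : ∀ P ∈ U, γ P = γ' P) {P : Jet n ι} (hP : P ∈ U) :
    jetBracket η γ P = jetBracket η γ' P := by
  refine Prod.ext (funext fun i => ?_) (funext fun k => funext fun j => ?_)
  · exact congrArg₂ (· - ·)
      (lieDerivative_congr hU (fun Q hQ => by rw [hγ Q hQ]) hP rfl)
      (lieDerivative_congr hU (fun Q _ => rfl) hP (hγ P hP))
  · exact congrArg₂ (· - ·)
      (lieDerivative_congr hU (fun Q hQ => by rw [hγ Q hQ]) hP rfl)
      (lieDerivative_congr hU (fun Q _ => rfl) hP (hγ P hP))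

omit [Fintype ι] in
theorem isOpen_jetsOver {X : Set (Fin n → ℝ)} (hX : IsOpen X) :
    IsOpen (X ×ˢ (Set.univ : Set (ℕ → ι → ℝ))) := hX.prod isOpen_univ

theorem factorsOn_affineSystem {X : Set (Fin n → ℝ)} {f₀ : (Fin n → ℝ) → Fin n → ℝ}
    {f : ι → (Fin n → ℝ) → Fin n → ℝ} (hf₀ : ContDiffOn ℝ ∞ f₀ X)
    (hf : ∀ i, ContDiffOn ℝ ∞ (f i) X) :
    FactorsOn 1 (fun P : Jet n ι => affineSystem f₀ f P.1 (P.2 0)) (X ×ˢ Set.univ) := by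
  refine ⟨fun p => f₀ p.1 + ∑ i, p.2 0 i • f i p.1, ?_, fun _ _ => rfl⟩
  have h1 : Set.MapsTo (Prod.fst : TruncJet n ι 1 → _) (jetTrunc 1 '' (X ×ˢ Set.univ)) X := by
    rintro _ ⟨P, hP, rfl⟩
    exact hP.1
  refine (hf₀.comp contDiff_fst.contDiffOn h1).add (ContDiffOn.sum fun i _ => ?_)
  have h2 : ContDiff ℝ ∞ fun p : TruncJet n ι 1 => p.2 0 i := by fun_prop
  exact h2.contDiffOn.smul ((hf i).comp contDiff_fst.contDiffOn h1)

theorem factorsOn_jetTrunc_cartanField {X : Set (Fin n → ℝ)} {f₀ : (Fin n → ℝ) → Fin n → ℝ}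
    {f : ι → (Fin n → ℝ) → Fin n → ℝ} (hf₀ : ContDiffOn ℝ ∞ f₀ X)
    (hf : ∀ i, ContDiffOn ℝ ∞ (f i) X) (N : ℕ) :
    FactorsOn (N + 1) (fun P => jetTrunc N (cartanField (affineSystem f₀ f) P))
      (X ×ˢ Set.univ) := by
  refine ((factorsOn_affineSystem hf₀ hf).of_le (by omega)).prodMk
    (FactorsOn.pi fun k => FactorsOn.pi fun j => ?_)
  exact (factorsOn_input _ _ _).of_le (by omega)

theorem isSmoothField_cartanField {X : Set (Fin n → ℝ)} {f₀ : (Fin n → ℝ) → Fin n → ℝ}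
    {f : ι → (Fin n → ℝ) → Fin n → ℝ} (hf₀ : ContDiffOn ℝ ∞ f₀ X)
    (hf : ∀ i, ContDiffOn ℝ ∞ (f i) X) :
    IsSmoothField (cartanField (affineSystem f₀ f)) (X ×ˢ Set.univ) :=
  ⟨fun i => ⟨1, (factorsOn_affineSystem hf₀ hf).comp (K := fun x => x i)
      (contDiff_apply ℝ ℝ i).contDiffOn fun _ _ => Set.mem_univ _⟩,
    fun k j => ⟨k + 2, factorsOn_input (k + 1) j _⟩⟩

/-- The iterated brackets `ad_{F₀ᵇ}^m f_i`, for the inputs `i` of the group `a`. -/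
noncomputable def iteratedBracket (f₀ : (Fin n → ℝ) → Fin n → ℝ)
    (f : Fin r ⊕ Fin q → (Fin n → ℝ) → Fin n → ℝ) (i : Fin r) (m : ℕ) : JetField n (Fin q) :=
  (jetBracket (extendedDrift f₀ f))^[m] (liftField (f (Sum.inl i)))

theorem iteratedBracket_succ (f₀ : (Fin n → ℝ) → Fin n → ℝ)
    (f : Fin r ⊕ Fin q → (Fin n → ℝ) → Fin n → ℝ) (i : Fin r) (m : ℕ) :
    iteratedBracket f₀ f i (m + 1) =
      jetBracket (extendedDrift f₀ f) (iteratedBracket f₀ f i m) :=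
  Function.iterate_succ_apply' _ _ _

/-- The subspace of `ℝⁿ` spanned by the values of `ad_{F₀ᵇ}^m f_i`, `m < L`. For `L = k + 1` these
are the values of `Γᵃ_k`. -/
noncomputable def levelSpan (f₀ : (Fin n → ℝ) → Fin n → ℝ)
    (f : Fin r ⊕ Fin q → (Fin n → ℝ) → Fin n → ℝ) (L : ℕ) (P : Jet n (Fin q)) :
    Submodule ℝ (Fin n → ℝ) :=
  Submodule.span ℝ ((fun a : Fin r × ℕ => (iteratedBracket f₀ f a.1 a.2 P).1) '' {a | a.2 < L})

variable {X : Set (Fin n → ℝ)} {f₀ : (Fin n → ℝ) → Fin n → ℝ}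
  {f : Fin r ⊕ Fin q → (Fin n → ℝ) → Fin n → ℝ}

theorem isSmoothField_extendedDrift (hf₀ : ContDiffOn ℝ ∞ f₀ X)
    (hf : ∀ i, ContDiffOn ℝ ∞ (f i) X) :
    IsSmoothField (extendedDrift f₀ f) (X ×ˢ Set.univ) :=
  isSmoothField_cartanField hf₀ fun j => hf (Sum.inr j)

theorem isSmoothField_iteratedBracket (hX : IsOpen X) (hf₀ : ContDiffOn ℝ ∞ f₀ X)
    (hf : ∀ i, ContDiffOn ℝ ∞ (f i) X) (i : Fin r) (m : ℕ) :
    IsSmoothField (iteratedBracket f₀ f i m) (X ×ˢ Set.univ) := by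
  induction m with
  | zero =>
    refine ⟨fun l => ⟨0, ?_⟩, fun k j => jetSmoothMapOn_const 0 _⟩
    exact (factorsOn_state (hf (Sum.inl i))).comp (K := fun x => x l)
      (contDiff_apply ℝ ℝ l).contDiffOn fun _ _ => Set.mem_univ _
  | succ m ih =>
    rw [iteratedBracket_succ]
    exact (isSmoothField_extendedDrift hf₀ hf).jetBracket (isOpen_jetsOver hX) ih

/-- The brackets `ad_{F₀ᵇ}^m f_i` are fields on the state space, with parameters `u_b^(k)`. -/
theorem iteratedBracket_snd (hX : IsOpen X) (i : Fin r) (m : ℕ) {P : Jet n (Fin q)} (hP : P.1 ∈ X) :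
    (iteratedBracket f₀ f i m P).2 = 0 := by
  induction m generalizing P with
  | zero => rfl
  | succ m ih =>
    rw [iteratedBracket_succ]
    funext k j
    have hS : P ∈ X ×ˢ (Set.univ : Set (ℕ → Fin q → ℝ)) := ⟨hP, Set.mem_univ _⟩
    have h1 : lieDerivative (extendedDrift f₀ f)
        (fun Q => (iteratedBracket f₀ f i m Q).2 k j) P = 0 := by
      rw [lieDerivative_congr (C' := extendedDrift f₀ f) (g' := fun _ => (0 : ℝ))
        (isOpen_jetsOver hX) (fun Q hQ => by rw [ih hQ.1]; rfl) hS rfl]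
      simp [lieDerivative, lineDeriv]
    have h2 : lieDerivative (iteratedBracket f₀ f i m)
        (fun Q => (extendedDrift f₀ f Q).2 k j) P = 0 := by
      have h3 : ∀ t : ℝ, (extendedDrift f₀ f (P + t • iteratedBracket f₀ f i m P)).2 k j =
          P.2 (k + 1) j := by
        intro t
        change (P.2 + t • (iteratedBracket f₀ f i m P).2) (k + 1) j = _
        rw [ih hP]; simp
      simp [lieDerivative, lineDeriv, h3]
    change _ - _ = _
    rw [h1, h2, sub_zero]; rfl

/-- The bracket `ad_{F₀ᵇ}^m f_i` depends on `x, u_b, ..., u_b^(m-1)` only. -/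
theorem factorsOn_iteratedBracket (hX : IsOpen X) (hf₀ : ContDiffOn ℝ ∞ f₀ X)
    (hf : ∀ i, ContDiffOn ℝ ∞ (f i) X) (i : Fin r) (m : ℕ) :
    FactorsOn m (fun P => (iteratedBracket f₀ f i m P).1) (X ×ˢ Set.univ) := by
  have hS : IsOpen (X ×ˢ (Set.univ : Set (ℕ → Fin q → ℝ))) := isOpen_jetsOver hX
  induction m with
  | zero => exact factorsOn_state (hf (Sum.inl i))
  | succ m ih =>
    rw [iteratedBracket_succ]
    refine FactorsOn.pi fun l => ?_
    have h1 : FactorsOn m (fun P => (iteratedBracket f₀ f i m P).1 l) (X ×ˢ Set.univ) :=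
      ih.comp (K := fun x => x l) (contDiff_apply ℝ ℝ l).contDiffOn fun _ _ => Set.mem_univ _
    have h2 : FactorsOn 1 (fun P => (extendedDrift f₀ f P).1 l) (X ×ˢ Set.univ) :=
      (factorsOn_affineSystem hf₀ fun j => hf (Sum.inr j)).comp (K := fun x => x l)
        (contDiff_apply ℝ ℝ l).contDiffOn fun _ _ => Set.mem_univ _
    have h3 := h1.lineDeriv hS (Nat.le_succ m)
      (factorsOn_jetTrunc_cartanField hf₀ (fun j => hf (Sum.inr j)) m)
    have h4 : FactorsOn (m + 1) (fun P => jetTrunc 1 (iteratedBracket f₀ f i m P))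
        (X ×ˢ Set.univ) := by
      have h5 : FactorsOn (m + 1) (fun _ => (0 : Fin 1 → Fin q → ℝ))
          (X ×ˢ (Set.univ : Set (ℕ → Fin q → ℝ))) :=
        ⟨fun _ => 0, contDiffOn_const, fun _ _ => rfl⟩
      refine ((ih.of_le (Nat.le_succ m)).prodMk h5).congr fun P hP => Prod.ext rfl ?_
      funext k
      change (iteratedBracket f₀ f i m P).2 k = 0
      rw [iteratedBracket_snd hX i m hP.1]; rfl
    exact (h3.prodMk (h2.lineDeriv hS (by omega) h4)).comp
      (K := fun p : ℝ × ℝ => p.1 - p.2) (contDiff_fst.sub contDiff_snd).contDiffOn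
      fun _ _ => Set.mem_univ _

/-- The fields of `Γᵃ_k` are combinations of the `ad_{F₀ᵇ}^m f_i`, `m ≤ k`, with smooth
coefficients. -/
theorem exists_eq_sum_of_mem_Gamma (hX : IsOpen X) (hf₀ : ContDiffOn ℝ ∞ f₀ X)
    (hf : ∀ i, ContDiffOn ℝ ∞ (f i) X) (k : ℕ) {γ : JetField n (Fin q)}
    (hγ : γ ∈ Gamma X f₀ f k) :
    ∃ (α : Type) (_ : Fintype α) (s : α → Fin r × ℕ) (c : α → Jet n (Fin q) → ℝ),
      (∀ a, (s a).2 < k + 1) ∧ (∀ a, JetSmoothMapOn (c a) (X ×ˢ Set.univ)) ∧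
      ∀ P, P.1 ∈ X → γ P = ∑ a, c a P • iteratedBracket f₀ f (s a).1 (s a).2 P := by
  have hS : IsOpen (X ×ˢ (Set.univ : Set (ℕ → Fin q → ℝ))) := isOpen_jetsOver hX
  induction k generalizing γ with
  | zero =>
    obtain ⟨c, hc, h⟩ := hγ
    exact ⟨Fin r, inferInstance, fun i => (i, 0), c, fun _ => Nat.zero_lt_one, hc, h⟩
  | succ k ih =>
    obtain ⟨δ, hδ, ε, hε, h⟩ := hγ
    obtain ⟨α, _, s, c, hs, hc, hδ⟩ := ih hδ
    obtain ⟨β, _, s', c', hs', hc', hε⟩ := ih hε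
    refine ⟨α ⊕ β ⊕ β, inferInstance,
      Sum.elim s (Sum.elim s' fun b => ((s' b).1, (s' b).2 + 1)),
      Sum.elim c (Sum.elim (fun b => lieDerivative (extendedDrift f₀ f) (c' b)) c'), ?_, ?_, ?_⟩
    · rintro (a | b | b)
      · exact (hs a).trans (Nat.lt_succ_self _)
      · exact (hs' b).trans (Nat.lt_succ_self _)
      · exact Nat.succ_lt_succ (hs' b)
    · rintro (a | b | b)
      · exact hc a
      · exact (hc' b).lieDerivative hS (isSmoothField_extendedDrift hf₀ hf)
      · exact hc' b
    · intro P hP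
      have hPS : P ∈ X ×ˢ (Set.univ : Set (ℕ → Fin q → ℝ)) := ⟨hP, Set.mem_univ _⟩
      rw [h P hP, hδ P hP, jetBracket_congr hS (fun Q hQ => hε Q hQ.1) hPS,
        jetBracket_sum_smul hS (isSmoothField_extendedDrift hf₀ hf)
          (fun b => isSmoothField_iteratedBracket hX hf₀ hf _ _) hc' hPS,
        Finset.sum_add_distrib]
      simp only [Fintype.sum_sum_type, Sum.elim_inl, Sum.elim_inr, iteratedBracket_succ]

omit [Fintype ι] in
theorem jetBracket_zero (η : JetField n ι) (P : Jet n ι) : jetBracket η (fun _ => 0) P = 0 := by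
  refine Prod.ext (funext fun i => ?_) (funext fun k => funext fun j => ?_) <;>
    simp [jetBracket, lieDerivative, lineDeriv]

theorem zero_mem_Gamma (k : ℕ) : (fun _ => 0) ∈ Gamma X f₀ f k := by
  induction k with
  | zero => exact ⟨fun _ _ => 0, fun _ => jetSmoothMapOn_const 0 _, fun P _ => by simp⟩
  | succ k ih => exact ⟨_, ih, _, ih, fun P _ => by rw [jetBracket_zero, add_zero]⟩

theorem iteratedBracket_mem_Gamma (i : Fin r) {m k : ℕ} (hmk : m ≤ k) :
    iteratedBracket f₀ f i m ∈ Gamma X f₀ f k := by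
  induction k generalizing m with
  | zero =>
    obtain rfl : m = 0 := by omega
    refine ⟨fun j _ => if j = i then 1 else 0, fun j => jetSmoothMapOn_const _ _, fun P _ => ?_⟩
    simp only [ite_smul, one_smul, zero_smul, Finset.sum_ite_eq', Finset.mem_univ, if_true]
    rfl
  | succ k ih =>
    rcases Nat.lt_or_ge k m with h | h
    · obtain rfl : m = k + 1 := by omega
      exact ⟨_, zero_mem_Gamma k, _, ih le_rfl, fun P _ => by
        rw [iteratedBracket_succ, zero_add]⟩
    · exact ⟨_, ih h, _, zero_mem_Gamma k, fun P _ => by rw [jetBracket_zero, add_zero]⟩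

theorem iteratedBracket_mem_levelSpan (i : Fin r) {m L : ℕ} (hm : m < L) (P : Jet n (Fin q)) :
    (iteratedBracket f₀ f i m P).1 ∈ levelSpan f₀ f L P :=
  Submodule.subset_span ⟨(i, m), hm, rfl⟩

theorem levelSpan_mono {L L' : ℕ} (h : L ≤ L') (P : Jet n (Fin q)) :
    levelSpan f₀ f L P ≤ levelSpan f₀ f L' P :=
  Submodule.span_mono (Set.image_mono fun _ ha => lt_of_lt_of_le ha h)

theorem mem_levelSpan_of_mem_Gamma (hX : IsOpen X) (hf₀ : ContDiffOn ℝ ∞ f₀ X)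
    (hf : ∀ i, ContDiffOn ℝ ∞ (f i) X) {k : ℕ} {γ : JetField n (Fin q)}
    (hγ : γ ∈ Gamma X f₀ f k) {P : Jet n (Fin q)} (hP : P.1 ∈ X) :
    (γ P).1 ∈ levelSpan f₀ f (k + 1) P ∧ (γ P).2 = 0 := by
  obtain ⟨α, _, s, c, hs, -, h⟩ := exists_eq_sum_of_mem_Gamma hX hf₀ hf k hγ
  rw [h P hP, Prod.fst_sum, Prod.snd_sum]
  refine ⟨Submodule.sum_mem _ fun a _ => Submodule.smul_mem _ _
    (iteratedBracket_mem_levelSpan _ (hs a) P), Finset.sum_eq_zero fun a _ => ?_⟩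
  rw [Prod.smul_snd, iteratedBracket_snd hX _ _ hP, smul_zero]

theorem span_valuesAt_Gamma (hX : IsOpen X) (hf₀ : ContDiffOn ℝ ∞ f₀ X)
    (hf : ∀ i, ContDiffOn ℝ ∞ (f i) X) (k : ℕ) {P : Jet n (Fin q)} (hP : P.1 ∈ X) :
    Submodule.span ℝ (valuesAt (Gamma X f₀ f k) P) =
      (levelSpan f₀ f (k + 1) P).map (LinearMap.inl ℝ (Fin n → ℝ) (ℕ → Fin q → ℝ)) := by
  apply le_antisymm
  · rw [Submodule.span_le]
    rintro _ ⟨γ, hγ, rfl⟩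
    obtain ⟨h1, h2⟩ := mem_levelSpan_of_mem_Gamma hX hf₀ hf hγ hP
    exact ⟨_, h1, Prod.ext rfl h2.symm⟩
  · rw [levelSpan, Submodule.map_span, Submodule.span_le]
    rintro _ ⟨_, ⟨a, ha, rfl⟩, rfl⟩
    refine Submodule.subset_span ⟨_, iteratedBracket_mem_Gamma a.1 (Nat.lt_succ_iff.1 ha), ?_⟩
    exact Prod.ext rfl (iteratedBracket_snd hX _ _ hP)

theorem dimAt_Gamma (hX : IsOpen X) (hf₀ : ContDiffOn ℝ ∞ f₀ X)
    (hf : ∀ i, ContDiffOn ℝ ∞ (f i) X) (k : ℕ) {P : Jet n (Fin q)} (hP : P.1 ∈ X) :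
    dimAt (Gamma X f₀ f k) P = Module.finrank ℝ (levelSpan f₀ f (k + 1) P) := by
  rw [dimAt, span_valuesAt_Gamma hX hf₀ hf k hP]
  exact (Submodule.equivMapOfInjective _ LinearMap.inl_injective _).finrank_eq.symm

end GammaStructure

/-! ### First integrals of the distributions -/

section FirstIntegrals

variable {n r q : ℕ} {X : Set (Fin n → ℝ)} {f₀ : (Fin n → ℝ) → Fin n → ℝ}
  {f : Fin r ⊕ Fin q → (Fin n → ℝ) → Fin n → ℝ}

/-- A covector that annihilates the values of the brackets `ad_{F₀ᵇ}^m f_i`, `m < L`, at a jet is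
the differential there of a common first integral of these brackets, which depends on the same
coordinates `x, u_b, ..., u_b^(L-2)` as they do. The derivatives of `u_b` are parameters:
Frobenius' theorem is applied in the space of truncated jets, to a basis of the distribution among
the brackets. -/
theorem exists_firstIntegral_iteratedBracket (hX : IsOpen X) (hf₀ : ContDiffOn ℝ ∞ f₀ X)
    (hf : ∀ i, ContDiffOn ℝ ∞ (f i) X) {D : Set (Jet n (Fin q))} (hD : IsOpen D)
    (hDX : D ⊆ X ×ˢ Set.univ) {L N d : ℕ} (hN : L ≤ N + 1)
    (hdim : ∀ P ∈ D, Module.finrank ℝ (levelSpan f₀ f L P) = d)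
    (hinv : ∀ P ∈ D, ∀ i m i' m', m < L → m' < L →
      (jetBracket (iteratedBracket f₀ f i m) (iteratedBracket f₀ f i' m') P).1 ∈
        levelSpan f₀ f L P)
    {P₀ : Jet n (Fin q)} (hP₀ : P₀ ∈ D) (θ : (Fin n → ℝ) →L[ℝ] ℝ)
    (hθ : ∀ v ∈ levelSpan f₀ f L P₀, θ v = 0) :
    ∃ W ⊆ D, IsOpen W ∧ P₀ ∈ W ∧ ∃ φ : TruncJet n (Fin q) N → ℝ,
      ContDiffOn ℝ ∞ φ (jetTrunc N '' W) ∧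
      (∀ Q ∈ W, ∀ i m, m < L → lieDerivative (iteratedBracket f₀ f i m) (pullTrunc φ) Q = 0) ∧
      ∀ v, lineDeriv ℝ (pullTrunc φ) P₀ (v, 0) = θ v := by
  have hS : IsOpen (X ×ˢ (Set.univ : Set (ℕ → Fin q → ℝ))) := isOpen_jetsOver hX
  -- a basis of the distribution at `P₀` among the brackets
  obtain ⟨I, hIL, -, hIspan, hIli⟩ := exists_linearIndepOn_extension (K := ℝ)
    (v := fun a : Fin r × ℕ => (iteratedBracket f₀ f a.1 a.2 P₀).1)
    (linearIndepOn_empty ℝ _) (Set.empty_subset {a : Fin r × ℕ | a.2 < L})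
  have hfin : I.Finite := by
    refine Set.Finite.subset ?_ hIL
    have : {a : Fin r × ℕ | a.2 < L} = Set.univ ×ˢ Set.Iio L := by ext; simp
    rw [this]
    exact Set.finite_univ.prod (Set.finite_Iio L)
  have : Fintype I := hfin.fintype
  -- the fields of the basis, as functions of the truncated jet
  have hfac : ∀ a : I, FactorsOn N (fun P => (iteratedBracket f₀ f a.1.1 a.1.2 P).1)
      (X ×ˢ Set.univ) := fun a =>
    (factorsOn_iteratedBracket hX hf₀ hf a.1.1 a.1.2).of_le (by
      have : a.1.2 < L := hIL a.2
      omega)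
  choose G hG hGeq using hfac
  let s₀ : Set (TruncJet n (Fin q) N) := jetTrunc N '' D
  have hs₀ : IsOpen s₀ := isOpen_image_jetTrunc hD
  have hG₀ : ∀ a, ContDiffOn ℝ ∞ (G a) s₀ := fun a => (hG a).mono (Set.image_mono hDX)
  let s : Set (TruncJet n (Fin q) N) :=
    s₀ ∩ (fun p a => G a p) ⁻¹' {v : I → Fin n → ℝ | LinearIndependent ℝ v}
  have hs : IsOpen s := (continuousOn_pi.2 fun a => (hG₀ a).continuousOn).isOpen_inter_preimage hs₀
    isOpen_setOfPred_linearIndependent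
  have hp₀ : jetTrunc N P₀ ∈ s := by
    refine ⟨⟨P₀, hP₀, rfl⟩, ?_⟩
    have h1 : (fun a : I => G a (jetTrunc N P₀)) =
        fun a : I => (iteratedBracket f₀ f a.1.1 a.1.2 P₀).1 :=
      funext fun a => (hGeq a P₀ (hDX hP₀)).symm
    change LinearIndependent ℝ fun a : I => G a (jetTrunc N P₀)
    rw [h1]
    exact hIli
  have hcard : Fintype.card I = d := by
    have h1 : levelSpan f₀ f L P₀ = Submodule.span ℝ (Set.range fun a : I =>
        (iteratedBracket f₀ f a.1.1 a.1.2 P₀).1) := by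
      rw [← Set.image_eq_range fun a : Fin r × ℕ => (iteratedBracket f₀ f a.1 a.2 P₀).1]
      exact le_antisymm (Submodule.span_le.2 hIspan) (Submodule.span_mono (Set.image_mono hIL))
    rw [← hdim P₀ hP₀, h1]
    exact (finrank_span_eq_card hIli).symm
  have hspan : ∀ P ∈ D, jetTrunc N P ∈ s →
      levelSpan f₀ f L P = Submodule.span ℝ (Set.range fun a => G a (jetTrunc N P)) := by
    intro P hP hPs
    symm
    apply Submodule.eq_of_le_of_finrank_eq
    · rw [Submodule.span_le]
      rintro _ ⟨a, rfl⟩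
      change G a (jetTrunc N P) ∈ levelSpan f₀ f L P
      rw [← hGeq a P (hDX hP)]
      exact iteratedBracket_mem_levelSpan _ (hIL a.2) P
    · rw [finrank_span_eq_card hPs.2, hcard, hdim P hP]
  -- the distribution on truncated jets
  let e : TruncJet n (Fin q) N → (I → ℝ) →L[ℝ] TruncJet n (Fin q) N := fun p =>
    ∑ a, (ContinuousLinearMap.proj (R := ℝ) (φ := fun _ : I => ℝ) a).smulRight
      ((G a p, 0) : TruncJet n (Fin q) N)
  have he_apply : ∀ p c, e p c = ((∑ a, c a • G a p, 0) : TruncJet n (Fin q) N) := by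
    intro p c
    simp only [e, _root_.sum_apply, ContinuousLinearMap.smulRight_apply,
      ContinuousLinearMap.proj_apply]
    refine Prod.ext ?_ ?_
    · simp [Prod.fst_sum]
    · simp [Prod.snd_sum]
  have he : ContDiffOn ℝ ∞ e s := by
    refine ContDiffOn.sum fun a _ => ?_
    exact contDiffOn_const.smulRight
      (((hG₀ a).mono Set.inter_subset_left).prodMk contDiffOn_const)
  have hrange : ∀ p ∈ s, ∀ v ∈ Submodule.span ℝ (Set.range fun a => G a p),
      ∃ b, e p b = (v, 0) := by
    intro p _ v hv
    obtain ⟨b, hb⟩ := (Submodule.mem_span_range_iff_exists_fun ℝ).1 hv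
    exact ⟨b, by rw [he_apply, hb]⟩
  have hinj : Function.Injective (e (jetTrunc N P₀)) := by
    rw [injective_iff_map_eq_zero]
    intro c hc
    rw [he_apply] at hc
    exact funext (Fintype.linearIndependent_iff.1 hp₀.2 c (congrArg Prod.fst hc))
  have hGd : ∀ p ∈ s, ∀ a, HasFDerivAt (G a) (fderiv ℝ (G a) p) p := fun p hp a =>
    (((hG₀ a).contDiffAt (hs₀.mem_nhds hp.1)).differentiableAt (by simp)).hasFDerivAt
  have hed : ∀ p ∈ s, ∀ v c, fderiv ℝ e p v c =
      ((∑ a, c a • fderiv ℝ (G a) p v, 0) : TruncJet n (Fin q) N) := by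
    intro p hp v c
    have h1 : HasFDerivAt e (fderiv ℝ e p) p :=
      ((he.contDiffAt (hs.mem_nhds hp)).differentiableAt (by simp)).hasFDerivAt
    have h2 := h1.clm_apply (hasFDerivAt_const c p)
    have h3 : HasFDerivAt (fun x => e x c)
        ((∑ a, c a • fderiv ℝ (G a) p).prod (0 : _ →L[ℝ] (Fin N → Fin q → ℝ))) p := by
      have h4 : HasFDerivAt (fun x => ∑ a, c a • G a x) (∑ a, c a • fderiv ℝ (G a) p) p :=
        HasFDerivAt.fun_sum fun a _ => (hGd p hp a).const_smul (c a)
      have h5 := h4.prodMk (hasFDerivAt_const (0 : Fin N → Fin q → ℝ) p)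
      exact h5.congr_of_eventuallyEq (Filter.Eventually.of_forall fun x => he_apply x c)
    have h6 := congrArg (fun L => L v) (h2.unique h3)
    simpa [_root_.sum_apply] using h6
  have hbr : ∀ p ∈ s, ∀ a b, fderiv ℝ (G a) p (G b p, 0) - fderiv ℝ (G b) p (G a p, 0) ∈
      Submodule.span ℝ (Set.range fun a => G a p) := by
    rintro p hp a b
    obtain ⟨P, hP, rfl⟩ := hp.1
    rw [← hspan P hP hp]
    have hPS := hDX hP
    have htr : ∀ c : I, jetTrunc N (iteratedBracket f₀ f c.1.1 c.1.2 P) =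
        ((G c (jetTrunc N P), 0) : TruncJet n (Fin q) N) := by
      intro c
      refine Prod.ext (hGeq c P hPS) (funext fun k => ?_)
      change (iteratedBracket f₀ f c.1.1 c.1.2 P).2 k = 0
      rw [iteratedBracket_snd hX _ _ hPS.1]; rfl
    have hcoord : ∀ c c' : I, ∀ l, lieDerivative (iteratedBracket f₀ f c'.1.1 c'.1.2)
        (fun Q => (iteratedBracket f₀ f c.1.1 c.1.2 Q).1 l) P =
        fderiv ℝ (G c) (jetTrunc N P) (G c' (jetTrunc N P), 0) l := by
      intro c c' l
      have h1 : HasFDerivAt (fun p => G c p l)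
          ((ContinuousLinearMap.proj l).comp (fderiv ℝ (G c) (jetTrunc N P))) (jetTrunc N P) :=
        (hasFDerivAt_apply (𝕜 := ℝ) l (G c (jetTrunc N P))).comp (jetTrunc N P) (hGd _ hp c)
      have h2 := lineDeriv_eq_fderiv (g := fun Q => (iteratedBracket f₀ f c.1.1 c.1.2 Q).1 l)
        (H := fun p => G c p l) hS ((contDiff_apply ℝ ℝ l).comp_contDiffOn (hG c))
        (fun Q hQ => congrFun (hGeq c Q hQ) l) hPS (iteratedBracket f₀ f c'.1.1 c'.1.2 P)
      rw [h1.fderiv, htr] at h2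
      exact h2
    have h3 := hinv P hP b.1.1 b.1.2 a.1.1 a.1.2 (hIL b.2) (hIL a.2)
    convert h3 using 1
    funext l
    change _ = lieDerivative _ _ _ - lieDerivative _ _ _
    rw [hcoord a b l, hcoord b a l]
    rfl
  have hinv' : ∀ p ∈ s, ∀ c c', ∃ b,
      fderiv ℝ e p (e p c) c' - fderiv ℝ e p (e p c') c = e p b := by
    intro p hp c c'
    have hlin : ∀ (c : I → ℝ) a, fderiv ℝ (G a) p (e p c) =
        ∑ b, c b • fderiv ℝ (G a) p (G b p, 0) := by
      intro c a
      have h1 : e p c = ∑ b, c b • ((G b p, 0) : TruncJet n (Fin q) N) := by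
        rw [he_apply]
        refine Prod.ext ?_ ?_
        · simp [Prod.fst_sum]
        · simp [Prod.snd_sum]
      rw [h1, map_sum]
      simp only [map_smul]
    have h2 : (∑ a, c' a • fderiv ℝ (G a) p (e p c)) - ∑ a, c a • fderiv ℝ (G a) p (e p c') =
        ∑ a, ∑ b, (c' a * c b) •
          (fderiv ℝ (G a) p (G b p, 0) - fderiv ℝ (G b) p (G a p, 0)) := by
      simp only [hlin, smul_sub, Finset.sum_sub_distrib, Finset.smul_sum, smul_smul]
      congr 1
      rw [Finset.sum_comm]
      refine Finset.sum_congr rfl fun a _ => Finset.sum_congr rfl fun b _ => ?_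
      rw [mul_comm]
    obtain ⟨b, hb⟩ := hrange p hp _ (Submodule.sum_mem _ fun a _ => Submodule.sum_mem _ fun b _ =>
      Submodule.smul_mem _ (c' a * c b) (hbr p hp a b))
    refine ⟨b, ?_⟩
    rw [hb, hed p hp, hed p hp, ← h2]
    exact Prod.ext rfl (sub_zero _)
  obtain ⟨t, ht, hp₀t, hts, φ, hφ, hφe, hφ₀⟩ := exists_firstIntegral hs hp₀ he hinj hinv'
    (θ.comp (ContinuousLinearMap.fst ℝ _ _)) (fun c => by
      rw [he_apply, ContinuousLinearMap.comp_apply]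
      refine hθ _ ?_
      rw [hspan P₀ hP₀ hp₀]
      exact Submodule.sum_mem _ fun a _ => Submodule.smul_mem _ _
        (Submodule.subset_span ⟨a, rfl⟩))
  have hWo : IsOpen (D ∩ jetTrunc N ⁻¹' t) := hD.inter (ht.preimage continuous_jetTrunc)
  have himg : jetTrunc N '' (D ∩ jetTrunc N ⁻¹' t) ⊆ t := by
    rintro _ ⟨P, hP, rfl⟩
    exact hP.2
  refine ⟨D ∩ jetTrunc N ⁻¹' t, Set.inter_subset_left, hWo, ⟨hP₀, hp₀t⟩, φ, hφ.mono himg, ?_, ?_⟩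
  · intro Q hQ i m hm
    have hQS := hDX hQ.1
    have hQs : jetTrunc N Q ∈ s := hts hQ.2
    have h1 := iteratedBracket_mem_levelSpan (f₀ := f₀) (f := f) i hm Q
    rw [hspan Q hQ.1 hQs] at h1
    obtain ⟨b, hb⟩ := hrange _ hQs _ h1
    have h2 : jetTrunc N (iteratedBracket f₀ f i m Q) = e (jetTrunc N Q) b := by
      rw [hb]
      refine Prod.ext rfl (funext fun k => ?_)
      change (iteratedBracket f₀ f i m Q).2 k = 0
      rw [iteratedBracket_snd hX _ _ hQS.1]; rfl
    unfold lieDerivative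
    rw [lineDeriv_eq_fderiv (g := pullTrunc φ) (H := φ) hWo (hφ.mono himg) (fun _ _ => rfl) hQ, h2]
    exact hφe _ hQ.2 b
  · intro v
    rw [lineDeriv_eq_fderiv (g := pullTrunc φ) (H := φ) hWo (hφ.mono himg) (fun _ _ => rfl)
      ⟨hP₀, hp₀t⟩, hφ₀]
    rfl

/-- If `h` is a first integral of the brackets `ad_{F₀ᵇ}^m f_i`, `m < L`, then each Lie derivative
along the drift can be exchanged for one more bracket, up to sign, as long as the order does not
exceed `L`. -/
theorem lieDerivative_iteratedBracket_iterate (hX : IsOpen X) (hf₀ : ContDiffOn ℝ ∞ f₀ X)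
    (hf : ∀ i, ContDiffOn ℝ ∞ (f i) X) {W : Set (Jet n (Fin q))} (hW : IsOpen W)
    (hWX : W ⊆ X ×ˢ Set.univ) {h : Jet n (Fin q) → ℝ} (hh : JetSmoothMapOn h W) {L : ℕ}
    (hL : ∀ Q ∈ W, ∀ i m, m < L → lieDerivative (iteratedBracket f₀ f i m) h Q = 0)
    (i : Fin r) (j m : ℕ) (hjm : m + j ≤ L) {P : Jet n (Fin q)} (hP : P ∈ W) :
    lieDerivative (iteratedBracket f₀ f i m) ((lieDerivative (extendedDrift f₀ f))^[j] h) P =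
      (-1) ^ j * lieDerivative (iteratedBracket f₀ f i (m + j)) h P := by
  have hF := (isSmoothField_extendedDrift (r := r) hf₀ hf).mono hWX
  induction j generalizing m P with
  | zero => simp
  | succ j ih =>
    have hj := hh.iterate_lieDerivative hW hF j
    have hzero : ∀ Q ∈ W, lieDerivative (iteratedBracket f₀ f i m)
        ((lieDerivative (extendedDrift f₀ f))^[j] h) Q = 0 := by
      intro Q hQ
      rw [ih m (by omega) hQ, hL Q hQ i (m + j) (by omega), mul_zero]
    have h1 := lieDerivative_jetBracket hW hF
      ((isSmoothField_iteratedBracket hX hf₀ hf i m).mono hWX) hj hP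
    rw [← iteratedBracket_succ, lieDerivative_congr (C' := extendedDrift f₀ f)
      (g' := fun _ => (0 : ℝ)) hW hzero hP rfl, ih (m + 1) (by omega) hP] at h1
    have h2 : lieDerivative (extendedDrift f₀ f) (fun _ => (0 : ℝ)) P = 0 := by
      simp [lieDerivative, lineDeriv]
    rw [h2, zero_sub] at h1
    rw [Function.iterate_succ_apply', pow_succ, mul_neg_one, neg_mul, ← neg_eq_iff_eq_neg, ← h1,
      Nat.add_right_comm, Nat.add_assoc]

/-- A function killed by the brackets `ad_{F₀ᵇ}^m f_i`, `m ≤ l`, at a jet is killed by `Γᵃ_l`. -/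
theorem lieDerivative_eq_zero_of_mem_Gamma (hX : IsOpen X) (hf₀ : ContDiffOn ℝ ∞ f₀ X)
    (hf : ∀ i, ContDiffOn ℝ ∞ (f i) X) {W : Set (Jet n (Fin q))} (hW : IsOpen W)
    (hWX : W ⊆ X ×ˢ Set.univ) {h : Jet n (Fin q) → ℝ} (hh : JetSmoothMapOn h W)
    {P : Jet n (Fin q)} (hP : P ∈ W) {l : ℕ}
    (hl : ∀ i m, m ≤ l → lieDerivative (iteratedBracket f₀ f i m) h P = 0)
    {γ : JetField n (Fin q)} (hγ : γ ∈ Gamma X f₀ f l) : lieDerivative γ h P = 0 := by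
  obtain ⟨α, _, s, c, hs, -, hsum⟩ := exists_eq_sum_of_mem_Gamma hX hf₀ hf l hγ
  obtain ⟨A, hA⟩ := hh.exists_linearMap hW hP
  unfold lieDerivative at hl ⊢
  rw [hsum P (hWX hP).1, hA, map_sum]
  refine Finset.sum_eq_zero fun a _ => ?_
  rw [map_smul, ← hA, hl _ _ (Nat.lt_succ_iff.1 (hs a)), smul_zero]

end FirstIntegrals

/-! ### Brunovský indices -/

section Brunovsky

/-- The Brunovský indices are the conjugate sequence of the dimension jumps. -/
theorem lt_brunovskyIndex_iff {ρ : ℕ → ℕ} {p : ℕ} (hanti : Antitone (dimJump ρ))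
    (hzero : ∀ j, p < j → dimJump ρ j = 0) (i j : ℕ) :
    j < brunovskyIndex ρ i ↔ i + 1 ≤ dimJump ρ j := by
  have hfin : {j | i + 1 ≤ dimJump ρ j}.Finite := by
    refine (Set.finite_Iic p).subset fun j hj => ?_
    by_contra h
    have h1 : i + 1 ≤ dimJump ρ j := hj
    rw [hzero j (not_le.1 h)] at h1
    omega
  constructor
  · intro h
    by_contra hlt
    have hsub : {j | i + 1 ≤ dimJump ρ j} ⊆ Set.Iio j := by
      intro j' hj'
      by_contra hle
      exact hlt (le_trans hj' (hanti (not_lt.1 hle)))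
    have := Set.ncard_le_ncard hsub (Set.finite_Iio j)
    rw [Set.ncard_eq_toFinset_card' (Set.Iio j)] at this
    simp only [Set.toFinset_Iio, Nat.card_Iio] at this
    unfold brunovskyIndex at h
    omega
  · intro h
    have hsub : Set.Iic j ⊆ {j | i + 1 ≤ dimJump ρ j} := fun j' hj' => h.trans (hanti hj')
    have := Set.ncard_le_ncard hsub hfin
    rw [Set.ncard_eq_toFinset_card' (Set.Iic j)] at this
    simp only [Set.toFinset_Iic, Nat.card_Iic] at this
    unfold brunovskyIndex
    omega

theorem brunovskyIndex_eq_sum {ρ : ℕ → ℕ} {p : ℕ} (hzero : ∀ j, p < j → dimJump ρ j = 0)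
    (i : ℕ) : brunovskyIndex ρ i =
      ∑ j ∈ Finset.range (p + 1), if i + 1 ≤ dimJump ρ j then 1 else 0 := by
  rw [← Finset.card_filter, brunovskyIndex, ← Set.ncard_coe_finset]
  congr 1
  ext j
  simp only [Set.mem_ofPred_eq, Finset.coe_filter, Finset.mem_range]
  refine ⟨fun h => ⟨?_, h⟩, fun h => h.2⟩
  by_contra hj
  rw [hzero j (by omega)] at h
  omega

theorem sum_brunovskyIndex {ρ : ℕ → ℕ} {p r : ℕ} (hmono : Monotone ρ)
    (hzero : ∀ j, p < j → dimJump ρ j = 0) (hr : ∀ j, dimJump ρ j ≤ r) :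
    ∑ i : Fin r, brunovskyIndex ρ i = ρ p := by
  have h1 : ∀ j, ∑ i : Fin r, (if (i : ℕ) + 1 ≤ dimJump ρ j then 1 else 0) = dimJump ρ j := by
    intro j
    rw [Fin.sum_univ_eq_sum_range (fun i => if i + 1 ≤ dimJump ρ j then 1 else 0) r,
      ← Finset.card_filter]
    have : (Finset.range r).filter (fun i => i + 1 ≤ dimJump ρ j) =
        Finset.range (dimJump ρ j) := by
      ext i
      simp only [Finset.mem_filter, Finset.mem_range]
      have := hr j
      omega
    rw [this, Finset.card_range]
  have h2 : ∀ p, ∑ j ∈ Finset.range (p + 1), dimJump ρ j = ρ p := by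
    intro p
    induction p with
    | zero => simp [dimJump]
    | succ p ih =>
      rw [Finset.sum_range_succ, ih]
      have : ρ p ≤ ρ (p + 1) := hmono (Nat.le_succ p)
      change ρ p + (ρ (p + 1) - ρ p) = _
      omega
  simp only [brunovskyIndex_eq_sum hzero]
  rw [Finset.sum_comm]
  simp only [h1, h2]

end Brunovsky

/-! ### Linear algebra of adapted families -/

section LinearAlgebra

/-- Independent vectors can be chosen one by one in subspaces of increasing dimensions. -/
theorem exists_linearIndependent_mem {E : Type*} [AddCommGroup E] [Module ℝ E]
    [FiniteDimensional ℝ E] {r : ℕ} (B : Fin r → Submodule ℝ E)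
    (hB : ∀ i : Fin r, (i : ℕ) + 1 ≤ Module.finrank ℝ (B i)) :
    ∃ c : Fin r → E, (∀ i, c i ∈ B i) ∧ LinearIndependent ℝ c := by
  induction r with
  | zero => exact ⟨fun i => i.elim0, fun i => i.elim0, linearIndependent_empty_type⟩
  | succ r ih =>
    obtain ⟨c, hcB, hc⟩ := ih (fun i => B i.castSucc) fun i => by simpa using hB i.castSucc
    have hlast : ¬ B (Fin.last r) ≤ Submodule.span ℝ (Set.range c) := by
      intro hle
      have h1 := Submodule.finrank_mono hle
      have h2 := hB (Fin.last r)
      rw [finrank_span_eq_card hc, Fintype.card_fin] at h1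
      simp only [Fin.val_last] at h2
      omega
    obtain ⟨v, hv, hvc⟩ := SetLike.not_le_iff_exists.1 hlast
    refine ⟨Fin.snoc c v, fun i => ?_, linearIndependent_finSnoc.2 ⟨hc, hvc⟩⟩
    refine Fin.lastCases ?_ (fun i => ?_) i
    · simpa using hv
    · simpa using hcB i

/-- Covectors `w_{i,j}`, `j < kᵢ`, are independent if their values on vectors `a_{m,b}` are block
triangular with respect to the level `kᵢ - 1 - j`, with (up to signs) columns of one invertible
matrix in the diagonal blocks. -/
theorem linearIndependent_of_triangular {n r : ℕ} {k : Fin r → ℕ}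
    {w : (Σ i : Fin r, Fin (k i)) → Fin n → ℝ} {a : ℕ → Fin r → Fin n → ℝ}
    {M : Matrix (Fin r) (Fin r) ℝ} (hM : M.det ≠ 0)
    (h0 : ∀ i (j : Fin (k i)) m b, m + j + 1 < k i → w ⟨i, j⟩ ⬝ᵥ a m b = 0)
    (h1 : ∀ i (j : Fin (k i)) m b, m + j + 1 = k i →
      w ⟨i, j⟩ ⬝ᵥ a m b = (-1) ^ (j : ℕ) * M b i) :
    LinearIndependent ℝ w := by
  rw [Fintype.linearIndependent_iff]
  intro g hg
  suffices h : ∀ m i (j : Fin (k i)), m + j + 1 = k i → g ⟨i, j⟩ = 0 by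
    rintro ⟨i, j⟩
    exact h (k i - 1 - j) i j (by omega)
  intro m
  induction m using Nat.strong_induction_on with
  | _ m ih =>
    -- the components of level `m` of the relation, as a vector indexed by `i`
    let y : Fin r → ℝ := fun i => if h : m < k i then
      (-1) ^ (k i - 1 - m) * g ⟨i, ⟨k i - 1 - m, by omega⟩⟩ else 0
    have hy : M.mulVec y = 0 := by
      funext b
      have h2 : (∑ s, g s • w s) ⬝ᵥ a m b = 0 := by rw [hg, zero_dotProduct]
      rw [sum_dotProduct, Fintype.sum_sigma] at h2
      rw [Pi.zero_apply, ← h2, Matrix.mulVec, dotProduct]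
      refine Finset.sum_congr rfl fun i _ => ?_
      by_cases hmi : m < k i
      · rw [Finset.sum_eq_single (⟨k i - 1 - m, by omega⟩ : Fin (k i))]
        · rw [smul_dotProduct, h1 i _ m b (by simp only; omega)]
          simp only [y, hmi, dite_true, smul_eq_mul]
          ring
        · intro j _ hj
          have hj' : (j : ℕ) ≠ k i - 1 - m := fun h => hj (Fin.ext h)
          have hjk := j.2
          rw [smul_dotProduct]
          rcases lt_or_gt_of_ne (show m + j + 1 ≠ k i by omega) with h | h
          · rw [h0 i j m b h, smul_zero]
          · rw [ih (k i - 1 - j) (by omega) i j (by omega), zero_smul]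
        · intro h
          exact absurd (Finset.mem_univ _) h
      · simp only [y, hmi, dite_false, mul_zero]
        symm
        refine Finset.sum_eq_zero fun j _ => ?_
        have hjk := j.2
        rw [smul_dotProduct, ih (k i - 1 - j) (by omega) i j (by omega), zero_smul]
    have hy0 := Matrix.eq_zero_of_mulVec_eq_zero hM hy
    intro i j hij
    have hmi : m < k i := by omega
    have h3 := congrFun hy0 i
    simp only [y, hmi, dite_true, Pi.zero_apply] at h3
    have h4 : j = ⟨k i - 1 - m, by omega⟩ := Fin.ext (by simp only; omega)
    rw [h4]
    exact (mul_eq_zero.1 h3).resolve_left (pow_ne_zero _ (by norm_num))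

end LinearAlgebra

/-! ### Existence of Brunovský families of first integrals -/

section Existence

variable {n r q : ℕ} {X : Set (Fin n → ℝ)} {f₀ : (Fin n → ℝ) → Fin n → ℝ}
  {f : Fin r ⊕ Fin q → (Fin n → ℝ) → Fin n → ℝ}

/-- The regularity assumptions on an open set `D` of jets, in terms of the iterated brackets: the
distributions `Γᵃ_k` have constant dimensions `ρ k` and are involutive, `Γᵃ_0` has the largest
possible dimension and `Γᵃ_p` is the whole tangent space. -/
structure IsRegularOn (X : Set (Fin n → ℝ)) (f₀ : (Fin n → ℝ) → Fin n → ℝ)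
    (f : Fin r ⊕ Fin q → (Fin n → ℝ) → Fin n → ℝ) (D : Set (Jet n (Fin q))) (ρ : ℕ → ℕ)
    (p : ℕ) : Prop where
  isOpen_states : IsOpen X
  smooth_drift : ContDiffOn ℝ ∞ f₀ X
  smooth_fields : ∀ i, ContDiffOn ℝ ∞ (f i) X
  isOpen : IsOpen D
  subset : D ⊆ X ×ˢ Set.univ
  nonempty : D.Nonempty
  finrank_eq : ∀ k, ∀ P ∈ D, Module.finrank ℝ (levelSpan f₀ f (k + 1) P) = ρ k
  involutive : ∀ L, ∀ P ∈ D, ∀ i m i' m', m < L → m' < L →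
    (jetBracket (iteratedBracket f₀ f i m) (iteratedBracket f₀ f i' m') P).1 ∈ levelSpan f₀ f L P
  base : ρ 0 = r
  full : ∀ P ∈ D, levelSpan f₀ f (p + 1) P = ⊤

/-- The values on `ad_{F₀ᵇ}^l f_1, ..., ad_{F₀ᵇ}^l f_r` of a covector. -/
noncomputable def bracketValues (f₀ : (Fin n → ℝ) → Fin n → ℝ)
    (f : Fin r ⊕ Fin q → (Fin n → ℝ) → Fin n → ℝ) (l : ℕ) (P : Jet n (Fin q)) :
    Module.Dual ℝ (Fin n → ℝ) →ₗ[ℝ] Fin r → ℝ :=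
  LinearMap.pi fun i => Module.Dual.eval ℝ (Fin n → ℝ) (iteratedBracket f₀ f i l P).1

/-- The values on `ad_{F₀ᵇ}^l f_1, ..., ad_{F₀ᵇ}^l f_r` of the covectors that annihilate the
brackets of order less than `l`; this is the dual of `Γᵃ_l / Γᵃ_{l-1}`. -/
noncomputable def levelDual (f₀ : (Fin n → ℝ) → Fin n → ℝ)
    (f : Fin r ⊕ Fin q → (Fin n → ℝ) → Fin n → ℝ) (l : ℕ) (P : Jet n (Fin q)) :
    Submodule ℝ (Fin r → ℝ) :=
  (levelSpan f₀ f l P).dualAnnihilator.map (bracketValues f₀ f l P)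

theorem levelSpan_zero (P : Jet n (Fin q)) : levelSpan f₀ f 0 P = ⊥ := by
  simp [levelSpan]

theorem mem_dualAnnihilator_levelSpan_succ {l : ℕ} {P : Jet n (Fin q)}
    {θ : Module.Dual ℝ (Fin n → ℝ)} :
    θ ∈ (levelSpan f₀ f (l + 1) P).dualAnnihilator ↔
      θ ∈ (levelSpan f₀ f l P).dualAnnihilator ∧ bracketValues f₀ f l P θ = 0 := by
  constructor
  · intro h
    refine ⟨Submodule.dualAnnihilator_anti (levelSpan_mono (Nat.le_succ l) P) h, ?_⟩
    funext i
    exact (Submodule.mem_dualAnnihilator _).1 h _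
      (iteratedBracket_mem_levelSpan i (Nat.lt_succ_self l) P)
  · rintro ⟨h1, h2⟩
    have hle : levelSpan f₀ f (l + 1) P ≤ LinearMap.ker θ := by
      refine Submodule.span_le.2 ?_
      rintro _ ⟨⟨i, m⟩, hm, rfl⟩
      rcases Nat.lt_succ_iff_lt_or_eq.1 (show m < l + 1 from hm) with h | rfl
      · exact (Submodule.mem_dualAnnihilator _).1 h1 _ (iteratedBracket_mem_levelSpan i h P)
      · exact congrFun h2 i
    exact (Submodule.mem_dualAnnihilator _).2 fun v hv => hle hv

theorem finrank_levelDual_add (l : ℕ) (P : Jet n (Fin q)) :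
    Module.finrank ℝ (levelDual f₀ f l P) + Module.finrank ℝ (levelSpan f₀ f l P) =
      Module.finrank ℝ (levelSpan f₀ f (l + 1) P) := by
  let A := (levelSpan f₀ f l P).dualAnnihilator
  let R := (bracketValues f₀ f l P).domRestrict A
  have h1 := LinearMap.finrank_range_add_finrank_ker (K := ℝ) (V := A) (V₂ := Fin r → ℝ) R
  have h2 : LinearMap.range R = levelDual f₀ f l P := LinearMap.range_domRestrict _ _
  have h3 : (LinearMap.ker R).map A.subtype = (levelSpan f₀ f (l + 1) P).dualAnnihilator := by
    ext θ
    rw [mem_dualAnnihilator_levelSpan_succ]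
    simp only [Submodule.mem_map, LinearMap.mem_ker, Submodule.subtype_apply]
    constructor
    · rintro ⟨x, hx, rfl⟩
      exact ⟨x.2, hx⟩
    · rintro ⟨hA, hR⟩
      exact ⟨⟨θ, hA⟩, hR, rfl⟩
  have h4 : Module.finrank ℝ (LinearMap.ker R) =
      Module.finrank ℝ (levelSpan f₀ f (l + 1) P).dualAnnihilator := by
    rw [← h3]
    exact (Submodule.equivMapOfInjective _ A.injective_subtype _).finrank_eq
  have h5 := Subspace.finrank_add_finrank_dualAnnihilator_eq (levelSpan f₀ f l P)
  have h6 := Subspace.finrank_add_finrank_dualAnnihilator_eq (levelSpan f₀ f (l + 1) P)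
  have h7 : Module.finrank ℝ A = Module.finrank ℝ (levelSpan f₀ f l P).dualAnnihilator := rfl
  rw [h2] at h1
  omega

theorem JetSmoothMapOn.lineDeriv_state {h : Jet n (Fin q) → ℝ} {U : Set (Jet n (Fin q))}
    (hU : IsOpen U) (hh : JetSmoothMapOn h U) {P : Jet n (Fin q)} (hP : P ∈ U) (v : Fin n → ℝ) :
    _root_.lineDeriv ℝ h P (v, 0) =
      (fun l => _root_.lineDeriv ℝ h P (Pi.single l 1, 0)) ⬝ᵥ v := by
  obtain ⟨A, hA⟩ := hh.exists_linearMap hU hP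
  simp only [hA]
  have h1 : ((v, 0) : Jet n (Fin q)) = ∑ l, v l • ((Pi.single l 1, 0) : Jet n (Fin q)) := by
    refine Prod.ext ?_ ?_
    · funext i
      simp [Prod.fst_sum, Finset.sum_apply, Pi.single_apply]
    · simp [Prod.snd_sum]
  rw [h1, map_sum]
  simp only [map_smul, smul_eq_mul, dotProduct, mul_comm]

variable {D : Set (Jet n (Fin q))} {ρ : ℕ → ℕ} {p : ℕ}

theorem IsRegularOn.exists_firstIntegral (h : IsRegularOn X f₀ f D ρ p) {L N : ℕ}
    (hN : L ≤ N + 1) {P : Jet n (Fin q)} (hP : P ∈ D) {θ : Module.Dual ℝ (Fin n → ℝ)}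
    (hθ : θ ∈ (levelSpan f₀ f L P).dualAnnihilator) :
    ∃ W ⊆ D, IsOpen W ∧ P ∈ W ∧ ∃ φ : TruncJet n (Fin q) N → ℝ,
      ContDiffOn ℝ ∞ φ (jetTrunc N '' W) ∧
      (∀ Q ∈ W, ∀ i m, m < L → lieDerivative (iteratedBracket f₀ f i m) (pullTrunc φ) Q = 0) ∧
      ∀ v, lineDeriv ℝ (pullTrunc φ) P (v, 0) = θ v := by
  obtain ⟨d, hd⟩ : ∃ d, ∀ Q ∈ D, Module.finrank ℝ (levelSpan f₀ f L Q) = d := by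
    cases L with
    | zero => exact ⟨0, fun Q _ => by rw [levelSpan_zero, finrank_bot]⟩
    | succ L => exact ⟨ρ L, h.finrank_eq L⟩
  exact exists_firstIntegral_iteratedBracket h.isOpen_states h.smooth_drift h.smooth_fields
    h.isOpen h.subset hN hd (h.involutive L) hP (LinearMap.toContinuousLinearMap θ)
    ((Submodule.mem_dualAnnihilator _).1 hθ)

/-- The dual spaces of the quotients `Γᵃ_l / Γᵃ_{l-1}` decrease: differentiating a first integral
of `Γᵃ_l` along the drift gives a first integral of `Γᵃ_{l-1}` with, up to sign, the same values on
the brackets of one order less. -/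
theorem IsRegularOn.levelDual_succ_le (h : IsRegularOn X f₀ f D ρ p) (l : ℕ)
    {P : Jet n (Fin q)} (hP : P ∈ D) : levelDual f₀ f (l + 1) P ≤ levelDual f₀ f l P := by
  rintro _ ⟨θ, hθ, rfl⟩
  obtain ⟨W, hWD, hW, hPW, φ, hφ, hφ0, hφP⟩ := h.exists_firstIntegral (N := l) le_rfl hP hθ
  have hWX := hWD.trans h.subset
  have hφs : JetSmoothMapOn (pullTrunc φ) W := ⟨l, φ, hφ, fun _ _ => rfl⟩
  have hψ := hφs.iterate_lieDerivative hW
    ((isSmoothField_extendedDrift (r := r) h.smooth_drift h.smooth_fields).mono hWX) 1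
  obtain ⟨A, hA⟩ := hψ.exists_linearMap hW hPW
  let θ' : Module.Dual ℝ (Fin n → ℝ) := A.comp (LinearMap.inl ℝ _ _)
  have hinl : ∀ i m, LinearMap.inl ℝ (Fin n → ℝ) (ℕ → Fin q → ℝ) (iteratedBracket f₀ f i m P).1 =
      iteratedBracket f₀ f i m P := fun i m =>
    Prod.ext rfl (iteratedBracket_snd h.isOpen_states i m (hWX hPW).1).symm
  have hθ' : ∀ i m, m ≤ l → θ' (iteratedBracket f₀ f i m P).1 =
      -lieDerivative (iteratedBracket f₀ f i (m + 1)) (pullTrunc φ) P := by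
    intro i m hm
    have h1 := lieDerivative_iteratedBracket_iterate h.isOpen_states h.smooth_drift
      h.smooth_fields hW hWX hφs hφ0 i 1 m (by omega) hPW
    rw [pow_one, neg_one_mul] at h1
    rw [← h1, LinearMap.comp_apply, hinl]
    exact (hA _).symm
  refine ⟨-θ', ?_, ?_⟩
  · refine Submodule.neg_mem _ ((Submodule.mem_dualAnnihilator _).2 fun v hv => ?_)
    have hle : levelSpan f₀ f l P ≤ LinearMap.ker θ' := by
      refine Submodule.span_le.2 ?_
      rintro _ ⟨⟨i, m⟩, hm, rfl⟩
      have hm' : m < l := hm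
      change θ' _ = 0
      rw [hθ' i m hm'.le, hφ0 P hPW i (m + 1) (by omega), neg_zero]
    exact hle hv
  · funext i
    change -θ' (iteratedBracket f₀ f i l P).1 = θ (iteratedBracket f₀ f i (l + 1) P).1
    rw [hθ' i l le_rfl, neg_neg, ← hφP]
    unfold lieDerivative
    rw [← hinl i (l + 1)]
    rfl

theorem IsRegularOn.finrank_levelDual (h : IsRegularOn X f₀ f D ρ p) (l : ℕ)
    {P : Jet n (Fin q)} (hP : P ∈ D) :
    Module.finrank ℝ (levelDual f₀ f l P) = dimJump ρ l := by
  have h1 := finrank_levelDual_add (f₀ := f₀) (f := f) l P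
  cases l with
  | zero =>
    rw [levelSpan_zero, finrank_bot, h.finrank_eq 0 P hP] at h1
    exact h1
  | succ l =>
    rw [h.finrank_eq l P hP, h.finrank_eq (l + 1) P hP] at h1
    change _ = ρ (l + 1) - ρ l
    omega

theorem IsRegularOn.antitone_dimJump (h : IsRegularOn X f₀ f D ρ p) : Antitone (dimJump ρ) := by
  obtain ⟨P, hP⟩ := h.nonempty
  refine antitone_nat_of_succ_le fun l => ?_
  rw [← h.finrank_levelDual l hP, ← h.finrank_levelDual (l + 1) hP]
  exact Submodule.finrank_mono (h.levelDual_succ_le l hP)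

theorem IsRegularOn.monotone_dim (h : IsRegularOn X f₀ f D ρ p) : Monotone ρ := by
  obtain ⟨P, hP⟩ := h.nonempty
  refine monotone_nat_of_le_succ fun l => ?_
  rw [← h.finrank_eq l P hP, ← h.finrank_eq (l + 1) P hP]
  exact Submodule.finrank_mono (levelSpan_mono (Nat.le_succ _) P)

theorem IsRegularOn.dim_eq (h : IsRegularOn X f₀ f D ρ p) {l : ℕ} (hl : p ≤ l) : ρ l = n := by
  obtain ⟨P, hP⟩ := h.nonempty
  have h1 : levelSpan f₀ f (l + 1) P = ⊤ :=
    top_le_iff.1 ((h.full P hP).symm.le.trans (levelSpan_mono (Nat.succ_le_succ hl) P))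
  rw [← h.finrank_eq l P hP, h1, finrank_top, Module.finrank_fin_fun]

theorem IsRegularOn.dimJump_eq_zero (h : IsRegularOn X f₀ f D ρ p) (j : ℕ) (hj : p < j) :
    dimJump ρ j = 0 := by
  obtain ⟨j, rfl⟩ : ∃ j', j = j' + 1 := ⟨j - 1, by omega⟩
  change ρ (j + 1) - ρ j = 0
  rw [h.dim_eq (l := j + 1) (by omega), h.dim_eq (l := j) (by omega), Nat.sub_self]

theorem IsRegularOn.dimJump_le (h : IsRegularOn X f₀ f D ρ p) (j : ℕ) : dimJump ρ j ≤ r :=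
  (h.antitone_dimJump (Nat.zero_le j)).trans h.base.le

theorem IsRegularOn.lt_index_iff (h : IsRegularOn X f₀ f D ρ p) (i j : ℕ) :
    j < brunovskyIndex ρ i ↔ i + 1 ≤ dimJump ρ j :=
  lt_brunovskyIndex_iff h.antitone_dimJump h.dimJump_eq_zero i j

theorem IsRegularOn.antitone_index (h : IsRegularOn X f₀ f D ρ p) :
    Antitone (brunovskyIndex ρ) := by
  intro i i' hii'
  by_contra hlt
  have h1 := (h.lt_index_iff i' (brunovskyIndex ρ i)).1 (not_le.1 hlt)
  exact lt_irrefl _ ((h.lt_index_iff i (brunovskyIndex ρ i)).2 (by omega))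

theorem IsRegularOn.index_le (h : IsRegularOn X f₀ f D ρ p) (i : ℕ) :
    brunovskyIndex ρ i ≤ p + 1 := by
  by_contra hlt
  have h1 := (h.lt_index_iff i (p + 1)).1 (not_le.1 hlt)
  rw [h.dimJump_eq_zero (p + 1) (Nat.lt_succ_self p)] at h1
  omega

theorem IsRegularOn.index_pos (h : IsRegularOn X f₀ f D ρ p) (i : Fin r) :
    0 < brunovskyIndex ρ i := by
  rw [h.lt_index_iff]
  change (i : ℕ) + 1 ≤ ρ 0
  rw [h.base]
  exact i.2

theorem IsRegularOn.sum_index (h : IsRegularOn X f₀ f D ρ p) :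
    ∑ i : Fin r, brunovskyIndex ρ i = n := by
  rw [sum_brunovskyIndex h.monotone_dim h.dimJump_eq_zero h.dimJump_le, h.dim_eq le_rfl]

/-- For a family of first integrals of the brackets of orders less than `kᵢ - 1`, invertibility of
the matrix of the derivatives `L_{ad^{kⱼ-1} fᵢ} φⱼ` is enough to have a Brunovský family. -/
theorem isBrunovskyFamily_of_det_ne_zero (hX : IsOpen X) (hf₀ : ContDiffOn ℝ ∞ f₀ X)
    (hf : ∀ i, ContDiffOn ℝ ∞ (f i) X) {W : Set (Jet n (Fin q))} (hW : IsOpen W)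
    (hWX : W ⊆ X ×ˢ Set.univ) {k : Fin r → ℕ}
    {φ : ∀ i : Fin r, TruncJet n (Fin q) (k i - 2) → ℝ}
    (hφ : ∀ i, ContDiffOn ℝ ∞ (φ i) (jetTrunc (k i - 2) '' W))
    (hint : ∀ i, ∀ Q ∈ W, ∀ b m, m < k i - 1 →
      lieDerivative (iteratedBracket f₀ f b m) (pullTrunc (φ i)) Q = 0)
    (hdet : ∀ Q ∈ W, (Matrix.of fun b i : Fin r =>
      lieDerivative (iteratedBracket f₀ f b (k i - 1)) (pullTrunc (φ i)) Q).det ≠ 0) :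
    IsBrunovskyFamily X f₀ f k W φ := by
  have hφs : ∀ i, JetSmoothMapOn (pullTrunc (φ i)) W := fun i =>
    ⟨k i - 2, φ i, hφ i, fun _ _ => rfl⟩
  have hF := (isSmoothField_extendedDrift (r := r) hf₀ hf).mono hWX
  have hφj : ∀ i j, JetSmoothMapOn
      ((lieDerivative (extendedDrift f₀ f))^[j] (pullTrunc (φ i))) W := fun i j =>
    (hφs i).iterate_lieDerivative hW hF j
  refine ⟨hφ, ?_, ?_, hdet⟩
  · intro i j l hjl γ hγ P hP
    refine lieDerivative_eq_zero_of_mem_Gamma hX hf₀ hf hW hWX (hφj i j) hP (fun b m hm => ?_) hγ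
    rw [lieDerivative_iteratedBracket_iterate hX hf₀ hf hW hWX (hφs i) (hint i) b j m
      (by omega) hP, hint i P hP b (m + j) (by omega), mul_zero]
  · intro P hP
    have hpair : ∀ (i : Fin r) (j : ℕ) (m : ℕ) (b : Fin r), m + j + 1 ≤ k i →
        (fun l => lineDeriv ℝ ((lieDerivative (extendedDrift f₀ f))^[j] (pullTrunc (φ i))) P
          (Pi.single l 1, 0)) ⬝ᵥ (iteratedBracket f₀ f b m P).1 =
        (-1) ^ j * lieDerivative (iteratedBracket f₀ f b (m + j)) (pullTrunc (φ i)) P := by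
      intro i j m b hmj
      rw [← (hφj i j).lineDeriv_state hW hP, ← lieDerivative_iteratedBracket_iterate hX hf₀ hf hW
        hWX (hφs i) (hint i) b j m (by omega) hP]
      unfold lieDerivative
      congr 1
      exact Prod.ext rfl (iteratedBracket_snd hX b m (hWX hP).1).symm
    refine linearIndependent_of_triangular
      (a := fun m b => (iteratedBracket f₀ f b m P).1) (hdet P hP) ?_ ?_
    · intro i j m b hmj
      rw [hpair i j m b hmj.le, hint i P hP b (m + j) (by omega), mul_zero]
    · intro i j m b hmj
      rw [hpair i j m b hmj.le, Matrix.of_apply]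
      rw [show m + (j : ℕ) = k i - 1 by omega]

theorem IsRegularOn.exists_brunovskyFamily (h : IsRegularOn X f₀ f D ρ p) {P : Jet n (Fin q)}
    (hP : P ∈ D) {k : Fin r → ℕ} (hk : ∀ i, k i = brunovskyIndex ρ i) :
    ∃ W ⊆ D, IsOpen W ∧ P ∈ W ∧ ∃ φ : ∀ i, TruncJet n (Fin q) (k i - 2) → ℝ,
      IsBrunovskyFamily X f₀ f k W φ := by
  have hkpos : ∀ i, 0 < k i := fun i => (hk i).symm ▸ h.index_pos i
  -- independent vectors in the dual spaces of the last levels on which the indices jump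
  obtain ⟨c, hcB, hc⟩ := exists_linearIndependent_mem (fun i => levelDual f₀ f (k i - 1) P)
    (fun i => by
      rw [h.finrank_levelDual _ hP, ← h.lt_index_iff, ← hk i]
      have := hkpos i
      omega)
  choose θ hθ hθc using hcB
  choose W hWD hW hPW φ hφ hφ0 hφP using fun i =>
    h.exists_firstIntegral (L := k i - 1) (N := k i - 2) (by omega) hP (hθ i)
  let W₀ : Set (Jet n (Fin q)) := D ∩ ⋂ i, W i
  have hW₀ : IsOpen W₀ := h.isOpen.inter (isOpen_iInter_of_finite hW)
  have hW₀W : ∀ i, W₀ ⊆ W i := fun i Q hQ => Set.mem_iInter.1 hQ.2 i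
  have hW₀X : W₀ ⊆ X ×ˢ Set.univ := Set.inter_subset_left.trans h.subset
  have hPW₀ : P ∈ W₀ := ⟨hP, Set.mem_iInter.2 hPW⟩
  have hφs : ∀ i, JetSmoothMapOn (pullTrunc (φ i)) W₀ := fun i =>
    ⟨k i - 2, φ i, (hφ i).mono (Set.image_mono (hW₀W i)), fun _ _ => rfl⟩
  let M : Jet n (Fin q) → Matrix (Fin r) (Fin r) ℝ := fun Q => Matrix.of fun b i : Fin r =>
    lieDerivative (iteratedBracket f₀ f b (k i - 1)) (pullTrunc (φ i)) Q
  have hM : ContinuousOn (fun Q => (M Q).det) W₀ := by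
    have h1 : ContinuousOn M W₀ := continuousOn_pi.2 fun b => continuousOn_pi.2 fun i =>
      ((hφs i).lieDerivative hW₀ ((isSmoothField_iteratedBracket h.isOpen_states h.smooth_drift
        h.smooth_fields b (k i - 1)).mono hW₀X)).continuousOn
    exact (Continuous.matrix_det continuous_id).comp_continuousOn h1
  have hMP : (M P).det ≠ 0 := by
    have h1 : M P = (Matrix.of c).transpose := by
      ext b i
      change lineDeriv ℝ (pullTrunc (φ i)) P (iteratedBracket f₀ f b (k i - 1) P) = c i b
      rw [← hθc i]
      change _ = θ i (iteratedBracket f₀ f b (k i - 1) P).1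
      rw [← hφP i]
      congr 1
      exact Prod.ext rfl (iteratedBracket_snd h.isOpen_states b _ (h.subset hP).1)
    rw [h1, Matrix.det_transpose]
    have h2 : IsUnit (Matrix.of c) := Matrix.linearIndependent_rows_iff_isUnit.1 hc
    exact ((Matrix.isUnit_iff_isUnit_det _).1 h2).ne_zero
  have hW₁ : IsOpen (W₀ ∩ (fun Q => (M Q).det) ⁻¹' {0}ᶜ) :=
    hM.isOpen_inter_preimage hW₀ isOpen_compl_singleton
  refine ⟨W₀ ∩ (fun Q => (M Q).det) ⁻¹' {0}ᶜ, fun Q hQ => hQ.1.1, hW₁, ⟨hPW₀, hMP⟩, φ, ?_⟩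
  exact isBrunovskyFamily_of_det_ne_zero h.isOpen_states h.smooth_drift h.smooth_fields hW₁
    (Set.inter_subset_left.trans hW₀X)
    (fun i => (hφ i).mono (Set.image_mono (Set.inter_subset_left.trans (hW₀W i))))
    (fun i Q hQ => hφ0 i Q (hW₀W i hQ.1)) (fun Q hQ => hQ.2)

end Existence

/-! ### Brunovský families along the system -/

section AlongSystem

variable {n r q : ℕ} {X : Set (Fin n → ℝ)} {f₀ : (Fin n → ℝ) → Fin n → ℝ}
  {f : Fin r ⊕ Fin q → (Fin n → ℝ) → Fin n → ℝ} {k : Fin r → ℕ} {W : Set (Jet n (Fin q))}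
  {φ : ∀ i : Fin r, TruncJet n (Fin q) (k i - 2) → ℝ}

theorem continuous_projB : Continuous (projB : Jet n (Fin r ⊕ Fin q) → Jet n (Fin q)) := by
  unfold projB; fun_prop

theorem isSmoothField_projB (U : Set (Jet n (Fin r ⊕ Fin q))) :
    IsSmoothField (projB : Jet n (Fin r ⊕ Fin q) → Jet n (Fin q)) U :=
  ⟨fun i => jetSmoothMapOn_state i U, fun k j => ⟨k + 1, factorsOn_input k (Sum.inr j) U⟩⟩

/-- The function `φ_{i,j} = L_{F₀ᵇ}^j φ_i`. -/
noncomputable def driftDerivative (f₀ : (Fin n → ℝ) → Fin n → ℝ)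
    (f : Fin r ⊕ Fin q → (Fin n → ℝ) → Fin n → ℝ)
    (φ : ∀ i : Fin r, TruncJet n (Fin q) (k i - 2) → ℝ) (i : Fin r) (j : ℕ) :
    Jet n (Fin q) → ℝ :=
  (lieDerivative (extendedDrift f₀ f))^[j] (pullTrunc (φ i))

/-- The decoupling matrix, with entries `L_{f_b} φ_{i,kᵢ-1}`. -/
noncomputable def decouplingMatrix (f₀ : (Fin n → ℝ) → Fin n → ℝ)
    (f : Fin r ⊕ Fin q → (Fin n → ℝ) → Fin n → ℝ)
    (φ : ∀ i : Fin r, TruncJet n (Fin q) (k i - 2) → ℝ) (P : Jet n (Fin q)) :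
    Matrix (Fin r) (Fin r) ℝ :=
  Matrix.of fun i b =>
    lieDerivative (liftField (f (Sum.inl b))) (driftDerivative f₀ f φ i (k i - 1)) P

/-- The derivative along the whole system of a function of `(x, u_b, u_b', ...)`. -/
theorem lieDerivative_cartanField_comp_projB {h : Jet n (Fin q) → ℝ} (hW : IsOpen W)
    (hh : JetSmoothMapOn h W) {P : Jet n (Fin r ⊕ Fin q)} (hP : projB P ∈ W) :
    lieDerivative (cartanField (affineSystem f₀ f)) (fun R => h (projB R)) P =
      lieDerivative (extendedDrift f₀ f) h (projB P) +
        ∑ b, P.2 0 (Sum.inl b) * lieDerivative (liftField (f (Sum.inl b))) h (projB P) := by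
  obtain ⟨A, hA⟩ := hh.exists_linearMap hW hP
  have h1 : projB (cartanField (affineSystem f₀ f) P) = extendedDrift f₀ f (projB P) +
      ∑ b, P.2 0 (Sum.inl b) • liftField (f (Sum.inl b)) (projB P) := by
    refine Prod.ext ?_ ?_
    · rw [Prod.fst_add, Prod.fst_sum]
      simp only [projB, cartanField, affineSystem, extendedDrift, liftField, Fintype.sum_sum_type,
        Prod.smul_fst]
      abel
    · rw [Prod.snd_add, Prod.snd_sum]
      simp only [projB, cartanField, extendedDrift, liftField, Prod.smul_snd, smul_zero,
        Finset.sum_const_zero, add_zero]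
  change lineDeriv ℝ h (projB P) (projB (cartanField (affineSystem f₀ f) P)) = _
  unfold lieDerivative
  rw [h1, hA, map_add, map_sum]
  simp only [map_smul, smul_eq_mul, hA]

namespace IsBrunovskyFamily

theorem jetSmooth (hφ : IsBrunovskyFamily X f₀ f k W φ) (hf₀ : ContDiffOn ℝ ∞ f₀ X)
    (hf : ∀ i, ContDiffOn ℝ ∞ (f i) X) (hW : IsOpen W) (hWX : W ⊆ X ×ˢ Set.univ) (i : Fin r)
    (j : ℕ) : JetSmoothMapOn (driftDerivative f₀ f φ i j) W :=
  JetSmoothMapOn.iterate_lieDerivative hW ⟨k i - 2, φ i, hφ.smooth i, fun _ _ => rfl⟩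
    ((isSmoothField_extendedDrift hf₀ hf).mono hWX) j

theorem det_decouplingMatrix (hφ : IsBrunovskyFamily X f₀ f k W φ) (hX : IsOpen X)
    (hf₀ : ContDiffOn ℝ ∞ f₀ X) (hf : ∀ i, ContDiffOn ℝ ∞ (f i) X) (hW : IsOpen W)
    (hWX : W ⊆ X ×ˢ Set.univ) {P : Jet n (Fin q)} (hP : P ∈ W) :
    (decouplingMatrix f₀ f φ P).det ≠ 0 := by
  have h1 : (decouplingMatrix f₀ f φ P).transpose = Matrix.of fun b i =>
      (-1) ^ (k i - 1) * (Matrix.of fun i j : Fin r => lieDerivative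
        ((jetBracket (extendedDrift f₀ f))^[k j - 1] (liftField (f (Sum.inl i))))
          (pullTrunc (φ j)) P) b i := by
    ext b i
    have := lieDerivative_iteratedBracket_iterate hX hf₀ hf hW hWX (L := k i - 1)
      (hφ.jetSmooth hf₀ hf hW hWX i 0) (fun Q hQ b m hm => hφ.firstIntegral i 0 m (by omega) _
        (iteratedBracket_mem_Gamma b le_rfl) Q hQ) b (k i - 1) 0 (by omega) hP
    rw [Nat.zero_add] at this
    exact this
  rw [← Matrix.det_transpose, h1, Matrix.det_mul_row]
  exact mul_ne_zero (Finset.prod_ne_zero_iff.2 fun i _ => pow_ne_zero _ (by norm_num))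
    (hφ.invertible P hP)

/-- The derivatives of `zᵢ` of order less than `kᵢ` do not depend on the inputs `u_a`. -/
theorem iterate_lieDerivative_eq (hφ : IsBrunovskyFamily X f₀ f k W φ)
    (hf₀ : ContDiffOn ℝ ∞ f₀ X) (hf : ∀ i, ContDiffOn ℝ ∞ (f i) X) (hW : IsOpen W)
    (hWX : W ⊆ X ×ˢ Set.univ) (i : Fin r) {j : ℕ} (hj : j < k i) {P : Jet n (Fin r ⊕ Fin q)}
    (hP : projB P ∈ W) :
    (lieDerivative (cartanField (affineSystem f₀ f)))^[j]
      (fun R => pullTrunc (φ i) (projB R)) P = driftDerivative f₀ f φ i j (projB P) := by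
  induction j generalizing P with
  | zero => rfl
  | succ j ih =>
    rw [Function.iterate_succ_apply', lieDerivative_congr
      (C' := cartanField (affineSystem f₀ f)) (hW.preimage continuous_projB)
      (fun Q hQ => ih (by omega) hQ) hP rfl, lieDerivative_cartanField_comp_projB hW
      (hφ.jetSmooth hf₀ hf hW hWX i j) hP]
    have h0 : ∀ b, lieDerivative (liftField (f (Sum.inl b))) (driftDerivative f₀ f φ i j)
        (projB P) = 0 := fun b =>
      hφ.firstIntegral i j 0 (by omega) _ (iteratedBracket_mem_Gamma (m := 0) b le_rfl) _ hP
    simp only [h0, mul_zero, Finset.sum_const_zero, add_zero]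
    rw [driftDerivative, driftDerivative, Function.iterate_succ_apply']

/-- The derivative of `zᵢ` of order `kᵢ` is affine in `u_a`, with the decoupling matrix as its
linear part. -/
theorem iterate_lieDerivative_index_eq (hφ : IsBrunovskyFamily X f₀ f k W φ)
    (hf₀ : ContDiffOn ℝ ∞ f₀ X) (hf : ∀ i, ContDiffOn ℝ ∞ (f i) X) (hW : IsOpen W)
    (hWX : W ⊆ X ×ˢ Set.univ) (hk : ∀ i, 0 < k i) (i : Fin r) {P : Jet n (Fin r ⊕ Fin q)}
    (hP : projB P ∈ W) :
    (lieDerivative (cartanField (affineSystem f₀ f)))^[k i]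
      (fun R => pullTrunc (φ i) (projB R)) P = driftDerivative f₀ f φ i (k i) (projB P) +
        (decouplingMatrix f₀ f φ (projB P)).mulVec (fun b => P.2 0 (Sum.inl b)) i := by
  have key : ∀ m j, m = j + 1 → m ≤ k i → (lieDerivative (cartanField (affineSystem f₀ f)))^[m]
      (fun R => pullTrunc (φ i) (projB R)) P = driftDerivative f₀ f φ i m (projB P) +
        ∑ b, P.2 0 (Sum.inl b) * lieDerivative (liftField (f (Sum.inl b)))
          (driftDerivative f₀ f φ i j) (projB P) := by
    rintro _ j rfl hj
    rw [Function.iterate_succ_apply', lieDerivative_congr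
      (C' := cartanField (affineSystem f₀ f)) (hW.preimage continuous_projB)
      (fun Q hQ => hφ.iterate_lieDerivative_eq hf₀ hf hW hWX i (j := j) (by omega) hQ) hP rfl,
      lieDerivative_cartanField_comp_projB hW (hφ.jetSmooth hf₀ hf hW hWX i j) hP]
    rw [driftDerivative, driftDerivative, Function.iterate_succ_apply']
  have hki := hk i
  rw [key (k i) (k i - 1) (by omega) le_rfl]
  congr 1
  exact Finset.sum_congr rfl fun b _ => mul_comm _ _

end IsBrunovskyFamily

theorem eq_zero_of_forall_dotProduct {α : Type*} [Fintype α] {w : α → Fin n → ℝ}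
    (hw : LinearIndependent ℝ w) (hcard : Fintype.card α = n) {v : Fin n → ℝ}
    (hv : ∀ s, w s ⬝ᵥ v = 0) : v = 0 := by
  have h1 : Submodule.span ℝ (Set.range w) = ⊤ :=
    hw.span_eq_top_of_card_eq_finrank' (by rw [hcard, Module.finrank_fin_fun])
  have h2 : ∀ u ∈ Submodule.span ℝ (Set.range w), u ⬝ᵥ v = 0 := by
    intro u hu
    induction hu using Submodule.span_induction with
    | mem x hx => obtain ⟨s, rfl⟩ := hx; exact hv s
    | zero => exact zero_dotProduct v
    | add x y _ _ hx hy => rw [add_dotProduct, hx, hy, add_zero]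
    | smul a x _ hx => rw [smul_dotProduct, hx, smul_zero]
  exact dotProduct_self_eq_zero.1 (h2 v (h1 ▸ Submodule.mem_top))

/-- For independent functions `φ_{i,j}` of `x`, as many as there are states, the map
`(x, u_b, ...) ↦ (φ_{i,j}, u_b, ...)` is a local diffeomorphism of truncated jets. -/
theorem exists_stateInverse {α : Type} [Fintype α] (hcard : Fintype.card α = n) (hW : IsOpen W)
    {h : α → Jet n (Fin q) → ℝ} (hh : ∀ s, JetSmoothMapOn (h s) W) {P₀ : Jet n (Fin q)}
    (hP₀ : P₀ ∈ W) (hind : LinearIndependent ℝ fun (s : α) (l : Fin n) =>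
      lineDeriv ℝ (h s) P₀ (Pi.single l 1, 0)) :
    ∃ (N : ℕ) (ε : OpenPartialHomeomorph (TruncJet n (Fin q) N)
        ((α → ℝ) × (Fin N → Fin q → ℝ))), jetTrunc N P₀ ∈ ε.source ∧
      (∀ P ∈ W, ε (jetTrunc N P) = (fun s => h s P, fun j : Fin N => P.2 j)) ∧
      (∀ p, (ε p).2 = p.2) ∧ ContDiffOn ℝ ∞ ε.symm ε.target := by
  choose N' hN' using hh
  let N := Finset.univ.sup N'
  have hN : ∀ s, FactorsOn N (h s) W := fun s =>
    (hN' s).of_le (Finset.le_sup (Finset.mem_univ s))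
  choose H hH hHeq using hN
  have ho : IsOpen (jetTrunc N '' W) := isOpen_image_jetTrunc hW
  let G : TruncJet n (Fin q) N → (α → ℝ) × (Fin N → Fin q → ℝ) := fun p => (fun s => H s p, p.2)
  have hG : ContDiffOn ℝ ∞ G (jetTrunc N '' W) :=
    (contDiffOn_pi.2 hH).prodMk contDiff_snd.contDiffOn
  have hp₀ : jetTrunc N P₀ ∈ jetTrunc N '' W := ⟨P₀, hP₀, rfl⟩
  let p₀ := jetTrunc N P₀
  have hd : ∀ s, HasFDerivAt (H s) (fderiv ℝ (H s) p₀) p₀ := fun s =>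
    (((hH s).contDiffAt (ho.mem_nhds hp₀)).differentiableAt (by simp)).hasFDerivAt
  let G' : TruncJet n (Fin q) N →L[ℝ] (α → ℝ) × (Fin N → Fin q → ℝ) :=
    (ContinuousLinearMap.pi fun s => fderiv ℝ (H s) p₀).prod (ContinuousLinearMap.snd ℝ _ _)
  have hGd : HasFDerivAt G G' p₀ := (hasFDerivAt_pi.2 hd).prodMk hasFDerivAt_snd
  have hinj : Function.Injective
      (G' : TruncJet n (Fin q) N →ₗ[ℝ] (α → ℝ) × (Fin N → Fin q → ℝ)) := by
    rw [injective_iff_map_eq_zero]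
    rintro ⟨v, w⟩ hvw
    have hw : w = 0 := congrArg Prod.snd hvw
    subst hw
    have h1 : ∀ s, fderiv ℝ (H s) p₀ (v, 0) = 0 := fun s => congrFun (congrArg Prod.fst hvw) s
    have h2 : v = 0 := eq_zero_of_forall_dotProduct hind hcard fun s => by
      rw [← JetSmoothMapOn.lineDeriv_state hW ⟨N, H s, hH s, hHeq s⟩ hP₀,
        lineDeriv_eq_fderiv hW (hH s) (hHeq s) hP₀]
      exact h1 s
    rw [h2]; rfl
  have hfin : Module.finrank ℝ (TruncJet n (Fin q) N) =
      Module.finrank ℝ ((α → ℝ) × (Fin N → Fin q → ℝ)) := by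
    rw [Module.finrank_prod, Module.finrank_prod, Module.finrank_fintype_fun_eq_card,
      Module.finrank_fintype_fun_eq_card, hcard, Fintype.card_fin]
  let L := (LinearEquiv.ofInjectiveOfFinrankEq _ hinj hfin).toContinuousLinearEquiv
  have hL : (L : TruncJet n (Fin q) N →L[ℝ] _) = G' := ContinuousLinearMap.ext fun v => rfl
  obtain ⟨ε, hε, -, hεG, hεs⟩ := exists_smooth_local_inverse ho hG hp₀ L (hL ▸ hGd)
  refine ⟨N, ε, hε, fun P hP => ?_, fun p => ?_, hεs⟩
  · rw [hεG]
    exact Prod.ext (funext fun s => (hHeq s P hP).symm) rfl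
  · rw [hεG]

theorem contDiff_det {E : Type*} [NormedAddCommGroup E] [NormedSpace ℝ E]
    {M : E → Matrix (Fin r) (Fin r) ℝ} (hM : ∀ i j, ContDiff ℝ ∞ fun x => M x i j) :
    ContDiff ℝ ∞ fun x => (M x).det := by
  simp only [Matrix.det_apply]
  exact ContDiff.sum fun σ _ => ContDiff.const_smul _ (contDiff_prod fun i _ => hM _ _)

/-- Cramer's rule: the solution `u` of `M u = y` is a smooth function of `M` and `y`. -/
theorem exists_smooth_solve (r : ℕ) :
    ∃ K : (Fin r → Fin r → ℝ) × (Fin r → ℝ) → Fin r → ℝ,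
      ContDiffOn ℝ ∞ K {x | (Matrix.of x.1).det ≠ 0} ∧
      ∀ x u, (Matrix.of x.1).det ≠ 0 → ((Matrix.of x.1).mulVec u = x.2 ↔ u = K x) := by
  refine ⟨fun x => (Matrix.of x.1).det⁻¹ • (Matrix.of x.1).cramer x.2, ?_, ?_⟩
  · refine contDiffOn_pi.2 fun i => ?_
    have h1 : ContDiff ℝ ∞ fun x : (Fin r → Fin r → ℝ) × (Fin r → ℝ) => (Matrix.of x.1).det :=
      contDiff_det fun i j => by simp only [Matrix.of_apply]; fun_prop
    have h2 : ContDiff ℝ ∞ fun x : (Fin r → Fin r → ℝ) × (Fin r → ℝ) =>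
        (Matrix.of x.1).cramer x.2 i := by
      simp only [Matrix.cramer_apply]
      refine contDiff_det fun a b => ?_
      by_cases hb : b = i
      · subst hb
        simp only [Matrix.updateCol_self]
        fun_prop
      · simp only [Matrix.updateCol_ne hb, Matrix.of_apply]
        fun_prop
    exact (h1.contDiffOn.inv fun x hx => hx).mul h2.contDiffOn
  · intro x u hx
    have h1 : (Matrix.of x.1).mulVec
        ((Matrix.of x.1).det⁻¹ • (Matrix.of x.1).cramer x.2) = x.2 := by
      rw [Matrix.mulVec_smul, Matrix.mulVec_cramer, smul_smul, inv_mul_cancel₀ hx, one_smul]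
    constructor
    · intro hu
      refine sub_eq_zero.1 (Matrix.eq_zero_of_mulVec_eq_zero hx ?_)
      rw [Matrix.mulVec_sub, hu, h1, sub_self]
    · rintro rfl
      exact h1

end AlongSystem

/-! ### Lie-Bäcklund charts from Brunovský families -/

section Flatness

theorem isSmoothField_trivialSystem {ι : Type} [Fintype ι] (U : Set (Jet 0 ι)) :
    IsSmoothField (cartanField (trivialSystem ι)) U :=
  ⟨fun i => i.elim0, fun k j => ⟨k + 2, factorsOn_input (k + 1) j U⟩⟩

theorem lineDeriv_input {n : ℕ} {ι : Type} (k : ℕ) (j : ι) (P v : Jet n ι) :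
    lineDeriv ℝ (fun R : Jet n ι => R.2 k j) P v = v.2 k j := by
  have h1 : HasDerivAt (fun t : ℝ => P.2 k j + t * v.2 k j) (v.2 k j) 0 := by
    simpa using ((hasDerivAt_id (0 : ℝ)).mul_const (v.2 k j)).const_add (P.2 k j)
  exact h1.deriv

variable {n r q : ℕ} {X : Set (Fin n → ℝ)} {f₀ : (Fin n → ℝ) → Fin n → ℝ}
  {f : Fin r ⊕ Fin q → (Fin n → ℝ) → Fin n → ℝ} {k : Fin r → ℕ} {W : Set (Jet n (Fin q))}
  {φ : ∀ i : Fin r, TruncJet n (Fin q) (k i - 2) → ℝ}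

/-- The output given by a Brunovský family and the inputs `u_b` is flat. The state is recovered
from `zᵢ, ..., zᵢ^(kᵢ-1)` and `u_b, u_b', ...`, the inputs `u_a` from `zᵢ^(kᵢ)` by inverting the
decoupling matrix, and the derivatives of `u_a` by differentiation along the trivial system. -/
theorem IsBrunovskyFamily.isFlatOutputAt (hφ : IsBrunovskyFamily X f₀ f k W φ) (hX : IsOpen X)
    (hf₀ : ContDiffOn ℝ ∞ f₀ X) (hf : ∀ i, ContDiffOn ℝ ∞ (f i) X) (hW : IsOpen W)
    (hWX : W ⊆ X ×ˢ Set.univ) (hk : ∀ i, 0 < k i) (hsum : ∑ i, k i = n)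
    {P₀ : Jet n (Fin r ⊕ Fin q)} (hP₀ : projB P₀ ∈ W) :
    IsFlatOutputAt X (affineSystem f₀ f) (brunovskyOutput φ) P₀ := by
  let C : JetField n (Fin r ⊕ Fin q) := cartanField (affineSystem f₀ f)
  let C₀ : JetField 0 (Fin r ⊕ Fin q) := cartanField (trivialSystem (Fin r ⊕ Fin q))
  have hds := hφ.jetSmooth hf₀ hf hW hWX
  obtain ⟨N, ε, hε0, hεW, hε2, hεs⟩ := exists_stateInverse
    (α := Σ i : Fin r, Fin (k i)) (by simp [hsum]) hW
    (h := fun s => driftDerivative f₀ f φ s.1 s.2) (fun s => hds s.1 s.2) hP₀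
    (hφ.independent _ hP₀)
  -- the state and the jet `(x, u_b, u_b', ...)`, in terms of the jet of the output
  let σ : Jet 0 (Fin r ⊕ Fin q) → ((Σ i : Fin r, Fin (k i)) → ℝ) × (Fin N → Fin q → ℝ) :=
    fun Q => (fun s => Q.2 s.2 (Sum.inl s.1), fun (j : Fin N) c => Q.2 j (Sum.inr c))
  have hσ : ∀ U, JetSmoothMapOn σ U := fun U =>
    (JetSmoothMapOn.pi fun s : Σ i : Fin r, Fin (k i) =>
      ⟨_, factorsOn_input s.2 (Sum.inl s.1) U⟩).prodMk
      (JetSmoothMapOn.pi fun j : Fin N => JetSmoothMapOn.pi fun c =>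
        ⟨_, factorsOn_input j (Sum.inr c) U⟩)
  have hσc : Continuous σ := by fun_prop
  let χ : Jet 0 (Fin r ⊕ Fin q) → Fin n → ℝ := fun Q => (ε.symm (σ Q)).1
  let π : Jet 0 (Fin r ⊕ Fin q) → Jet n (Fin q) := fun Q => (χ Q, fun j c => Q.2 j (Sum.inr c))
  let T : Set (Jet 0 (Fin r ⊕ Fin q)) := σ ⁻¹' ε.target
  have hT : IsOpen T := ε.open_target.preimage hσc
  have hχT : ∀ l, JetSmoothMapOn (fun Q => χ Q l) T := fun l =>
    (hσ T).comp (K := fun y => (ε.symm y).1 l)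
      (((contDiff_apply ℝ ℝ l).comp contDiff_fst).comp_contDiffOn hεs) fun Q hQ => hQ
  have hπT : IsSmoothField π T := ⟨hχT, fun j c => ⟨_, factorsOn_input j (Sum.inr c) T⟩⟩
  have hπc : ContinuousOn π T := by
    refine ContinuousOn.prodMk ?_ ?_
    · exact continuous_fst.comp_continuousOn (ε.continuousOn_symm.comp hσc.continuousOn
        fun Q hQ => hQ)
    · exact Continuous.continuousOn (by fun_prop)
  let U' : Set (Jet 0 (Fin r ⊕ Fin q)) := T ∩ π ⁻¹' W
  have hU' : IsOpen U' := hπc.isOpen_inter_preimage hT hW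
  have hU'T : U' ⊆ T := Set.inter_subset_left
  have hπU' : IsSmoothField π U' := hπT.mono hU'T
  have htrπ : ∀ Q ∈ T, jetTrunc N (π Q) = ε.symm (σ Q) := by
    intro Q hQ
    refine Prod.ext rfl ?_
    rw [← hε2 (ε.symm (σ Q)), ε.right_inv hQ]
    rfl
  have hhπ : ∀ Q ∈ U', ∀ i j, j < k i →
      driftDerivative f₀ f φ i j (π Q) = Q.2 j (Sum.inl i) := by
    intro Q hQ i j hj
    have h1 := hεW (π Q) hQ.2
    rw [htrπ Q hQ.1, ε.right_inv hQ.1] at h1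
    exact (congrFun (congrArg Prod.fst h1) ⟨i, ⟨j, hj⟩⟩).symm
  -- the direct map
  let z : Fin r → ℕ → Jet n (Fin r ⊕ Fin q) → ℝ := fun i j =>
    (lieDerivative C)^[j] (fun R => pullTrunc (φ i) (projB R))
  have hWo : IsOpen (projB ⁻¹' W : Set (Jet n (Fin r ⊕ Fin q))) := hW.preimage continuous_projB
  have hWoX : (projB ⁻¹' W : Set (Jet n (Fin r ⊕ Fin q))) ⊆ X ×ˢ Set.univ :=
    fun P hP => ⟨(hWX hP).1, Set.mem_univ _⟩
  have hz : ∀ i j, JetSmoothMapOn (z i j) (projB ⁻¹' W) := fun i j =>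
    JetSmoothMapOn.iterate_lieDerivative hWo
      ((hds i 0).comp_field (isSmoothField_projB _) fun P hP => hP)
      ((isSmoothField_cartanField hf₀ hf).mono hWoX) j
  have hzlt : ∀ P, projB P ∈ W → ∀ i j, j < k i →
      z i j P = driftDerivative f₀ f φ i j (projB P) := fun P hP i j hj =>
    hφ.iterate_lieDerivative_eq hf₀ hf hW hWX i hj hP
  have hztop : ∀ P, projB P ∈ W → ∀ i, z i (k i) P = driftDerivative f₀ f φ i (k i) (projB P) +
      (decouplingMatrix f₀ f φ (projB P)).mulVec (fun b => P.2 0 (Sum.inl b)) i := fun P hP i =>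
    hφ.iterate_lieDerivative_index_eq hf₀ hf hW hWX hk i hP
  let Ψ : Jet n (Fin r ⊕ Fin q) → Jet 0 (Fin r ⊕ Fin q) := fun P =>
    (0, fun j => Sum.elim (fun i => z i j P) fun c => P.2 j (Sum.inr c))
  let U : Set (Jet n (Fin r ⊕ Fin q)) :=
    projB ⁻¹' W ∩ (fun P => jetTrunc N (projB P)) ⁻¹' ε.source
  have hU : IsOpen U :=
    hWo.inter (ε.open_source.preimage (continuous_jetTrunc.comp continuous_projB))
  have hUW : U ⊆ projB ⁻¹' W := Set.inter_subset_left
  have hUX : U ⊆ X ×ˢ Set.univ := hUW.trans hWoX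
  have hσΨ : ∀ P, projB P ∈ W → σ (Ψ P) = ε (jetTrunc N (projB P)) := by
    intro P hP
    rw [hεW _ hP]
    exact Prod.ext (funext fun s => hzlt P hP s.1 s.2 s.2.2) rfl
  have hπΨ : ∀ P ∈ U, π (Ψ P) = projB P := by
    intro P hP
    refine Prod.ext ?_ rfl
    change (ε.symm (σ (Ψ P))).1 = _
    rw [hσΨ P hP.1, ε.left_inv hP.2]
    rfl
  have hΨU : ∀ P ∈ U, Ψ P ∈ U' := by
    intro P hP
    refine ⟨?_, ?_⟩
    · change σ (Ψ P) ∈ ε.target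
      rw [hσΨ P hP.1]
      exact ε.map_source hP.2
    · change π (Ψ P) ∈ W
      rw [hπΨ P hP]
      exact hP.1
  have hΨs : IsSmoothField Ψ U := by
    refine ⟨fun i => i.elim0, fun j s => ?_⟩
    rcases s with i | c
    · exact (hz i j).mono hUW
    · exact ⟨_, factorsOn_input j (Sum.inr c) U⟩
  have hΨr : ∀ P ∈ U, ∀ j s, lieDerivative C (fun R => (Ψ R).2 j s) P = (C₀ (Ψ P)).2 j s := by
    intro P hP j s
    rcases s with i | c
    · change lieDerivative C (z i j) P = z i (j + 1) P
      simp only [z]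
      rw [Function.iterate_succ_apply']
    · exact lineDeriv_input j (Sum.inr c) P (C P)
  -- the inverse map
  obtain ⟨K, hKs, hK⟩ := exists_smooth_solve r
  let m : Jet 0 (Fin r ⊕ Fin q) → (Fin r → Fin r → ℝ) × (Fin r → ℝ) := fun Q =>
    (fun i b => decouplingMatrix f₀ f φ (π Q) i b,
      fun i => Q.2 (k i) (Sum.inl i) - driftDerivative f₀ f φ i (k i) (π Q))
  let μ : Fin r → Jet 0 (Fin r ⊕ Fin q) → ℝ := fun b Q => K (m Q) b
  have hmdet : ∀ Q ∈ U', (Matrix.of (m Q).1).det ≠ 0 := fun Q hQ =>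
    hφ.det_decouplingMatrix hX hf₀ hf hW hWX hQ.2
  have hms : JetSmoothMapOn m U' := by
    refine (JetSmoothMapOn.pi fun i => JetSmoothMapOn.pi fun b => ?_).prodMk
      (JetSmoothMapOn.pi fun i => ?_)
    · exact JetSmoothMapOn.comp_field ((hds i (k i - 1)).lieDerivative hW
        ((isSmoothField_iteratedBracket hX hf₀ hf b 0).mono hWX)) hπU' fun Q hQ => hQ.2
    · have h1 : JetSmoothMapOn (fun Q : Jet 0 (Fin r ⊕ Fin q) => Q.2 (k i) (Sum.inl i)) U' :=
        ⟨_, factorsOn_input (k i) (Sum.inl i) U'⟩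
      exact h1.sub ((hds i (k i)).comp_field hπU' fun Q hQ => hQ.2)
  have hμs : ∀ b, JetSmoothMapOn (μ b) U' := fun b =>
    hms.comp (K := fun x => K x b) ((contDiff_apply ℝ ℝ b).comp_contDiffOn hKs) hmdet
  have hμjs : ∀ b j, JetSmoothMapOn ((lieDerivative C₀)^[j] (μ b)) U' := fun b j =>
    (hμs b).iterate_lieDerivative hU' (isSmoothField_trivialSystem U') j
  let Φ : Jet 0 (Fin r ⊕ Fin q) → Jet n (Fin r ⊕ Fin q) := fun Q =>
    (χ Q, fun j => Sum.elim (fun b => (lieDerivative C₀)^[j] (μ b) Q) fun c => Q.2 j (Sum.inr c))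
  have hprojΦ : ∀ Q, projB (Φ Q) = π Q := fun Q => rfl
  have hΦU' : ∀ Q ∈ U', Φ Q ∈ U := by
    intro Q hQ
    refine ⟨hQ.2, ?_⟩
    change jetTrunc N (π Q) ∈ ε.source
    rw [htrπ Q hQ.1]
    exact ε.map_target hQ.1
  have hΦs : IsSmoothField Φ U' := by
    refine ⟨fun l => (hχT l).mono hU'T, fun j s => ?_⟩
    rcases s with b | c
    · exact hμjs b j
    · exact ⟨_, factorsOn_input j (Sum.inr c) U'⟩
  have hΦri : ∀ Q, ∀ j s, lieDerivative C₀ (fun R => (Φ R).2 j s) Q = (C (Φ Q)).2 j s := by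
    intro Q j s
    rcases s with b | c
    · change lieDerivative C₀ ((lieDerivative C₀)^[j] (μ b)) Q =
        (lieDerivative C₀)^[j + 1] (μ b) Q
      rw [Function.iterate_succ_apply']
    · exact lineDeriv_input j (Sum.inr c) Q (C₀ Q)
  have hzΦ : ∀ Q ∈ U', ∀ i j, j ≤ k i → z i j (Φ Q) = Q.2 j (Sum.inl i) := by
    intro Q hQ i j hj
    rcases hj.lt_or_eq with hlt | rfl
    · rw [hzlt (Φ Q) hQ.2 i j hlt]
      exact hhπ Q hQ i j hlt
    · rw [hztop (Φ Q) hQ.2 i]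
      have h1 := congrFun ((hK (m Q) (K (m Q)) (hmdet Q hQ)).2 rfl) i
      have h2 : (decouplingMatrix f₀ f φ (projB (Φ Q))).mulVec
          (fun b => (Φ Q).2 0 (Sum.inl b)) i =
          Q.2 (k i) (Sum.inl i) - driftDerivative f₀ f φ i (k i) (π Q) := h1
      rw [h2, hprojΦ, add_sub_cancel]
  -- both derivatives of the state agree, since they give the same derivatives of the `φ_{i,j}`
  have hΦrs : ∀ Q ∈ U', ∀ l, lieDerivative C₀ (fun R => (Φ R).1 l) Q = (C (Φ Q)).1 l := by
    intro Q hQ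
    let v : Fin n → ℝ := fun l => lieDerivative C₀ (fun R => χ R l) Q
    let w : Fin n → ℝ := (C (Φ Q)).1
    suffices hvw : v - w = 0 by
      intro l
      exact congrFun (sub_eq_zero.1 hvw) l
    refine eq_zero_of_forall_dotProduct (hφ.independent _ hQ.2) (by simp [hsum]) ?_
    rintro ⟨i, j⟩
    have h1 : lineDeriv ℝ (fun R => driftDerivative f₀ f φ i j (π R)) Q (C₀ Q) =
        lineDeriv ℝ (driftDerivative f₀ f φ i j) (π Q)
          (v, fun j c => Q.2 (j + 1) (Sum.inr c)) :=
      lineDeriv_comp_field hW (hds i j) hU' hπU' (fun R hR => hR.2) hQ (fun l => rfl)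
        fun j c => lineDeriv_input j (Sum.inr c) Q (C₀ Q)
    have h2 : lineDeriv ℝ (fun R => driftDerivative f₀ f φ i j (π R)) Q (C₀ Q) =
        Q.2 (j + 1) (Sum.inl i) := by
      rw [lineDeriv_congr_of_isOpen hU' (fun R hR => hhπ R hR i j j.2) hQ]
      exact lineDeriv_input (j : ℕ) (Sum.inl i) Q (C₀ Q)
    have h3 : lineDeriv ℝ (driftDerivative f₀ f φ i j) (π Q)
        (w, fun j c => Q.2 (j + 1) (Sum.inr c)) = Q.2 (j + 1) (Sum.inl i) := by
      rw [← hzΦ Q hQ i (j + 1) j.2]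
      simp only [z]
      rw [Function.iterate_succ_apply']
      exact (lieDerivative_congr (C' := C) (P := Φ Q) hWo (fun R hR => hzlt R hR i j j.2) hQ.2
        rfl).symm
    obtain ⟨A, hA⟩ := (hds i j).exists_linearMap hW hQ.2
    have h4 := (hds i j).lineDeriv_state hW hQ.2 (v - w)
    refine h4.symm.trans ?_
    have h5 : ((v - w, 0) : Jet n (Fin q)) = (v, fun j c => Q.2 (j + 1) (Sum.inr c)) -
        (w, fun j c => Q.2 (j + 1) (Sum.inr c)) := Prod.ext rfl (sub_self _).symm
    rw [h5, hA, map_sub, ← hA, ← hA, ← h1, h2, h3, sub_self]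
  -- the two maps are inverse to each other
  have hzΦ' : ∀ i j, ∀ Q ∈ U', z i j (Φ Q) = Q.2 j (Sum.inl i) := by
    intro i j
    induction j with
    | zero => exact fun Q hQ => hzΦ Q hQ i 0 (Nat.zero_le _)
    | succ j ih =>
      intro Q hQ
      have h1 : lineDeriv ℝ (fun R => z i j (Φ R)) Q (C₀ Q) =
          lineDeriv ℝ (z i j) (Φ Q) (C (Φ Q)) :=
        lineDeriv_comp_field hWo (hz i j) hU' hΦs (fun R hR => hR.2) hQ (hΦrs Q hQ) (hΦri Q)
      rw [lineDeriv_congr_of_isOpen hU' ih hQ] at h1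
      simp only [z]
      rw [Function.iterate_succ_apply']
      exact h1.symm.trans (lineDeriv_input j (Sum.inl i) Q (C₀ Q))
  have hμΨ : ∀ b j, ∀ P ∈ U, (lieDerivative C₀)^[j] (μ b) (Ψ P) = P.2 j (Sum.inl b) := by
    intro b j
    induction j with
    | zero =>
      intro P hP
      have h1 : (Matrix.of (m (Ψ P)).1).mulVec (fun b => P.2 0 (Sum.inl b)) = (m (Ψ P)).2 := by
        funext i
        have h2 := hztop P hP.1 i
        change (decouplingMatrix f₀ f φ (π (Ψ P))).mulVec _ i =
          z i (k i) P - driftDerivative f₀ f φ i (k i) (π (Ψ P))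
        rw [hπΨ P hP, h2, add_sub_cancel_left]
      exact (congrFun ((hK _ _ (hmdet _ (hΨU P hP))).1 h1) b).symm
    | succ j ih =>
      intro P hP
      have h1 : lineDeriv ℝ (fun R => (lieDerivative C₀)^[j] (μ b) (Ψ R)) P (C P) =
          lineDeriv ℝ ((lieDerivative C₀)^[j] (μ b)) (Ψ P) (C₀ (Ψ P)) :=
        lineDeriv_comp_field hU' (hμjs b j) hU hΨs hΨU hP (fun l => l.elim0) (hΨr P hP)
      rw [lineDeriv_congr_of_isOpen hU ih hP] at h1
      rw [Function.iterate_succ_apply']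
      exact h1.symm.trans (lineDeriv_input j (Sum.inl b) P (C P))
  have hP₀U : P₀ ∈ U := ⟨hP₀, hε0⟩
  refine ⟨U, Ψ, ⟨⟨P₀, hP₀U⟩, U', Φ, ?_⟩, hP₀U, ?_⟩
  · exact
      { isOpen_source := hU
        isOpen_target := hU'
        source_subset := hUX
        target_subset := fun Q _ => ⟨Set.mem_univ _, Set.mem_univ _⟩
        mapsTo := hΨU
        mapsTo_inv := hΦU'
        leftInv := by
          intro P hP
          have h1 : (Φ (Ψ P)).1 = P.1 :=
            (congrArg Prod.fst (hπΨ P hP) : (π (Ψ P)).1 = (projB P).1)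
          refine Prod.ext h1 (funext fun j => funext fun s => ?_)
          rcases s with b | c
          · exact hμΨ b j P hP
          · rfl
        rightInv := by
          intro Q hQ
          refine Prod.ext (Subsingleton.elim _ _) (funext fun j => funext fun s => ?_)
          rcases s with i | c
          · exact hzΦ' i j Q hQ
          · rfl
        smooth_state := hΨs.state
        smooth_input := hΨs.input
        smooth_inv_state := hΦs.state
        smooth_inv_input := hΦs.input
        related_state := fun _ _ i => i.elim0
        related_input := hΨr
        related_inv_state := hΦrs
        related_inv_input := fun Q _ => hΦri Q }
  · intro Q _
    rfl

/-- The restriction of a Lie-Bäcklund chart to a smaller open set is a Lie-Bäcklund chart. -/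
theorem IsLieBacklundChart.restrict {n : ℕ} {ι : Type} [Fintype ι] {X : Set (Fin n → ℝ)}
    {g : (Fin n → ℝ) → (ι → ℝ) → Fin n → ℝ} {U : Set (Jet n ι)} {ψ : Jet n ι → Jet 0 ι}
    (h : IsLieBacklundChart X g U ψ) {G : Set (Jet n ι)} (hG : IsOpen G) (hUG : (U ∩ G).Nonempty) :
    IsLieBacklundChart X g (U ∩ G) ψ := by
  obtain ⟨-, U', Φ, h⟩ := h
  have hΦs : IsSmoothField Φ U' := ⟨h.smooth_inv_state, h.smooth_inv_input⟩
  have hΦc : ContinuousOn Φ U' :=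
    (continuousOn_pi.2 fun i => JetSmoothMapOn.continuousOn (hΦs.state i)).prodMk
      (continuousOn_pi.2 fun k => continuousOn_pi.2 fun j =>
        JetSmoothMapOn.continuousOn (hΦs.input k j))
  have hsub : U ∩ G ⊆ U := Set.inter_subset_left
  have hsub' : U' ∩ Φ ⁻¹' G ⊆ U' := Set.inter_subset_left
  exact ⟨hUG, U' ∩ Φ ⁻¹' G, Φ,
    { isOpen_source := h.isOpen_source.inter hG
      isOpen_target := hΦc.isOpen_inter_preimage h.isOpen_target hG
      source_subset := hsub.trans h.source_subset
      target_subset := hsub'.trans h.target_subset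
      mapsTo := fun P hP => ⟨h.mapsTo hP.1, by
        rw [Set.mem_preimage, h.leftInv P hP.1]
        exact hP.2⟩
      mapsTo_inv := fun Q hQ => ⟨h.mapsTo_inv hQ.1, hQ.2⟩
      leftInv := fun P hP => h.leftInv P hP.1
      rightInv := fun Q hQ => h.rightInv Q hQ.1
      smooth_state := fun i => JetSmoothMapOn.mono (h.smooth_state i) hsub
      smooth_input := fun k j => JetSmoothMapOn.mono (h.smooth_input k j) hsub
      smooth_inv_state := fun i => JetSmoothMapOn.mono (h.smooth_inv_state i) hsub'
      smooth_inv_input := fun k j => JetSmoothMapOn.mono (h.smooth_inv_input k j) hsub'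
      related_state := fun P hP => h.related_state P hP.1
      related_input := fun P hP => h.related_input P hP.1
      related_inv_state := fun Q hQ => h.related_inv_state Q hQ.1
      related_inv_input := fun Q hQ => h.related_inv_input Q hQ.1 }⟩

end Flatness

/-- A Lie-Bäcklund chart around `P` can be restricted to the jets over an open dense set of states,
so that `P` is an apparent singularity if its state does not belong to some such set. -/
theorem IsLieBacklundChart.isApparentSingularity {n : ℕ} {ι : Type} [Fintype ι]
    {X : Set (Fin n → ℝ)} {g : (Fin n → ℝ) → (ι → ℝ) → Fin n → ℝ} {U : Set (Jet n ι)}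
    {ψ : Jet n ι → Jet 0 ι} (h : IsLieBacklundChart X g U ψ) {P : Jet n ι} (hP : P ∈ U)
    {G : Set (Fin n → ℝ)} (hG : IsOpen G) (hGX : X ⊆ closure G) (hPG : P.1 ∉ G) :
    IsApparentSingularity X g P := by
  refine ⟨⟨U ∩ Prod.fst ⁻¹' G, ψ, h.restrict (hG.preimage continuous_fst) ?_,
    fun hP' => hPG hP'.2⟩, U, ψ, h, hP⟩
  obtain ⟨-, U', Φ, h⟩ := h
  obtain ⟨x, hxU, hxG⟩ := mem_closure_iff.1 (hGX (h.source_subset hP).1)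
    ((fun x => (x, P.2)) ⁻¹' U) (h.isOpen_source.preimage (by fun_prop)) hP
  exact ⟨(x, P.2), hxU, hxG⟩

/-- The assumptions on the distributions `Γᵃ_k` in terms of the iterated brackets. -/
theorem isRegularOn_of_Gamma {n r q : ℕ} {X : Set (Fin n → ℝ)} {f₀ : (Fin n → ℝ) → Fin n → ℝ}
    {f : Fin r ⊕ Fin q → (Fin n → ℝ) → Fin n → ℝ} {D : Set (Jet n (Fin q))} {ρ : ℕ → ℕ} {p : ℕ}
    (hX : IsOpen X) (hf₀ : ContDiffOn ℝ ∞ f₀ X) (hf : ∀ i, ContDiffOn ℝ ∞ (f i) X)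
    (hD : IsOpen D) (hDX : D ⊆ X ×ˢ Set.univ)
    (hdim : ∀ k, ∀ P ∈ D, dimAt (Gamma X f₀ f k) P = ρ k)
    (hinv : ∀ k, IsInvolutiveOn (Gamma X f₀ f k) D)
    (hfull : ∀ P ∈ D, valuesAt (Gamma X f₀ f p) P = {v | v.2 = 0})
    {P : Jet n (Fin q)} (hP : P ∈ D)
    (hr : Module.finrank ℝ (Submodule.span ℝ (Set.range fun i => f (Sum.inl i) P.1)) = r) :
    IsRegularOn X f₀ f D ρ p where
  isOpen_states := hX
  smooth_drift := hf₀
  smooth_fields := hf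
  isOpen := hD
  subset := hDX
  nonempty := ⟨P, hP⟩
  finrank_eq k Q hQ := (dimAt_Gamma hX hf₀ hf k (hDX hQ).1).symm.trans (hdim k Q hQ)
  involutive L Q hQ i m i' m' hm hm' := by
    obtain ⟨l, rfl⟩ : ∃ l, L = l + 1 := ⟨L - 1, by omega⟩
    obtain ⟨γ, hγ, h⟩ := hinv l _ (iteratedBracket_mem_Gamma i (by omega : m ≤ l)) _
      (iteratedBracket_mem_Gamma i' (by omega : m' ≤ l)) Q hQ
    rw [← h]
    exact (mem_levelSpan_of_mem_Gamma hX hf₀ hf hγ (hDX hQ).1).1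
  base := by
    have h1 : (fun a : Fin r × ℕ => (iteratedBracket f₀ f a.1 a.2 P).1) '' {a | a.2 < 0 + 1} =
        Set.range fun i => f (Sum.inl i) P.1 := by
      ext v
      constructor
      · rintro ⟨⟨i, m⟩, hm, rfl⟩
        obtain rfl : m = 0 := Nat.lt_one_iff.1 hm
        exact ⟨i, rfl⟩
      · rintro ⟨i, rfl⟩
        exact ⟨(i, 0), Nat.one_pos, rfl⟩
    rw [← hdim 0 P hP, dimAt_Gamma hX hf₀ hf 0 (hDX hP).1, levelSpan, h1, hr]
  full Q hQ := by
    rw [eq_top_iff]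
    intro v _
    have hv : ((v, 0) : Jet n (Fin q)) ∈ valuesAt (Gamma X f₀ f p) Q := by
      rw [hfull Q hQ]
      rfl
    obtain ⟨γ, hγ, h⟩ := hv
    have h1 := (mem_levelSpan_of_mem_Gamma hX hf₀ hf hγ (hDX hQ).1).1
    rwa [h] at h1

end AffineFlat

theorem mainTheorem2 (n p : ℕ) (hp : 1 < p) (hpn : p ≤ n)
    -- the system `x' = f₀(x) + ∑ uᵢ fᵢ(x)` with `n - 1` inputs, in a chart `X ⊆ ℝⁿ`
    (X : Set (Fin n → ℝ)) (hX : IsOpen X)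
    (f₀ : (Fin n → ℝ) → Fin n → ℝ) (hf₀ : ContDiffOn ℝ ∞ f₀ X)
    (f : Fin (n - p) ⊕ Fin (p - 1) → (Fin n → ℝ) → Fin n → ℝ)
    (hf : ∀ i, ContDiffOn ℝ ∞ (f i) X)
    (hgen : ∃ G ⊆ X, IsOpen G ∧ X ⊆ closure G ∧
      ∀ x ∈ G, LinearIndependent ℝ (fun i => f i x))
    -- the rank drop at `x₀`
    (x₀ : Fin n → ℝ)
    (hdrop : Module.finrank ℝ (Submodule.span ℝ (Set.range fun i => f i x₀)) = n - p)
    (hspan : Submodule.span ℝ (Set.range fun i => f i x₀) =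
      Submodule.span ℝ (Set.range fun i => f (Sum.inl i) x₀))
    -- the neighborhood `V` of `x₀` and the open dense set `O` of values of `(u_b, u_b', ...)`
    (V : Set (Fin n → ℝ)) (hV : IsOpen V) (hx₀ : x₀ ∈ V) (hVX : V ⊆ X)
    (O : Set (ℕ → Fin (p - 1) → ℝ)) (hO : IsOpen O) (hOd : Dense O)
    -- (i) constant dimensions `ρ k` and involutivity
    (ρ : ℕ → ℕ) (hdim : ∀ k, ∀ P ∈ V ×ˢ O, AffineFlat.dimAt (AffineFlat.Gamma X f₀ f k) P = ρ k)
    (hinv : ∀ k, AffineFlat.IsInvolutiveOn (AffineFlat.Gamma X f₀ f k) (V ×ˢ O))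
    -- (ii) `Γᵃ_p` is the whole tangent space of `X`
    (hfull : ∀ P ∈ V ×ˢ O, AffineFlat.valuesAt (AffineFlat.Gamma X f₀ f p) P = {v | v.2 = 0})
    -- the Brunovský controllability indices
    (k : Fin (n - p) → ℕ) (hk : ∀ i, k i = AffineFlat.brunovskyIndex ρ i) :
    (Antitone k ∧ (∀ i, k i ≤ p + 1) ∧ ∑ i, k i = n) ∧
    (∀ P ∈ V ×ˢ O, ∃ W ⊆ V ×ˢ O, IsOpen W ∧ P ∈ W ∧
      ∃ φ : ∀ i, (Fin n → ℝ) × (Fin (k i - 2) → Fin (p - 1) → ℝ) → ℝ,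
        AffineFlat.IsBrunovskyFamily X f₀ f k W φ) ∧
    (∀ W ⊆ V ×ˢ O, IsOpen W →
      ∀ φ : ∀ i, (Fin n → ℝ) × (Fin (k i - 2) → Fin (p - 1) → ℝ) → ℝ,
        AffineFlat.IsBrunovskyFamily X f₀ f k W φ →
        ∀ P, AffineFlat.projB P ∈ W →
          AffineFlat.IsFlatOutputAt X (AffineFlat.affineSystem f₀ f)
            (AffineFlat.brunovskyOutput φ) P) ∧
    (∀ P, P.1 = x₀ → (AffineFlat.projB P).2 ∈ O →
      AffineFlat.IsApparentSingularity X (AffineFlat.affineSystem f₀ f) P) := by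
  have hDX : V ×ˢ O ⊆ X ×ˢ (Set.univ : Set (ℕ → Fin (p - 1) → ℝ)) :=
    Set.prod_mono hVX (Set.subset_univ O)
  obtain ⟨o, ho⟩ := hOd.nonempty
  have h := AffineFlat.isRegularOn_of_Gamma hX hf₀ hf (hV.prod hO) hDX hdim hinv
    hfull (P := (x₀, o)) ⟨hx₀, ho⟩ (hspan ▸ hdrop)
  have hkpos : ∀ i, 0 < k i := fun i => (hk i).symm ▸ h.index_pos i
  have hksum : ∑ i, k i = n := (Finset.sum_congr rfl fun i _ => hk i).trans h.sum_index
  refine ⟨⟨fun i j hij => ?_, fun i => (hk i).symm ▸ h.index_le i, hksum⟩,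
    fun P hP => h.exists_brunovskyFamily hP hk, fun W hWD hW φ hφ P hP =>
      hφ.isFlatOutputAt hX hf₀ hf hW (hWD.trans hDX) hkpos hksum hP, fun P hPx hPO => ?_⟩
  · rw [hk, hk]
    exact h.antitone_index hij
  obtain ⟨W, hWD, hW, hPW, φ, hφ⟩ :=
    h.exists_brunovskyFamily (P := AffineFlat.projB P) ⟨hPx.symm ▸ hx₀, hPO⟩ hk
  obtain ⟨U, ψ, hψ, hPU, -⟩ := hφ.isFlatOutputAt hX hf₀ hf hW (hWD.trans hDX) hkpos hksum hPW
  obtain ⟨G, -, hG, hGX, hGi⟩ := hgen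
  refine hψ.isApparentSingularity hPU hG hGX fun hPG => ?_
  -- at `x₀` the `n - 1` control fields span a space of dimension `n - p < n - 1` only
  have h1 := finrank_span_eq_card (hGi P.1 hPG)
  rw [hPx, hdrop, Fintype.card_sum, Fintype.card_fin, Fintype.card_fin] at h1
  omega
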